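/- **Setting.** For a measurable space $\Omega$ and $0<r\le 1$, let $\mathcal S^r(\Omega)$ be the normed space of $r$-th powers of finite signed measures, i.e. the direct limit of the spaces $L^{1/r}(\Omega,\mu)$ over all finite measures $\mu$ ordered by absolute continuity, along the isometries $\phi\mapsto\phi\,(d\mu/d\nu)^r$ for $\mu\ll\nu$. The image of $\phi\in L^{1/r}(\Omega,\mu)$ is written $\phi\mu^r$, and $\mu^r:=1\cdot\mu^r$. Let $\mathcal M^r(\Omega)$ (resp. $\mathcal P^r(\Omega)$) be the subset of all $\mu^r$ with $\mu$ a finite measure (resp. a probability measure), with tangent spaces $$T_{\mu^r}\mathcal M^r(\Omega)=\{\phi\mu^r:\phi\in L^{1/r}(\mu)\},\qquad T_{\mu^r}\mathcal P^r(\Omega)=\Big\{\phi\mu^r:\phi\in L^{1/r}(\mu),\ \int\phi\,d\mu=0\Big\}.$$ A continuous vector field on $\mathcal M^r(\Omega)$ (resp. $\mathcal P^r(\Omega)$) is a continuous map $X$ from it to $\mathcal S^r(\Omega)$ with $X_{\mu^r}$ tangent at $\mu^r$ for all $\mu^r$. A covariant $n$-tensor on it is a collection of $n$-multilinear forms $\Psi_{\mu^r}$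 on the tangent spaces such that $\mu^r\mapsto\Psi_{\mu^r}(X^1_{\mu^r},\dots,X^n_{\mu^r})$ is continuous for all continuous vector fields $X^1,\dots,X^n$. A Markov kernel $K:\Omega\to\mathcal P(\Omega')$ acts on finite signed measures by $K_*\nu(A')=\int K(\omega;A')\,d\nu(\omega)$; it is *congruent* if for some measurable $\kappa:\Omega'\to\Omega$ one has $\kappa_*K(\omega)=\delta_\omega$ for all $\omega$. Put $\mu'=K_*\mu$. The formal derivative of $K_r:\mu^r\mapsto\mu'^r$ is $d_{\mu^r}K_r(\phi\mu^r)=\frac{d\{K_*(\phi\mu)\}}{d\mu'}\,\mu'^r$, and the pull-back of an $n$-tensor is $(K_r^*\Psi)_{\mu^r}(V_1,\dots,V_n)=\Psi_{\mu'^r}(dK_r V_1,\dots,dK_rV_n)$. For $m\le 1/r$ the canonical $m$-tensor is $(\tau^m_{\Omega;r})_{\mu^r}(\phi_1\mu^r,\dots,\phi_m\mu^r)=r^{-m}\int_\Omega\phi_1\cdots\phi_m\,d\mu$, and for a partition $\mathbf P=\{P_1,\dots,P_l\}$ of $\{1,\dots,n\}$ with all $|P_i|\le 1/r$ put $\tau^{\mathbf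 P}_{\Omega;r}(v_1,\dots,v_n)=\prod_i\tau^{|P_i|}_{\Omega;r}\big((v_j)_{j\in P_i}\big)$. **Theorem (classification of congruent families).** Let $0<r\le1$ and $n\ge1$, and let $(\Theta^n_{\Omega;r})$ be a family of covariant $n$-tensors on $\mathcal M^r(\Omega)$ (resp. on $\mathcal P^r(\Omega)$), one for each measurable space $\Omega$. The following are equivalent: 1. The family is congruent: $K_r^*\Theta^n_{\Omega';r}=\Theta^n_{\Omega;r}$ for every congruent Markov kernel $K:\Omega\to\mathcal P(\Omega')$. 2. $K_r^*\Theta^n_{\Omega;r}=\Theta^n_{I;r}$ for every congruent Markov kernel $K:I\to\mathcal P(\Omega)$ with $I$ a finite set (with the $\sigma$-algebra of all subsets). 3. On $\mathcal M^r$: there are uniquely determined continuous functions $a_{\mathbf P}:(0,\infty)\to\mathbb R$, one for each partition $\mathbf P$ of $\{1,\dots,n\}$ with all blocks of size $\le1/r$, such that for all $\Omega$ and $\mu$ $$(\Theta^n_{\Omega;r})_{\mu^r}=\sum_{\mathbf P}a_{\mathbf P}(\|\mu\|)\,(\tau^{\mathbf P}_{\Omega;r})_{\mu^r},\qquad \|\mu\|=\mu(\Omega)$$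 (for $\mu=0$ the tangent space is zero and both sides are read as $0$). Resp., on $\mathcal P^r$: there are uniquely determined constants $c_{\mathbf P}\in\mathbb R$, one for each partition with all blocks of size between $2$ and $1/r$, such that $\Theta^n_{\Omega;r}=\sum_{\mathbf P}c_{\mathbf P}\,\tau^{\mathbf P}_{\Omega;r}$ for all $\Omega$. **Consequence.** Let $k=1/r$, and let $(\Theta^n_{\Omega;r})$ be a congruent family on $\mathcal M^r$ (resp. $\mathcal P^r$). Then for the functions $a_{\mathbf P}$ (resp. constants $c_{\mathbf P}$) in 3 the following holds for every $k$-integrable parametrized measure model (resp. statistical model) $(M,\Omega,\mathbf p)$, i.e. for every manifold $M$ without boundary, of finite or infinite dimension, and every map $\mathbf p$ from $M$ to the finite measures (resp. probability measures) on $\Omega$ such that $\mathbf p:M\to\mathcal S(\Omega)=\mathcal S^1(\Omega)$ and $\mathbf p^{1/k}:M\to\mathcal S^{1/k}(\Omega)$ are continuously Fréchet differentiable: for all $\xi\in M$ the differential $d_\xi\mathbf p^{1/k}$ takes values in the tangent space at $\mathbf p(\xi)^{1/k}$, and $$(\mathbf p^{1/k})^*\Theta^n_{\Omega;1/k}=\sum_{\mathbf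 P}a_{\mathbf P}(\|\mathbf p\|)\,\tau^{\mathbf P}_{(M,\Omega,\mathbf p)}\qquad\Big(\text{resp. }\sum_{\mathbf P}c_{\mathbf P}\,\tau^{\mathbf P}_{(M,\Omega,\mathbf p)}\Big),$$ where $\tau^{\mathbf P}_{(M,\Omega,\mathbf p)}(V_1,\dots,V_n)=\prod_i\tau^{|P_i|}_{(M,\Omega,\mathbf p)}\big((V_j)_{j\in P_i}\big)$ and $\tau^m_{(M,\Omega,\mathbf p)}=(\mathbf p^{1/k})^*\tau^m_{\Omega;1/k}$, $m\le k$, are the canonical tensors of the model. That is, the invariant tensor field is algebraically generated by the canonical tensors $\tau^m_{(M,\Omega,\mathbf p)}$ with $m\le k$. -/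

import Mathlib

universe u v w

open MeasureTheory ProbabilityTheory Set
open scoped ENNReal Manifold Topology

noncomputable section

namespace CongruentTensors

/-! ### The spaces of powers of finite signed measures -/

/-- The exponents `r` with `0 < r ≤ 1`. -/
abbrev Exponent : Type := Set.Ioc (0 : ℝ) 1

/-- The integrability exponent `1 / r` attached to `r`. -/
def Exponent.inv (r : Exponent) : ℝ≥0∞ := ENNReal.ofReal (1 / (r : ℝ))

theorem Exponent.one_le_inv (r : Exponent) : 1 ≤ r.inv := by
  rw [Exponent.inv, ← ENNReal.ofReal_one]
  exact ENNReal.ofReal_le_ofReal ((one_le_div r.2.1).2 r.2.2)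

theorem Exponent.inv_ne_top (r : Exponent) : r.inv ≠ ⊤ := ENNReal.ofReal_ne_top

theorem Exponent.inv_ne_zero (r : Exponent) : r.inv ≠ 0 :=
  (zero_lt_one.trans_le r.one_le_inv).ne'

theorem Exponent.toReal_inv (r : Exponent) : r.inv.toReal = 1 / (r : ℝ) :=
  ENNReal.toReal_ofReal (one_div_nonneg.2 r.2.1.le)

instance (r : Exponent) : Fact (1 ≤ r.inv) := ⟨r.one_le_inv⟩

/-- Finite (nonnegative) measures on `Ω`, to be preordered by absolute continuity. -/
structure FinMeas (Ω : Type u) [MeasurableSpace Ω] : Type u where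
  /-- The underlying measure. -/
  toMeasure : Measure Ω
  /-- The total mass is finite. -/
  isFinite : IsFiniteMeasure toMeasure

section Powers

variable {Ω : Type u} [MeasurableSpace Ω]

instance (μ : FinMeas Ω) : IsFiniteMeasure μ.1 := μ.2

/-- The preorder `μ ≤ ν :↔ μ ≪ ν`. -/
instance : Preorder (FinMeas Ω) where
  le μ ν := μ.1 ≪ ν.1
  le_refl _ := Measure.AbsolutelyContinuous.rfl
  le_trans _ _ _ h₁ h₂ := Measure.AbsolutelyContinuous.trans h₁ h₂

theorem FinMeas.le_def {μ ν : FinMeas Ω} : μ ≤ ν ↔ μ.1 ≪ ν.1 := Iff.rfl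

instance : Nonempty (FinMeas Ω) := ⟨⟨0, inferInstance⟩⟩

instance : IsDirectedOrder (FinMeas Ω) where
  directed μ ν := ⟨⟨μ.1 + ν.1, inferInstance⟩,
    (Measure.le_add_right le_rfl).absolutelyContinuous,
    (Measure.le_add_left le_rfl).absolutelyContinuous⟩

/-- The total mass `‖μ‖ = μ(Ω)`. -/
def FinMeas.mass (μ : FinMeas Ω) : ℝ := μ.1.real Set.univ

theorem eLpNorm_rescale (r : Exponent) {μ ν : FinMeas Ω} (h : μ ≤ ν) {φ : Ω → ℝ}
    (hφ : StronglyMeasurable φ) :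
    eLpNorm (fun x => φ x * ((μ.1.rnDeriv ν.1 x).toReal) ^ (r : ℝ)) r.inv ν.1
      = eLpNorm φ r.inv μ.1 := by
  have hr : (0 : ℝ) < r := r.2.1
  rw [eLpNorm_eq_lintegral_rpow_enorm_toReal r.inv_ne_zero r.inv_ne_top,
    eLpNorm_eq_lintegral_rpow_enorm_toReal r.inv_ne_zero r.inv_ne_top, r.toReal_inv]
  congr 1
  rw [← lintegral_rnDeriv_mul h (hφ.measurable.enorm.pow_const _).aemeasurable]
  refine lintegral_congr_ae ?_
  filter_upwards [Measure.rnDeriv_lt_top μ.1 ν.1] with x hx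
  rw [enorm_mul, ENNReal.mul_rpow_of_nonneg _ _ (by positivity), mul_comm]
  congr 1
  rw [Real.enorm_eq_ofReal (by positivity), ENNReal.ofReal_rpow_of_nonneg (by positivity)
    (by positivity), ← Real.rpow_mul (by positivity), mul_one_div_cancel hr.ne', Real.rpow_one,
    ENNReal.ofReal_toReal hx.ne]

theorem memLp_rescale (r : Exponent) {μ ν : FinMeas Ω} (h : μ ≤ ν) (φ : Lp ℝ r.inv μ.1) :
    MemLp (fun x => φ x * ((μ.1.rnDeriv ν.1 x).toReal) ^ (r : ℝ)) r.inv ν.1 := by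
  refine ⟨?_, ?_⟩
  · exact ((Lp.stronglyMeasurable φ).measurable.mul
      ((Measure.measurable_rnDeriv _ _).ennreal_toReal.pow_const _)).aestronglyMeasurable
  · rw [eLpNorm_rescale r h (Lp.stronglyMeasurable φ)]
    exact Lp.eLpNorm_lt_top φ

theorem ae_imp_rescale (r : Exponent) {μ : FinMeas Ω} (ν : FinMeas Ω) {f g : Ω → ℝ}
    (hfg : f =ᵐ[μ.1] g) :
    (fun x => f x * ((μ.1.rnDeriv ν.1 x).toReal) ^ (r : ℝ))
      =ᵐ[ν.1] fun x => g x * ((μ.1.rnDeriv ν.1 x).toReal) ^ (r : ℝ) := by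
  filter_upwards [Measure.ae_rnDeriv_ne_zero_imp_of_ae ν.1 hfg] with x hx
  by_cases h0 : μ.1.rnDeriv ν.1 x = 0
  · simp [h0, Real.zero_rpow r.2.1.ne']
  · rw [hx h0]

/-- For `μ ≪ ν`, the isometric map `L^{1/r}(μ) → L^{1/r}(ν)`, `φ ↦ φ (dμ/dν)^r`, which expresses
`φ μ^r` in terms of `ν^r`. -/
def rescale (r : Exponent) {μ ν : FinMeas Ω} (h : μ ≤ ν) :
    Lp ℝ r.inv μ.1 →ₗ[ℝ] Lp ℝ r.inv ν.1 where
  toFun φ := (memLp_rescale r h φ).toLp _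
  map_add' φ ψ := by
    rw [← MemLp.toLp_add, MemLp.toLp_eq_toLp_iff]
    refine (ae_imp_rescale r ν (Lp.coeFn_add φ ψ)).trans (ae_of_all _ fun x => ?_)
    simp [add_mul]
  map_smul' c φ := by
    rw [RingHom.id_apply, ← MemLp.toLp_const_smul, MemLp.toLp_eq_toLp_iff]
    refine (ae_imp_rescale r ν (Lp.coeFn_smul c φ)).trans (ae_of_all _ fun x => ?_)
    simp [mul_assoc]

theorem coeFn_rescale (r : Exponent) {μ ν : FinMeas Ω} (h : μ ≤ ν) (φ : Lp ℝ r.inv μ.1) :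
    rescale r h φ =ᵐ[ν.1] fun x => φ x * ((μ.1.rnDeriv ν.1 x).toReal) ^ (r : ℝ) :=
  MemLp.coeFn_toLp (memLp_rescale r h φ)

theorem norm_rescale (r : Exponent) {μ ν : FinMeas Ω} (h : μ ≤ ν) (φ : Lp ℝ r.inv μ.1) :
    ‖rescale r h φ‖ = ‖φ‖ := by
  rw [Lp.norm_def, Lp.norm_def, eLpNorm_congr_ae (coeFn_rescale r h φ),
    eLpNorm_rescale r h (Lp.stronglyMeasurable φ)]

instance (r : Exponent) : DirectedSystem (fun μ : FinMeas Ω => Lp ℝ r.inv μ.1)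
    (fun _ _ h => rescale r h) where
  map_self μ φ := by
    refine Lp.ext ((coeFn_rescale r le_rfl φ).trans ?_)
    filter_upwards [Measure.rnDeriv_self μ.1] with x hx
    simp [hx]
  map_map κ ν μ h₁ h₂ φ := by
    refine Lp.ext ((coeFn_rescale r _ _).trans ?_)
    refine (ae_imp_rescale r κ (coeFn_rescale r h₁ φ)).trans ?_
    refine Filter.EventuallyEq.trans ?_ (coeFn_rescale r _ φ).symm
    filter_upwards [Measure.rnDeriv_mul_rnDeriv (κ := κ.1) h₁] with x hx
    rw [← hx, Pi.mul_apply, ENNReal.toReal_mul, Real.mul_rpow (by positivity) (by positivity),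
      mul_assoc]

open Classical in
/-- The space `S^r(Ω)` of `r`-th powers of finite signed measures: the direct limit of the spaces
`L^{1/r}(Ω, μ)` over all finite measures `μ`, where for `μ ≪ ν` the element `φ ∈ L^{1/r}(Ω, μ)` is
identified with `φ (dμ/dν)^r ∈ L^{1/r}(Ω, ν)`. For `r = 1` this is the space of finite signed
measures, with the norm of total variation. -/
def RootMeas (r : Exponent) (Ω : Type u) [MeasurableSpace Ω] : Type u :=
  Module.DirectLimit (fun μ : FinMeas Ω => Lp ℝ r.inv μ.1) (fun _ _ h => rescale r h)

/-- The vector space structure of `S^r(Ω)`. -/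
instance (r : Exponent) : AddCommGroup (RootMeas r Ω) := by
  classical
  exact inferInstanceAs (AddCommGroup
    (Module.DirectLimit (fun μ : FinMeas Ω => Lp ℝ r.inv μ.1) (fun _ _ h => rescale r h)))

instance (r : Exponent) : Module ℝ (RootMeas r Ω) := by
  classical
  exact inferInstanceAs (Module ℝ
    (Module.DirectLimit (fun μ : FinMeas Ω => Lp ℝ r.inv μ.1) (fun _ _ h => rescale r h)))

open Classical in
/-- The inclusion `L^{1/r}(Ω, μ) → S^r(Ω)`, `φ ↦ φ μ^r`, whose image is the space `S^r(Ω; μ)` of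
elements dominated by `μ`. -/
def densityPow (r : Exponent) (μ : FinMeas Ω) : Lp ℝ r.inv μ.1 →ₗ[ℝ] RootMeas r Ω :=
  Module.DirectLimit.of ℝ (FinMeas Ω) (fun μ : FinMeas Ω => Lp ℝ r.inv μ.1)
    (fun _ _ h => rescale r h) μ

theorem densityPow_rescale (r : Exponent) {μ ν : FinMeas Ω} (h : μ ≤ ν) (φ : Lp ℝ r.inv μ.1) :
    densityPow r ν (rescale r h φ) = densityPow r μ φ := by
  classical
  exact Module.DirectLimit.of_f

theorem exists_densityPow (r : Exponent) (x : RootMeas r Ω) :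
    ∃ (μ : FinMeas Ω) (φ : Lp ℝ r.inv μ.1), densityPow r μ φ = x := by
  classical
  exact Module.DirectLimit.exists_of x

theorem exists_densityPow₂ (r : Exponent) (x y : RootMeas r Ω) :
    ∃ (μ : FinMeas Ω) (φ ψ : Lp ℝ r.inv μ.1), densityPow r μ φ = x ∧ densityPow r μ ψ = y := by
  classical
  exact Module.DirectLimit.exists_of₂ x y

theorem norm_eq_of_densityPow_eq (r : Exponent) {μ ν : FinMeas Ω} {φ : Lp ℝ r.inv μ.1}
    {ψ : Lp ℝ r.inv ν.1} (h : densityPow r μ φ = densityPow r ν ψ) : ‖φ‖ = ‖ψ‖ := by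
  classical
  obtain ⟨κ, h₁, h₂⟩ := exists_ge_ge μ ν
  have h' : densityPow r κ (rescale r h₁ φ) = densityPow r κ (rescale r h₂ ψ) := by
    rw [densityPow_rescale, densityPow_rescale, h]
  obtain ⟨ρ, h₃, h₄⟩ := Module.DirectLimit.exists_eq_of_of_eq h'
  rw [← norm_rescale r h₁, ← norm_rescale r h₃, h₄, norm_rescale, norm_rescale]

/-- The norm `‖φ μ^r‖ = ‖φ‖_{L^{1/r}(μ)}` of `S^r(Ω)`. -/
instance (r : Exponent) : Norm (RootMeas r Ω) where
  norm x := ‖(exists_densityPow r x).choose_spec.choose‖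

theorem norm_densityPow (r : Exponent) (μ : FinMeas Ω) (φ : Lp ℝ r.inv μ.1) :
    ‖densityPow r μ φ‖ = ‖φ‖ :=
  norm_eq_of_densityPow_eq r (exists_densityPow r (densityPow r μ φ)).choose_spec.choose_spec

theorem normCore (r : Exponent) : NormedSpace.Core ℝ (RootMeas r Ω) where
  norm_nonneg _ := norm_nonneg (_ : Lp ℝ r.inv _)
  norm_smul c x := by
    obtain ⟨μ, φ, rfl⟩ := exists_densityPow r x
    rw [← map_smul, norm_densityPow, norm_densityPow, norm_smul]
  norm_triangle x y := by
    obtain ⟨μ, φ, ψ, rfl, rfl⟩ := exists_densityPow₂ r x y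
    rw [← map_add, norm_densityPow, norm_densityPow, norm_densityPow]
    exact norm_add_le φ ψ
  norm_eq_zero_iff x := by
    obtain ⟨μ, φ, rfl⟩ := exists_densityPow r x
    rw [norm_densityPow, norm_eq_zero]
    refine ⟨fun h => by rw [h, map_zero], fun h => ?_⟩
    rw [← norm_eq_zero, ← norm_densityPow, h, ← map_zero (densityPow r μ), norm_densityPow,
      norm_zero]

instance (r : Exponent) : NormedAddCommGroup (RootMeas r Ω) := NormedAddCommGroup.ofCore (normCore r)

instance (r : Exponent) : NormedSpace ℝ (RootMeas r Ω) := NormedSpace.ofCore (normCore r)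

/-- The `r`-th power `μ^r ∈ S^r(Ω)` of a finite measure `μ`. -/
def rootPow (r : Exponent) (μ : FinMeas Ω) : RootMeas r Ω :=
  densityPow r μ (Lp.const r.inv μ.1 (1 : ℝ))

end Powers

/-! ### Markov kernels and the formal derivative -/

section Markov

variable {Ω Ω' : Type u} [MeasurableSpace Ω] [MeasurableSpace Ω']

/-- The image `K_* μ` of a finite measure under a Markov kernel,
`K_* μ(A') = ∫ K(ω; A') dμ(ω)`. -/
def FinMeas.push (K : Kernel Ω Ω') [IsMarkovKernel K] (μ : FinMeas Ω) : FinMeas Ω' :=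
  ⟨K ∘ₘ μ.1, inferInstance⟩

/-- The Markov morphism `K_* : S(Ω) → S(Ω')` on finite signed measures,
`K_* ν(A') = ∫ K(ω; A') dν(ω)`, computed through the Jordan decomposition `ν = ν⁺ - ν⁻`. -/
def markovMorphism (K : Kernel Ω Ω') [IsMarkovKernel K] (ν : SignedMeasure Ω) :
    SignedMeasure Ω' :=
  (K ∘ₘ ν.toJordanDecomposition.posPart).toSignedMeasure
    - (K ∘ₘ ν.toJordanDecomposition.negPart).toSignedMeasure

/-- A Markov kernel `K : Ω → P(Ω')` is congruent if `κ_* K(ω) = δ_ω` for all `ω`, for some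
statistic (measurable map) `κ : Ω' → Ω`. -/
def IsCongruentKernel (K : Kernel Ω Ω') : Prop :=
  ∃ κ : Ω' → Ω, Measurable κ ∧ ∀ ω, (K ω).map κ = Measure.dirac ω

theorem integrable_of_Lp (r : Exponent) (μ : FinMeas Ω) (φ : Lp ℝ r.inv μ.1) :
    Integrable φ μ.1 :=
  (Lp.memLp φ).integrable r.one_le_inv

theorem markovMorphism_sub (K : Kernel Ω Ω') [IsMarkovKernel K] (α β : Measure Ω)
    [IsFiniteMeasure α] [IsFiniteMeasure β] :
    markovMorphism K (α.toSignedMeasure - β.toSignedMeasure)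
      = (K ∘ₘ α).toSignedMeasure - (K ∘ₘ β).toSignedMeasure := by
  set ν := α.toSignedMeasure - β.toSignedMeasure with hν
  set p := ν.toJordanDecomposition.posPart with hp
  set q := ν.toJordanDecomposition.negPart with hq
  have h1 : p.toSignedMeasure - q.toSignedMeasure = α.toSignedMeasure - β.toSignedMeasure :=
    ν.toSignedMeasure_toJordanDecomposition
  have h2 : p + β = α + q := by
    rw [← Measure.toSignedMeasure_eq_toSignedMeasure_iff, Measure.toSignedMeasure_add,
      Measure.toSignedMeasure_add]
    rwa [sub_eq_sub_iff_add_eq_add] at h1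
  have h3 : K ∘ₘ p + K ∘ₘ β = K ∘ₘ α + K ∘ₘ q := by
    rw [← Measure.comp_add, h2, Measure.comp_add]
  have h4 : (K ∘ₘ p).toSignedMeasure + (K ∘ₘ β).toSignedMeasure
      = (K ∘ₘ α).toSignedMeasure + (K ∘ₘ q).toSignedMeasure := by
    rw [← Measure.toSignedMeasure_add, ← Measure.toSignedMeasure_add,
      Measure.toSignedMeasure_eq_toSignedMeasure_iff, h3]
  rw [markovMorphism, sub_eq_sub_iff_add_eq_add]
  exact h4

theorem lintegral_push_withDensity (K : Kernel Ω Ω') [IsMarkovKernel K] (μ : Measure Ω)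
    [IsFiniteMeasure μ] {f : Ω → ℝ≥0∞} (hf : Measurable f) {A : Set Ω'} (hA : MeasurableSet A) :
    (K ∘ₘ μ.withDensity f) A = ∫⁻ z in Prod.snd ⁻¹' A, f z.1 ∂(μ ⊗ₘ K) := by
  rw [Measure.bind_apply hA K.aemeasurable,
    lintegral_withDensity_eq_lintegral_mul μ hf (K.measurable_coe hA),
    ← Set.univ_prod, Measure.setLIntegral_compProd (f := fun z : Ω × Ω' => f z.1) (hf.comp measurable_fst)
      MeasurableSet.univ hA]
  simp

theorem integrable_fst_compProd (K : Kernel Ω Ω') [IsMarkovKernel K] (μ : FinMeas Ω)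
    {φ : Ω → ℝ} (hφ : Integrable φ μ.1) :
    Integrable (fun z : Ω × Ω' => φ z.1) (μ.1 ⊗ₘ K) := by
  have h : Integrable φ ((μ.1 ⊗ₘ K).map Prod.fst) := by
    rwa [← Measure.fst, Measure.fst_compProd]
  exact h.comp_measurable measurable_fst

theorem markovMorphism_withDensity_apply (K : Kernel Ω Ω') [IsMarkovKernel K] (μ : FinMeas Ω)
    {φ : Ω → ℝ} (hm : Measurable φ) (hφ : Integrable φ μ.1) {A : Set Ω'}
    (hA : MeasurableSet A) :
    markovMorphism K (μ.1.withDensityᵥ φ) A = ∫ z in Prod.snd ⁻¹' A, φ z.1 ∂(μ.1 ⊗ₘ K) := by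
  have := isFiniteMeasure_withDensity_ofReal hφ.hasFiniteIntegral
  have := isFiniteMeasure_withDensity_ofReal hφ.neg.hasFiniteIntegral
  have e := lintegral_push_withDensity K μ.1 hm.neg.ennreal_ofReal hA
  simp only [Pi.neg_apply] at e
  rw [withDensityᵥ_eq_withDensity_pos_part_sub_withDensity_neg_part hφ]
  refine (congrArg (fun s : SignedMeasure Ω' => s A) (markovMorphism_sub K _ _)).trans ?_
  rw [integral_eq_lintegral_pos_part_sub_lintegral_neg_part
      (integrable_fst_compProd K μ hφ).integrableOn,
    ← lintegral_push_withDensity K μ.1 hm.ennreal_ofReal hA,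
    ← e]
  simp [Measure.toSignedMeasure_apply, hA, Measure.real]

theorem markovMorphism_absolutelyContinuous (K : Kernel Ω Ω') [IsMarkovKernel K]
    (μ : FinMeas Ω) {φ : Ω → ℝ} (hm : Measurable φ) (hφ : Integrable φ μ.1) :
    markovMorphism K (μ.1.withDensityᵥ φ) ≪ᵥ (K ∘ₘ μ.1).toENNRealVectorMeasure := by
  refine VectorMeasure.AbsolutelyContinuous.mk fun A hA h0 => ?_
  rw [Measure.toENNRealVectorMeasure_apply_measurable hA, ← Measure.snd_compProd,
    Measure.snd_apply hA] at h0
  rw [markovMorphism_withDensity_apply K μ hm hφ hA, Measure.restrict_eq_zero.2 h0,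
    integral_zero_measure]

/-- The density `d{K_*(φ μ)}/d{K_* μ}`. -/
def pushDensity (K : Kernel Ω Ω') [IsMarkovKernel K] (μ : FinMeas Ω) (φ : Ω → ℝ) : Ω' → ℝ :=
  (markovMorphism K (μ.1.withDensityᵥ φ)).rnDeriv (μ.push K).1

theorem withDensity_pushDensity (K : Kernel Ω Ω') [IsMarkovKernel K] (μ : FinMeas Ω)
    {φ : Ω → ℝ} (hm : Measurable φ) (hφ : Integrable φ μ.1) :
    (μ.push K).1.withDensityᵥ (pushDensity K μ φ) = markovMorphism K (μ.1.withDensityᵥ φ) :=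
  SignedMeasure.withDensityᵥ_rnDeriv_eq _ (μ.push K).1
    (markovMorphism_absolutelyContinuous K μ hm hφ)

theorem integrable_pushDensity (K : Kernel Ω Ω') [IsMarkovKernel K] (μ : FinMeas Ω)
    (φ : Ω → ℝ) : Integrable (pushDensity K μ φ) (μ.push K).1 :=
  SignedMeasure.integrable_rnDeriv _ _

theorem setIntegral_pushDensity (K : Kernel Ω Ω') [IsMarkovKernel K] (μ : FinMeas Ω)
    {φ : Ω → ℝ} (hm : Measurable φ) (hφ : Integrable φ μ.1) {A : Set Ω'}
    (hA : MeasurableSet A) :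
    ∫ x in A, pushDensity K μ φ x ∂(μ.push K).1
      = ∫ z in Prod.snd ⁻¹' A, φ z.1 ∂(μ.1 ⊗ₘ K) := by
  rw [← markovMorphism_withDensity_apply K μ hm hφ hA, ← withDensity_pushDensity K μ hm hφ,
    withDensityᵥ_apply (integrable_pushDensity K μ φ) hA]

theorem map_snd_compProd (K : Kernel Ω Ω') [IsMarkovKernel K] (μ : FinMeas Ω) :
    (μ.1 ⊗ₘ K).map Prod.snd = (μ.push K).1 := by
  rw [← Measure.snd, Measure.snd_compProd]; rfl

theorem pushDensity_ae_eq_condExp (K : Kernel Ω Ω') [IsMarkovKernel K] (μ : FinMeas Ω)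
    {φ : Ω → ℝ} (hm : Measurable φ) (hφ : Integrable φ μ.1) :
    (fun z : Ω × Ω' => pushDensity K μ φ z.2)
      =ᵐ[μ.1 ⊗ₘ K] (μ.1 ⊗ₘ K)[fun z => φ z.1 | MeasurableSpace.comap Prod.snd inferInstance] := by
  have hmeas : Measurable (pushDensity K μ φ) := SignedMeasure.measurable_rnDeriv _ _
  refine ae_eq_condExp_of_forall_setIntegral_eq measurable_snd.comap_le
    (integrable_fst_compProd K μ hφ) (fun s _ _ => Integrable.integrableOn ?_) ?_ ?_
  · have h := integrable_pushDensity K μ φ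
    rw [← map_snd_compProd] at h
    exact h.comp_measurable measurable_snd
  · rintro _ ⟨A, hA, rfl⟩ _
    rw [← setIntegral_pushDensity K μ hm hφ hA, ← map_snd_compProd,
      setIntegral_map hA hmeas.aestronglyMeasurable measurable_snd.aemeasurable]
  · exact (hmeas.comp (comap_measurable Prod.snd)).aestronglyMeasurable

theorem memLp_pushDensity (r : Exponent) (K : Kernel Ω Ω') [IsMarkovKernel K] (μ : FinMeas Ω)
    (φ : Lp ℝ r.inv μ.1) : MemLp (pushDensity K μ φ) r.inv (μ.push K).1 := by
  have hm : Measurable φ := (Lp.stronglyMeasurable φ).measurable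
  have hmeas : Measurable (pushDensity K μ φ) := SignedMeasure.measurable_rnDeriv _ _
  have h1 : MemLp φ r.inv ((μ.1 ⊗ₘ K).map Prod.fst) := by
    rw [← Measure.fst, Measure.fst_compProd]
    exact Lp.memLp φ
  have h2 : MemLp (fun z : Ω × Ω' => φ z.1) r.inv (μ.1 ⊗ₘ K) :=
    h1.comp_of_map measurable_fst.aemeasurable
  have h3 := (h2.condExp (m := MeasurableSpace.comap Prod.snd inferInstance) r.one_le_inv).ae_eq
    (pushDensity_ae_eq_condExp K μ hm (integrable_of_Lp r μ φ)).symm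
  rw [← map_snd_compProd]
  exact (memLp_map_measure_iff hmeas.aestronglyMeasurable measurable_snd.aemeasurable).2 h3

theorem pushDensity_ae_unique (K : Kernel Ω Ω') [IsMarkovKernel K] (μ : FinMeas Ω)
    {φ : Ω → ℝ} (hm : Measurable φ) (hφ : Integrable φ μ.1) {g : Ω' → ℝ}
    (hg : Integrable g (μ.push K).1)
    (h : ∀ A, MeasurableSet A →
      ∫ x in A, g x ∂(μ.push K).1 = ∫ z in Prod.snd ⁻¹' A, φ z.1 ∂(μ.1 ⊗ₘ K)) :
    pushDensity K μ φ =ᵐ[(μ.push K).1] g := by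
  refine Integrable.ae_eq_of_forall_setIntegral_eq _ _ (integrable_pushDensity K μ φ) hg
    fun A hA _ => ?_
  rw [h A hA, setIntegral_pushDensity K μ hm hφ hA]

theorem ae_fst_compProd (K : Kernel Ω Ω') [IsMarkovKernel K] (μ : FinMeas Ω) {p : Ω → Prop}
    (h : ∀ᵐ x ∂μ.1, p x) : ∀ᵐ z ∂(μ.1 ⊗ₘ K), p z.1 := by
  have h' : ∀ᵐ x ∂((μ.1 ⊗ₘ K).map Prod.fst), p x := by
    rwa [← Measure.fst, Measure.fst_compProd]
  exact ae_of_ae_map measurable_fst.aemeasurable h'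

/-- The formal derivative `d_{μ^r} K_r : S^r(Ω; μ) → S^r(Ω'; μ')`, `μ' = K_* μ`, of
`K_r : μ^r ↦ (K_* μ)^r`. It maps `φ μ^r` to `(d{K_*(φ μ)}/dμ') μ'^r`. -/
def formalDeriv (r : Exponent) (K : Kernel Ω Ω') [IsMarkovKernel K] (μ : FinMeas Ω) :
    Lp ℝ r.inv μ.1 →ₗ[ℝ] Lp ℝ r.inv (μ.push K).1 where
  toFun φ := (memLp_pushDensity r K μ φ).toLp _
  map_add' φ ψ := by
    rw [← MemLp.toLp_add, MemLp.toLp_eq_toLp_iff]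
    refine pushDensity_ae_unique K μ (Lp.stronglyMeasurable _).measurable
      (integrable_of_Lp r μ _)
      ((integrable_pushDensity K μ _).add (integrable_pushDensity K μ _)) fun A hA => ?_
    have hφ := integrable_of_Lp r μ φ
    have hψ := integrable_of_Lp r μ ψ
    simp only [Pi.add_apply]
    rw [integral_add (integrable_pushDensity K μ _).integrableOn
        (integrable_pushDensity K μ _).integrableOn,
      setIntegral_pushDensity K μ (Lp.stronglyMeasurable _).measurable hφ hA,
      setIntegral_pushDensity K μ (Lp.stronglyMeasurable _).measurable hψ hA,
      ← integral_add (integrable_fst_compProd K μ hφ).integrableOn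
        (integrable_fst_compProd K μ hψ).integrableOn]
    refine integral_congr_ae (ae_restrict_of_ae ?_)
    filter_upwards [ae_fst_compProd K μ (Lp.coeFn_add φ ψ)] with z hz
    rw [hz, Pi.add_apply]
  map_smul' c φ := by
    rw [RingHom.id_apply, ← MemLp.toLp_const_smul, MemLp.toLp_eq_toLp_iff]
    refine pushDensity_ae_unique K μ (Lp.stronglyMeasurable _).measurable
      (integrable_of_Lp r μ _) ((integrable_pushDensity K μ _).smul c) fun A hA => ?_
    simp only [Pi.smul_apply]
    rw [integral_smul, setIntegral_pushDensity K μ (Lp.stronglyMeasurable _).measurable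
      (integrable_of_Lp r μ φ) hA, ← integral_smul]
    refine integral_congr_ae (ae_restrict_of_ae ?_)
    filter_upwards [ae_fst_compProd K μ (Lp.coeFn_smul c φ)] with z hz
    rw [hz, Pi.smul_apply]

theorem coeFn_formalDeriv (r : Exponent) (K : Kernel Ω Ω') [IsMarkovKernel K] (μ : FinMeas Ω)
    (φ : Lp ℝ r.inv μ.1) : formalDeriv r K μ φ =ᵐ[(μ.push K).1] pushDensity K μ φ :=
  MemLp.coeFn_toLp (memLp_pushDensity r K μ φ)

theorem integral_formalDeriv (r : Exponent) (K : Kernel Ω Ω') [IsMarkovKernel K]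
    (μ : FinMeas Ω) (φ : Lp ℝ r.inv μ.1) :
    ∫ x, formalDeriv r K μ φ x ∂(μ.push K).1 = ∫ x, φ x ∂μ.1 := by
  have h := setIntegral_pushDensity K μ (Lp.stronglyMeasurable φ).measurable
    (integrable_of_Lp r μ φ) MeasurableSet.univ
  rw [Set.preimage_univ, Measure.restrict_univ, Measure.restrict_univ] at h
  rw [integral_congr_ae (coeFn_formalDeriv r K μ φ), h]
  have h2 : ∫ x, φ x ∂((μ.1 ⊗ₘ K).map Prod.fst) = ∫ z, φ z.1 ∂(μ.1 ⊗ₘ K) :=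
    integral_map measurable_fst.aemeasurable (Lp.stronglyMeasurable φ).aestronglyMeasurable
  have h3 : ∫ x, φ x ∂((μ.1 ⊗ₘ K).map Prod.fst) = ∫ x, φ x ∂μ.1 :=
    congrArg (fun m : Measure Ω => ∫ x, φ x ∂m) (Measure.fst_compProd μ.1 K)
  rw [← h2, h3]

end Markov

/-! ### Tensor fields and congruent families -/

/-- The two settings treated in parallel: all finite measures, or probability measures. -/
inductive Setting : Type where
  /-- The setting of `M^r(Ω)`. -/
  | measures
  /-- The setting of `P^r(Ω)`. -/
  | probabilities

/-- The measures that are admitted in a setting. -/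
def Setting.Admits {Ω : Type u} [MeasurableSpace Ω] : Setting → FinMeas Ω → Prop
  | .measures, _ => True
  | .probabilities, μ => μ.1 Set.univ = 1

/-- The measures `μ` that parametrize the points `μ^r` of `M^r(Ω)` or `P^r(Ω)`. The topology, which
depends on `r`, is `powTopology`. -/
structure Point (s : Setting) (Ω : Type u) [MeasurableSpace Ω] : Type u where
  /-- The underlying finite measure. -/
  base : FinMeas Ω
  /-- It is a probability measure in the setting of probability measures. -/
  admits : s.Admits base

/-- The topology of `M^r(Ω)` resp. `P^r(Ω)` as a subset of the normed space `S^r(Ω)`. -/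
abbrev powTopology (s : Setting) (r : Exponent) (Ω : Type u) [MeasurableSpace Ω] :
    TopologicalSpace (Point s Ω) :=
  TopologicalSpace.induced (fun μ => rootPow r μ.base) inferInstance

/-- The tangent space at `μ^r`, with `φ μ^r` written as `φ`: all of `L^{1/r}(μ)` for `M^r(Ω)`, and
the `φ ∈ L^{1/r}(μ)` with `∫ φ dμ = 0` for `P^r(Ω)`. -/
def tangent {Ω : Type u} [MeasurableSpace Ω] (s : Setting) (r : Exponent) (μ : FinMeas Ω) :
    Submodule ℝ (Lp ℝ r.inv μ.1) :=
  match s with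
  | .measures => ⊤
  | .probabilities =>
    { carrier := {φ | ∫ x, φ x ∂μ.1 = 0}
      zero_mem' := by
        rw [Set.mem_ofPred_eq, integral_congr_ae (Lp.coeFn_zero ℝ r.inv μ.1)]
        simp
      add_mem' := by
        intro φ ψ hφ hψ
        rw [Set.mem_ofPred_eq] at hφ hψ ⊢
        rw [integral_congr_ae (Lp.coeFn_add φ ψ), integral_add' (integrable_of_Lp r μ φ)
          (integrable_of_Lp r μ ψ), hφ, hψ, add_zero]
      smul_mem' := by
        intro c φ hφ
        rw [Set.mem_ofPred_eq] at hφ ⊢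
        rw [integral_congr_ae (Lp.coeFn_smul c φ)]
        simp only [Pi.smul_apply]
        rw [integral_smul, hφ, smul_zero] }

/-- A continuous vector field on `M^r(Ω)` resp. `P^r(Ω)`: a continuous map `X` to `S^r(Ω)` whose
value at `μ^r` is tangent at `μ^r`. -/
structure VectorField (s : Setting) (r : Exponent) (Ω : Type u) [MeasurableSpace Ω] where
  /-- The value at `μ^r`. -/
  val : ∀ μ : Point s Ω, tangent s r μ.base
  /-- Continuity as a map to `S^r(Ω)`. -/
  continuous_val : Continuous[powTopology s r Ω, inferInstance]
    fun μ => densityPow r μ.base (val μ : Lp ℝ r.inv μ.base.1)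

/-- A covariant `n`-tensor field on `M^r(Ω)` resp. `P^r(Ω)`: an `n`-multilinear form on each tangent
space, such that evaluation on continuous vector fields gives continuous functions. -/
structure TensorField (s : Setting) (r : Exponent) (n : ℕ) (Ω : Type u) [MeasurableSpace Ω] where
  /-- The multilinear form at `μ^r`. -/
  form : ∀ μ : Point s Ω, MultilinearMap ℝ (fun _ : Fin n => tangent s r μ.base) ℝ
  /-- Continuity on continuous vector fields. -/
  continuous_form : ∀ X : Fin n → VectorField s r Ω,
    Continuous[powTopology s r Ω, inferInstance] fun μ => form μ fun i => (X i).val μ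

/-- A family of covariant `n`-tensor fields, one for every measurable space. -/
abbrev TensorFamily (s : Setting) (r : Exponent) (n : ℕ) : Type (u + 1) :=
  (Ω : Type u) → [MeasurableSpace Ω] → TensorField s r n Ω

section Pullback

variable {Ω Ω' : Type u} [MeasurableSpace Ω] [MeasurableSpace Ω']

/-- The map `K_r : μ^r ↦ (K_* μ)^r` on points. -/
abbrev Point.push {s : Setting} (K : Kernel Ω Ω') [IsMarkovKernel K] (μ : Point s Ω) :
    Point s Ω' where
  base := μ.base.push K
  admits := by
    cases s with
    | measures => trivial
    | probabilities =>
      exact (Measure.comp_apply_univ (μ := μ.base.1) (κ := K)).trans μ.admits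

/-- The formal derivative of `K_r` between tangent spaces. -/
def tangentMap (s : Setting) (r : Exponent) (K : Kernel Ω Ω') [IsMarkovKernel K]
    (μ : Point s Ω) : tangent s r μ.base →ₗ[ℝ] tangent s r (μ.push K).base :=
  (formalDeriv r K μ.base).restrict fun φ hφ => by
    cases s with
    | measures => exact Submodule.mem_top
    | probabilities =>
      exact (integral_formalDeriv r K μ.base φ).trans hφ

/-- The pull-back `K_r^* Ψ` of the field of multilinear forms `Ψ` under a Markov kernel. -/
def pullback {s : Setting} {r : Exponent} {n : ℕ} (K : Kernel Ω Ω') [IsMarkovKernel K]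
    (Ψ : TensorField s r n Ω') (μ : Point s Ω) :
    MultilinearMap ℝ (fun _ : Fin n => tangent s r μ.base) ℝ :=
  (Ψ.form (μ.push K)).compLinearMap fun _ => tangentMap s r K μ

end Pullback

/-- A congruent family: invariance under all congruent Markov kernels. -/
def IsCongruentFamily {s : Setting} {r : Exponent} {n : ℕ} (Θ : TensorFamily.{u} s r n) : Prop :=
  ∀ (Ω Ω' : Type u) [MeasurableSpace Ω] [MeasurableSpace Ω'] (K : Kernel Ω Ω')
    [IsMarkovKernel K], IsCongruentKernel K →
    ∀ μ : Point s Ω, pullback K (Θ Ω') μ = (Θ Ω).form μ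

/-- Invariance under the congruent Markov kernels `K : I → P(Ω)` with `I` a finite set, which
carries the σ-algebra of all subsets. -/
def IsFinitelyCongruentFamily {s : Setting} {r : Exponent} {n : ℕ}
    (Θ : TensorFamily.{u} s r n) : Prop :=
  ∀ (I Ω : Type u) [Finite I] [MeasurableSpace I] [DiscreteMeasurableSpace I]
    [MeasurableSpace Ω] (K : Kernel I Ω) [IsMarkovKernel K], IsCongruentKernel K →
    ∀ μ : Point s I, pullback K (Θ Ω) μ = (Θ I).form μ

/-! ### Canonical tensors -/

section Canonical

variable {Ω : Type u} [MeasurableSpace Ω]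

/-- The canonical tensor `τ^m_{Ω;r}` at `μ^r`, with its `m` arguments `φ_i μ^r` indexed by a finite
set `ι` of `m ≤ 1/r` elements. Since the product of the `φ_i μ^r` and of `(μ^r)^{1/r - m}` is the
signed measure `(∏ φ_i) μ`, its value is `r^{-m} ∫ ∏ φ_i dμ`. -/
def canonicalTensor (r : Exponent) (μ : FinMeas Ω) {ι : Type} [Fintype ι]
    (φ : ι → Lp ℝ r.inv μ.1) : ℝ :=
  1 / (r : ℝ) ^ Fintype.card ι * ∫ x, ∏ i, φ i x ∂μ.1

/-- The tensor `τ^P_{Ω;r}` of a partition `P` of the set of arguments: the product over the blocks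
of `P` of canonical tensors applied to the arguments in the block. -/
def partitionTensor (r : Exponent) (μ : FinMeas Ω) {n : ℕ}
    (P : Finpartition (Finset.univ : Finset (Fin n))) (φ : Fin n → Lp ℝ r.inv μ.1) : ℝ :=
  ∏ B ∈ P.parts, canonicalTensor r μ fun j : B => φ j

/-- Partitions of an `n`-element set all of whose blocks have at least `b` and at most `1/r`
elements. -/
abbrev BlockPartition (r : Exponent) (n b : ℕ) : Type :=
  {P : Finpartition (Finset.univ : Finset (Fin n)) //
    ∀ B ∈ P.parts, b ≤ B.card ∧ (B.card : ℝ) ≤ 1 / (r : ℝ)}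

instance (r : Exponent) (n b : ℕ) : Fintype (BlockPartition r n b) := Fintype.ofFinite _

/-- The value at a mass `m` of a coefficient function on `(0, ∞)`. (The measure of mass `0` has the
zero tangent space, so that the value given to `m = 0` plays no role.) -/
def coeffAt (a : C(Set.Ioi (0 : ℝ), ℝ)) (m : ℝ) : ℝ :=
  if h : 0 < m then a ⟨m, h⟩ else 0

/-- The tensor `∑_P a_P(‖μ‖) τ^P_{Ω;r}` at `μ^r`, over partitions with blocks of size `≤ 1/r`. -/
def generatedOnMeasures {r : Exponent} {n : ℕ}
    (a : BlockPartition r n 1 → C(Set.Ioi (0 : ℝ), ℝ)) (μ : FinMeas Ω)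
    (φ : Fin n → Lp ℝ r.inv μ.1) : ℝ :=
  ∑ P, coeffAt (a P) μ.mass * partitionTensor r μ P.1 φ

/-- The tensor `∑_P c_P τ^P_{Ω;r}` at `μ^r`, over partitions with blocks of size between `2` and
`1/r`. -/
def generatedOnProbabilities {r : Exponent} {n : ℕ} (c : BlockPartition r n 2 → ℝ)
    (μ : FinMeas Ω) (φ : Fin n → Lp ℝ r.inv μ.1) : ℝ :=
  ∑ P, c P * partitionTensor r μ P.1 φ

/-- The family has the form `∑_P a_P(‖μ‖) τ^P_{Ω;r}` on all spaces `M^r(Ω)`. -/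
def HasMeasureForm {r : Exponent} {n : ℕ} (Θ : TensorFamily.{u} .measures r n)
    (a : BlockPartition r n 1 → C(Set.Ioi (0 : ℝ), ℝ)) : Prop :=
  ∀ (Ω : Type u) [MeasurableSpace Ω] (μ : Point .measures Ω)
    (φ : Fin n → tangent .measures r μ.base),
    (Θ Ω).form μ φ = generatedOnMeasures a μ.base fun i => (φ i : Lp ℝ r.inv μ.base.1)

/-- The family has the form `∑_P c_P τ^P_{Ω;r}` on all spaces `P^r(Ω)`. -/
def HasProbabilityForm {r : Exponent} {n : ℕ} (Θ : TensorFamily.{u} .probabilities r n)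
    (c : BlockPartition r n 2 → ℝ) : Prop :=
  ∀ (Ω : Type u) [MeasurableSpace Ω] (μ : Point .probabilities Ω)
    (φ : Fin n → tangent .probabilities r μ.base),
    (Θ Ω).form μ φ = generatedOnProbabilities c μ.base fun i => (φ i : Lp ℝ r.inv μ.base.1)

end Canonical

/-! ### Parametrized measure models -/

section Models

variable {Ω : Type u} [MeasurableSpace Ω]
  {E : Type w} [NormedAddCommGroup E] [NormedSpace ℝ E]
  {M : Type v} [TopologicalSpace M] [ChartedSpace E M]

/-- The exponent `1`. -/
def Exponent.one : Exponent := ⟨1, one_pos, le_rfl⟩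

/-- The map `p : M → M(Ω)` (or `p : M → P(Ω)`) is a parametrized measure model (a statistical model)
that is `k`-integrable for `k = 1/r`: both `p`, as a map to the space `S(Ω) = S^1(Ω)` of finite
signed measures, and `p^{1/k}`, as a map to `S^{1/k}(Ω)`, are continuously Fréchet
differentiable. -/
def IsIntegrableModel {s : Setting} (r : Exponent) (p : M → Point s Ω) : Prop :=
  ContMDiff 𝓘(ℝ, E) 𝓘(ℝ, RootMeas Exponent.one Ω) 1
      (fun ξ => rootPow Exponent.one (p ξ).base) ∧
    ContMDiff 𝓘(ℝ, E) 𝓘(ℝ, RootMeas r Ω) 1 (fun ξ => rootPow r (p ξ).base)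

/-- `D` is the differential `d_ξ p^r : T_ξ M → T_{p(ξ)^r}` of `p^r` at `ξ`, as a map to the tangent
space at `p(ξ)^r`. (It is unique, since `φ ↦ φ μ^r` is injective.) -/
def IsRootDifferential {s : Setting} (r : Exponent) (p : M → Point s Ω) (ξ : M)
    (D : TangentSpace 𝓘(ℝ, E) ξ →ₗ[ℝ] tangent s r (p ξ).base) : Prop :=
  ∀ v : TangentSpace 𝓘(ℝ, E) ξ, densityPow r (p ξ).base (D v : Lp ℝ r.inv (p ξ).base.1)
    = mfderiv 𝓘(ℝ, E) 𝓘(ℝ, RootMeas r Ω) (fun ζ => rootPow r (p ζ).base) ξ v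

/-- The pull-back `(p^r)^* Ψ` at `ξ` of a tensor field `Ψ`, where `D` is the differential of `p^r`
at `ξ`. -/
def modelPullback {s : Setting} {r : Exponent} {n : ℕ} (Ψ : TensorField s r n Ω)
    (p : M → Point s Ω) (ξ : M)
    (D : TangentSpace 𝓘(ℝ, E) ξ →ₗ[ℝ] tangent s r (p ξ).base) :
    MultilinearMap ℝ (fun _ : Fin n => TangentSpace 𝓘(ℝ, E) ξ) ℝ :=
  (Ψ.form (p ξ)).compLinearMap fun _ => D

/-- The canonical tensor `τ^m_{(M,Ω,p)} = (p^r)^* τ^m_{Ω;r}` of the model at `ξ`, with its `m`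
arguments indexed by a finite set `ι`. -/
def modelCanonicalTensor {s : Setting} {r : Exponent} (p : M → Point s Ω) (ξ : M)
    (D : TangentSpace 𝓘(ℝ, E) ξ →ₗ[ℝ] tangent s r (p ξ).base) {ι : Type} [Fintype ι]
    (V : ι → TangentSpace 𝓘(ℝ, E) ξ) : ℝ :=
  canonicalTensor r (p ξ).base fun i => (D (V i) : Lp ℝ r.inv (p ξ).base.1)

/-- The tensor `τ^P_{(M,Ω,p)}` of the model for a partition `P` of the set of arguments. -/
def modelPartitionTensor {s : Setting} {r : Exponent} (p : M → Point s Ω) (ξ : M)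
    (D : TangentSpace 𝓘(ℝ, E) ξ →ₗ[ℝ] tangent s r (p ξ).base) {n : ℕ}
    (P : Finpartition (Finset.univ : Finset (Fin n)))
    (V : Fin n → TangentSpace 𝓘(ℝ, E) ξ) : ℝ :=
  ∏ B ∈ P.parts, modelCanonicalTensor p ξ D fun j : B => V j

end Models

end CongruentTensors

end

open CongruentTensors

noncomputable section

namespace CongruentTensors

/-! ### Congruent kernels -/

section Congruent

variable {Ω Ω' : Type u} [MeasurableSpace Ω] [MeasurableSpace Ω']

/-! If `K` is congruent with statistic `κ`, the formal derivative turns a tangent vector `φ` into `φ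
∘ κ` (`formalDeriv_congruent`). Since `κ` carries `K_* μ` back to `μ`, all joint moments `∫ ∏ φ_i`
are preserved, so every combination of the partition tensors is congruent. The substance is the
converse, from finite sample spaces to the explicit form.

Step functions come first. For a measurable surjection `κ` onto a finite set, the conditional
distributions of `ν` given `κ` form a congruent kernel from `κ_* ν` to `ν`
(`exists_congruent_kernel`), so the values on functions of `κ` can be computed on the finite set
(`evalSimple_map`). For equal weights, `κ` may be any permutation. The form is therefore a
permutation invariant multilinear form on `I → ℝ`, and these are spanned by the products of power
sums `blockSum R` (`exists_eq_sum_blockSum`): on indicators of points only the coincidences among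
the points matter, and `blockSum R` detects whether `R` refines the partition of coincidences, which
gives a triangular system. Comparison through a product space shows that the coefficients depend on
the total mass alone. Rational proportions are images of equal weights, continuity reaches all
weights on finite sets, and the finite set of joint values reaches every `Ω` (`exists_hasCoeff`).

Blocks larger than `1/r` cannot occur (`HasCoeff.eq_zero_of_large_block`). With `1/|p| < a < r`, the
field `ν(A)^{-a} 1_A` is continuous because `1_A ν^r` has norm `ν(A)^r`, whereas a block `p`
contributes `ν(A)^{1 - a|p|}`, which blows up as `ν(A)` tends to zero.

The passage from step functions to `L^{1/r}` is not plain density, since continuity is assumed only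
along continuous vector fields and not for the form at a fixed point. For each tangent vector at `μ`
there is a continuous field with that value at `μ` and step functions as values at all other points
(`exists_field`). Along `ν_k = (1 + δ_k h) μ`, which converges to `μ` without meeting it, the
formula holds, and the moments of blocks of size at most `1/r` converge (`form_eq_of_hasCoeff`).

On probability measures the blocks of size one drop out because tangent vectors have mean zero.
Uniqueness is again triangularity, with indicators replaced by mean-zero functions where necessary.

For a model it remains to show that the differential is tangent. It is dominated by `p(ξ)` because a
nonnegative quantity that vanishes at a point has zero derivative there
(`exists_densityPow_eq_fderiv`). For probability measures its mean vanishes because a functional of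
norm at most one attains its maximum over the unit sphere at `p(ξ)^r` (`mem_tangent_of_fderiv`). -/

theorem map_comp_congruent {K : Kernel Ω Ω'} {κ : Ω' → Ω} (hκ : Measurable κ)
    (h : ∀ ω, (K ω).map κ = Measure.dirac ω) (μ : Measure Ω) : (K ∘ₘ μ).map κ = μ := by
  have h1 : K.map κ = Kernel.id := by
    ext ω : 1
    rw [Kernel.map_apply _ hκ, h, Kernel.id_apply]
  rw [Measure.map_comp μ K hκ, h1, Measure.id_comp]

theorem ae_comp_congruent {K : Kernel Ω Ω'} [IsMarkovKernel K] {κ : Ω' → Ω}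
    (hκ : Measurable κ) (h : ∀ ω, (K ω).map κ = Measure.dirac ω) (μ : FinMeas Ω) {p : Ω → Prop}
    (hp : ∀ᵐ x ∂μ.1, p x) : ∀ᵐ y ∂(μ.push K).1, p (κ y) := by
  have hmap : (μ.push K).1.map κ = μ.1 := map_comp_congruent hκ h μ.1
  rw [← hmap] at hp
  exact ae_of_ae_map hκ.aemeasurable hp

/-- Under the joint law `μ ⊗ K` the first coordinate is almost surely `κ` of the second, so
conditioning `φ` on the second coordinate changes nothing. -/
theorem pushDensity_congruent {K : Kernel Ω Ω'} [IsMarkovKernel K] {κ : Ω' → Ω}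
    (hκ : Measurable κ) (h : ∀ ω, (K ω).map κ = Measure.dirac ω) (μ : FinMeas Ω) {φ : Ω → ℝ}
    (hm : Measurable φ) (hφ : Integrable φ μ.1) :
    pushDensity K μ φ =ᵐ[(μ.push K).1] φ ∘ κ := by
  have hmap : (μ.push K).1.map κ = μ.1 := map_comp_congruent hκ h μ.1
  refine pushDensity_ae_unique K μ hm hφ ?_ fun A hA => ?_
  · rw [← hmap] at hφ
    exact hφ.comp_measurable hκ
  · rw [← map_snd_compProd, setIntegral_map hA (hm.comp hκ).aestronglyMeasurable
      measurable_snd.aemeasurable]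
    refine integral_congr_ae (ae_restrict_of_ae ?_)
    refine (Measure.ae_compProd_iff (measurableSet_eq_fun ((hm.comp hκ).comp measurable_snd)
      (hm.comp measurable_fst))).2 (ae_of_all _ fun ω => ?_)
    have h0 : ∀ᵐ x ∂((K ω).map κ), φ x = φ ω := by
      rw [h, ae_dirac_iff (measurableSet_eq_fun hm measurable_const)]
    exact ae_of_ae_map hκ.aemeasurable h0

theorem formalDeriv_congruent (r : Exponent) {K : Kernel Ω Ω'} [IsMarkovKernel K] {κ : Ω' → Ω}
    (hκ : Measurable κ) (h : ∀ ω, (K ω).map κ = Measure.dirac ω) (μ : FinMeas Ω)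
    (φ : Lp ℝ r.inv μ.1) : formalDeriv r K μ φ =ᵐ[(μ.push K).1] φ ∘ κ :=
  (coeFn_formalDeriv r K μ φ).trans
    (pushDensity_congruent hκ h μ (Lp.stronglyMeasurable φ).measurable (integrable_of_Lp r μ φ))

theorem integral_comp_congruent {K : Kernel Ω Ω'} [IsMarkovKernel K] {κ : Ω' → Ω}
    (hκ : Measurable κ) (h : ∀ ω, (K ω).map κ = Measure.dirac ω) (μ : FinMeas Ω) {f : Ω → ℝ}
    (hf : Measurable f) : ∫ x, f (κ x) ∂(μ.push K).1 = ∫ x, f x ∂μ.1 := by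
  have hmap : (μ.push K).1.map κ = μ.1 := map_comp_congruent hκ h μ.1
  have := integral_map (μ := (μ.push K).1) hκ.aemeasurable hf.aestronglyMeasurable
  rw [← this, hmap]

theorem mass_push (K : Kernel Ω Ω') [IsMarkovKernel K] (μ : FinMeas Ω) :
    (μ.push K).mass = μ.mass :=
  congrArg ENNReal.toReal (Measure.comp_apply_univ (μ := μ.1) (κ := K))

/-- This is disintegration along a finite-valued statistic: `K i` is `ν` conditioned on the fibre
over `i`, and the law of total probability reassembles `ν`. -/
theorem exists_congruent_kernel {I : Type u} [Finite I] [MeasurableSpace I]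
    [DiscreteMeasurableSpace I] {κ : Ω → I} (hκ : Measurable κ) (hs : Function.Surjective κ)
    (ν : Measure Ω) [IsFiniteMeasure ν] :
    ∃ (K : Kernel I Ω) (_ : IsMarkovKernel K), (∀ i, (K i).map κ = Measure.dirac i) ∧
      K ∘ₘ (ν.map κ) = ν := by
  classical
  cases nonempty_fintype I
  -- Conditioning on a null fibre would give the zero measure. A Dirac measure at a point of the
  -- fibre keeps `K` Markov and congruent; this is where surjectivity enters.
  let f : I → Measure Ω := fun i =>
    if ν (κ ⁻¹' {i}) = 0 then Measure.dirac (Function.surjInv hs i) else ν[|κ ⁻¹' {i}]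
  have hf : ∀ i, ν (κ ⁻¹' {i}) • f i = ν (κ ⁻¹' {i}) • ν[|κ ⁻¹' {i}] := fun i => by
    by_cases h0 : ν (κ ⁻¹' {i}) = 0
    · simp [h0]
    · simp [f, h0]
  refine ⟨⟨f, Measurable.of_discrete⟩, ⟨fun i => ?_⟩, fun i => ?_, ?_⟩
  · change IsProbabilityMeasure (f i)
    by_cases h0 : ν (κ ⁻¹' {i}) = 0
    · simp only [f, h0, if_true]; infer_instance
    · simp only [f, h0, if_false]
      exact cond_isProbabilityMeasure h0
  · change (f i).map κ = _
    by_cases h0 : ν (κ ⁻¹' {i}) = 0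
    · simp only [f, h0, if_true]
      rw [Measure.map_dirac' hκ, Function.surjInv_eq hs i]
    · simp only [f, h0, if_false]
      ext A hA
      rw [Measure.map_apply hκ hA, cond_apply (hκ (measurableSet_singleton i)),
        Measure.dirac_apply' _ hA]
      by_cases hi : i ∈ A
      · have : κ ⁻¹' {i} ∩ κ ⁻¹' A = κ ⁻¹' {i} := by
          rw [inter_eq_left]; rintro x rfl; exact hi
        rw [this, ENNReal.inv_mul_cancel h0 (measure_ne_top _ _)]
        simp [hi]
      · have : κ ⁻¹' {i} ∩ κ ⁻¹' A = ∅ := by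
          refine eq_empty_of_forall_notMem fun x => ?_
          rintro ⟨rfl, h⟩
          exact hi h
        rw [this]
        simp [hi]
  · conv_rhs => rw [← sum_meas_smul_cond_fiber hκ ν]
    ext A hA
    rw [Measure.bind_apply hA (Kernel.aemeasurable _), lintegral_fintype,
      Measure.finsetSum_apply]
    refine Finset.sum_congr rfl fun i _ => ?_
    rw [← hf, Measure.map_apply hκ (measurableSet_singleton i), mul_comm]
    rfl

end Congruent

/-! ### Sums over finite partitions -/

section Partitions

/-- The system is unitriangular for the order, so it is solved by induction from below. The
disjunction allows an equation to be missing at any `Q` where `d Q` is already known to vanish. -/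
theorem eq_zero_of_sum_Iic {α : Type*} [Fintype α] [PartialOrder α] [DecidableLE α] (d : α → ℝ)
    (h : ∀ Q, d Q = 0 ∨ ∑ R, (if R ≤ Q then d R else 0) = 0) : d = 0 := by
  have : ∀ Q, d Q = 0 := fun Q => by
    induction Q using WellFoundedLT.induction with
    | ind Q ih =>
      rcases h Q with h | h
      · exact h
      · rw [Finset.sum_eq_single Q] at h
        · simpa using h
        · intro R _ hR
          split_ifs with hle
          · exact ih R (lt_of_le_of_ne hle hR)
          · rfl
        · simp
  exact funext this

/-- Möbius inversion without the Möbius function: summation over lower sets is an injective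
endomorphism of a finite-dimensional space. -/
theorem exists_sum_Iic_eq {α : Type*} [Fintype α] [PartialOrder α] [DecidableLE α] (β : α → ℝ) :
    ∃ c : α → ℝ, ∀ Q, β Q = ∑ R, if R ≤ Q then c R else 0 := by
  let Z : (α → ℝ) →ₗ[ℝ] (α → ℝ) :=
    { toFun := fun c Q => ∑ R, if R ≤ Q then c R else 0
      map_add' := fun c d => by
        ext Q
        simp only [Pi.add_apply, ← Finset.sum_add_distrib]
        exact Finset.sum_congr rfl fun R _ => by split_ifs <;> simp
      map_smul' := fun c d => by
        ext Q
        simp [Finset.mul_sum] }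
  have hinj : Function.Injective Z := by
    rw [injective_iff_map_eq_zero]
    exact fun c hc => eq_zero_of_sum_Iic c fun Q => Or.inr (congrFun hc Q)
  obtain ⟨c, hc⟩ := LinearMap.injective_iff_surjective.1 hinj β
  exact ⟨c, fun Q => (congrFun hc Q).symm⟩

/-- Partitions of the set of `n` arguments. -/
abbrev ArgPartition (n : ℕ) : Type := Finpartition (Finset.univ : Finset (Fin n))

variable {n : ℕ} {I : Type*}

/-- The blocks of `Q` are the fibres of `j`. -/
def IsKernelOf (Q : ArgPartition n) (j : Fin n → I) : Prop :=
  ∀ x y, j x = j y ↔ Q.part x = Q.part y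

/-- The function `j` is constant on the blocks of `R`. -/
def ConstOnBlocks (R : ArgPartition n) (j : Fin n → I) : Prop :=
  ∀ B ∈ R.parts, ∀ x ∈ B, ∀ y ∈ B, j x = j y

/-- Through this equivalence, evaluation of `∑ c_R blockSum R` at indicators of points becomes a sum
over the lower set of `Q`. -/
theorem IsKernelOf.constOnBlocks_iff {Q R : ArgPartition n} {j : Fin n → I}
    (hj : IsKernelOf Q j) : ConstOnBlocks R j ↔ R ≤ Q := by
  constructor
  · intro h B hB
    obtain ⟨x, hx⟩ := R.nonempty_of_mem_parts hB
    refine ⟨Q.part x, Q.part_mem.2 (Finset.mem_univ x), fun y hy => ?_⟩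
    rw [(hj x y).1 (h B hB x hx y hy)]
    exact Q.mem_part_self.2 (Finset.mem_univ y)
  · intro h B hB x hx y hy
    obtain ⟨C, hC, hBC⟩ := h hB
    rw [hj, Q.part_eq_of_mem hC (hBC hx), Q.part_eq_of_mem hC (hBC hy)]

theorem exists_isKernelOf (j : Fin n → I) : ∃ Q : ArgPartition n, IsKernelOf Q j := by
  classical
  refine ⟨Finpartition.ofSetoid (Setoid.ker j), fun x y => ?_⟩
  rw [← Finpartition.mem_part_iff_part_eq_part _ (Finset.mem_univ x) (Finset.mem_univ y),
    Finpartition.mem_part_ofSetoid_iff_rel, Setoid.ker_def, eq_comm]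

theorem exists_isKernelOf_fin (Q : ArgPartition n) : ∃ j : Fin n → Fin n, IsKernelOf Q j := by
  have hne : ∀ x, (Q.part x).Nonempty := fun x => Q.part_nonempty.2 (Finset.mem_univ x)
  have hmem : ∀ x, (Q.part x).min' (hne x) ∈ Q.part x := fun x => Finset.min'_mem _ _
  refine ⟨fun x => (Q.part x).min' (hne x), fun x y => ⟨fun h => ?_, fun h => ?_⟩⟩
  · have h1 := hmem x
    have h2 := hmem y
    dsimp only at h
    rw [← h] at h2
    exact Q.eq_of_mem_parts (Q.part_mem.2 (Finset.mem_univ x)) (Q.part_mem.2 (Finset.mem_univ y))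
      h1 h2
  · simp only [h]

theorem IsKernelOf.comp {Q : ArgPartition n} {j : Fin n → I} (hj : IsKernelOf Q j) {J : Type*}
    {e : I → J} (he : Function.Injective e) : IsKernelOf Q (e ∘ j) :=
  fun x y => he.eq_iff.trans (hj x y)

theorem exists_isKernelOf_of_le_card [Fintype I] (h : n ≤ Fintype.card I) (Q : ArgPartition n) :
    ∃ j : Fin n → I, IsKernelOf Q j := by
  obtain ⟨j, hj⟩ := exists_isKernelOf_fin Q
  have : Fintype.card (Fin n) ≤ Fintype.card I := by simpa using h
  obtain ⟨e⟩ := Function.Embedding.nonempty_of_card_le this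
  exact ⟨_, hj.comp e.injective⟩

/-- Index maps with the same coincidences have ranges in bijection over their common quotient, and a
bijection between subsets of a finite set extends to a permutation. Hence an invariant form takes a
single value for each partition. -/
theorem exists_perm_comp_eq [Fintype I] {Q : ArgPartition n} {j j' : Fin n → I}
    (hj : IsKernelOf Q j) (hj' : IsKernelOf Q j') : ∃ σ : Equiv.Perm I, σ ∘ j = j' := by
  classical
  have h : ∀ x y, j x = j y ↔ j' x = j' y := fun x y => (hj x y).trans (hj' x y).symm
  choose s hs using fun a : {a // a ∈ Set.range j} => a.2
  choose s' hs' using fun a : {a // a ∈ Set.range j'} => a.2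
  let e : {a // a ∈ Set.range j} ≃ {a // a ∈ Set.range j'} :=
    { toFun := fun a => ⟨j' (s a), mem_range_self _⟩
      invFun := fun a => ⟨j (s' a), mem_range_self _⟩
      left_inv := fun a => Subtype.ext (((h _ _).2 (hs' ⟨j' (s a), mem_range_self _⟩)).trans (hs a))
      right_inv := fun a =>
        Subtype.ext (((h _ _).1 (hs ⟨j (s' a), mem_range_self _⟩)).trans (hs' a)) }
  refine ⟨e.extendSubtype, funext fun x => ?_⟩
  rw [Function.comp_apply, e.extendSubtype_apply_of_mem _ (mem_range_self x)]
  exact (h _ _).1 (hs ⟨j x, mem_range_self x⟩)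

theorem prod_update_apply (f : Fin n → I → ℝ) (i : Fin n) (a : I → ℝ) {B : Finset (Fin n)}
    (hi : i ∈ B) (x : I) :
    ∏ k ∈ B, Function.update f i a k x = a x * ∏ k ∈ B.erase i, f k x := by
  rw [← Finset.mul_prod_erase B _ hi, Function.update_self]
  congr 1
  refine Finset.prod_congr rfl fun k hk => ?_
  rw [Function.update_of_ne (Finset.ne_of_mem_erase hk)]

variable [Fintype I]

/-- The argument `i` enters only the factor of its own block, and there linearly; both
multilinearity axioms follow. -/
theorem blockSum_update (R : ArgPartition n) (f : Fin n → I → ℝ) (i : Fin n) (a : I → ℝ) :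
    ∏ B ∈ R.parts, ∑ x, ∏ k ∈ B, Function.update f i a k x =
      (∑ x, a x * ∏ k ∈ (R.part i).erase i, f k x) *
        ∏ B ∈ R.parts.erase (R.part i), ∑ x, ∏ k ∈ B, f k x := by
  have hi := R.part_mem.2 (Finset.mem_univ i)
  rw [← Finset.mul_prod_erase R.parts _ hi]
  congr 1
  · exact Finset.sum_congr rfl fun x _ =>
      prod_update_apply f i a (R.mem_part_self.2 (Finset.mem_univ i)) x
  · refine Finset.prod_congr rfl fun B hB => Finset.sum_congr rfl fun x _ =>
      Finset.prod_congr rfl fun k hk => ?_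
    rw [Function.update_of_ne]
    rintro rfl
    exact Finset.ne_of_mem_erase hB (R.part_eq_of_mem (Finset.mem_of_mem_erase hB) hk).symm

/-- The multilinear form `f ↦ ∏_{B ∈ R} ∑_x ∏_{k ∈ B} f_k(x)`. -/
def blockSum (R : ArgPartition n) : MultilinearMap ℝ (fun _ : Fin n => I → ℝ) ℝ where
  toFun f := ∏ B ∈ R.parts, ∑ x, ∏ k ∈ B, f k x
  map_update_add' {dec} f i a b := by
    obtain rfl := Subsingleton.elim dec (instDecidableEqFin n)
    simp only [blockSum_update, Pi.add_apply, add_mul, Finset.sum_add_distrib]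
  map_update_smul' {dec} f i c a := by
    obtain rfl := Subsingleton.elim dec (instDecidableEqFin n)
    simp only [blockSum_update, Pi.smul_apply, smul_eq_mul, mul_assoc, ← Finset.mul_sum]

theorem blockSum_apply (R : ArgPartition n) (f : Fin n → I → ℝ) :
    blockSum R f = ∏ B ∈ R.parts, ∑ x, ∏ k ∈ B, f k x := rfl

theorem sum_mul_prod_single [DecidableEq I] {B : Finset (Fin n)} {i : Fin n} (hi : i ∈ B)
    (j : Fin n → I) (g : I → ℝ) :
    ∑ x, g x * ∏ k ∈ B, (Pi.single (j k) (1 : ℝ) : I → ℝ) x =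
      if ∀ k ∈ B, ∀ l ∈ B, j k = j l then g (j i) else 0 := by
  split_ifs with h
  · rw [Finset.sum_eq_single (j i)]
    · rw [Finset.prod_eq_one, mul_one]
      intro k hk
      rw [h i hi k hk, Pi.single_eq_same]
    · intro x _ hx
      rw [Finset.prod_eq_zero hi (Pi.single_eq_of_ne hx _), mul_zero]
    · simp
  · push Not at h
    obtain ⟨k, hk, l, hl, hkl⟩ := h
    refine Finset.sum_eq_zero fun x _ => ?_
    by_cases hx : x = j k
    · rw [Finset.prod_eq_zero hl (Pi.single_eq_of_ne (hx.trans_ne hkl) _), mul_zero]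
    · rw [Finset.prod_eq_zero hk (Pi.single_eq_of_ne hx _), mul_zero]

open Classical in
theorem blockSum_single [DecidableEq I] (R : ArgPartition n) (j : Fin n → I) :
    blockSum R (fun k => Pi.single (j k) (1 : ℝ)) = if ConstOnBlocks R j then 1 else 0 := by
  rw [blockSum_apply]
  have h : ∀ B ∈ R.parts, ∑ x, ∏ k ∈ B, (Pi.single (j k) (1 : ℝ) : I → ℝ) x =
      if ∀ k ∈ B, ∀ l ∈ B, j k = j l then 1 else 0 := fun B hB => by
    obtain ⟨i, hi⟩ := R.nonempty_of_mem_parts hB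
    simpa using sum_mul_prod_single hi j (fun _ => 1)
  rw [Finset.prod_congr rfl h, Finset.prod_ite_zero, Finset.prod_const_one]
  by_cases hR : ConstOnBlocks R j
  · rw [if_pos hR]
    exact if_pos hR
  · rw [if_neg hR]
    exact if_neg hR

open Classical in
-- On tuples of basis vectors both sides depend only on the partition of coincidences, by invariance
-- on the left and by `blockSum_single` on the right. The coefficients are then obtained by
-- inversion over the refinement order.
theorem exists_eq_sum_blockSum (Ψ : MultilinearMap ℝ (fun _ : Fin n => I → ℝ) ℝ)
    (h : ∀ (σ : Equiv.Perm I) (f : Fin n → I → ℝ), Ψ (fun k => f k ∘ σ) = Ψ f) :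
    ∃ c : ArgPartition n → ℝ, ∀ f, Ψ f = ∑ R, c R * blockSum R f := by
  let b : (Fin n → I) → ℝ := fun j => Ψ fun k => Pi.single (j k) 1
  have hb : ∀ (Q : ArgPartition n) (j j' : Fin n → I), IsKernelOf Q j → IsKernelOf Q j' →
      b j = b j' := fun Q j j' hj hj' => by
    obtain ⟨σ, rfl⟩ := exists_perm_comp_eq hj hj'
    simp only [b]
    rw [← h σ fun k => Pi.single ((σ ∘ j) k) 1]
    congr 1
    ext k x
    simp only [Pi.single_apply, Function.comp_apply, EmbeddingLike.apply_eq_iff_eq]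
  -- A partition with more blocks than `I` has points is not realised by any `j`; the value
  -- prescribed there is never used.
  obtain ⟨c, hc⟩ := exists_sum_Iic_eq fun Q : ArgPartition n =>
    if hQ : ∃ j : Fin n → I, IsKernelOf Q j then b hQ.choose else 0
  refine ⟨c, fun f => ?_⟩
  have key : Ψ = ∑ R, c R • blockSum R := by
    refine Module.Basis.ext_multilinear (fun _ => Pi.basisFun ℝ I) fun j => ?_
    obtain ⟨Q, hQ⟩ := exists_isKernelOf j
    have hex : ∃ j : Fin n → I, IsKernelOf Q j := ⟨j, hQ⟩
    have h1 := hc Q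
    rw [dif_pos hex, hb Q _ j hex.choose_spec hQ] at h1
    simp only [Pi.basisFun_apply, sum_apply, smul_apply,
      blockSum_single, hQ.constOnBlocks_iff]
    rw [show Ψ (fun k => Pi.single (j k) 1) = b j from rfl, h1]
    exact Finset.sum_congr rfl fun R _ => by split_ifs <;> simp
  rw [key, sum_apply]
  simp

/-- With at least `n` points every partition arises as a pattern of coincidences, so every equation
of the triangular system is available. -/
theorem eq_zero_of_sum_blockSum_eq_zero (hI : n ≤ Fintype.card I) (c : ArgPartition n → ℝ)
    (h : ∀ f : Fin n → I → ℝ, ∑ R, c R * blockSum R f = 0) : c = 0 := by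
  classical
  refine eq_zero_of_sum_Iic c fun Q => Or.inr ?_
  obtain ⟨j, hj⟩ := exists_isKernelOf_of_le_card hI Q
  refine (Finset.sum_congr rfl fun R _ => ?_).trans (h fun k => Pi.single (j k) 1)
  rw [blockSum_single, hj.constOnBlocks_iff]
  split_ifs <;> simp

end Partitions

/-! ### Simple functions and the space `S^r(Ω)` -/

section SimpleAction

variable {Ω : Type u} [MeasurableSpace Ω]

/-- The class of a simple function in `L^{1/r}(μ)`. -/
def simpleLp (r : Exponent) (μ : FinMeas Ω) : SimpleFunc Ω ℝ →ₗ[ℝ] Lp ℝ r.inv μ.1 where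
  toFun f := (f.memLp_of_isFiniteMeasure r.inv μ.1).toLp f
  map_add' f g := by
    rw [← MemLp.toLp_add, MemLp.toLp_eq_toLp_iff, SimpleFunc.coe_add]
  map_smul' c f := by
    rw [RingHom.id_apply, ← MemLp.toLp_const_smul, MemLp.toLp_eq_toLp_iff, SimpleFunc.coe_smul]

theorem coeFn_simpleLp (r : Exponent) (μ : FinMeas Ω) (f : SimpleFunc Ω ℝ) :
    simpleLp r μ f =ᵐ[μ.1] f :=
  MemLp.coeFn_toLp (f.memLp_of_isFiniteMeasure r.inv μ.1)

theorem simpleLp_one (r : Exponent) (μ : FinMeas Ω) :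
    simpleLp r μ 1 = Lp.const r.inv μ.1 (1 : ℝ) :=
  Lp.ext ((coeFn_simpleLp r μ 1).trans (Lp.coeFn_const ..).symm)

theorem memLp_simple_mul (r : Exponent) (μ : FinMeas Ω) (f : SimpleFunc Ω ℝ)
    (φ : Lp ℝ r.inv μ.1) : MemLp (fun x => f x * φ x) r.inv μ.1 := by
  obtain ⟨C, hC⟩ := f.exists_forall_norm_le
  refine (Lp.memLp φ).of_le_mul (c := C)
    (f.measurable.mul (Lp.stronglyMeasurable φ).measurable).aestronglyMeasurable
    (ae_of_all _ fun x => ?_)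
  rw [norm_mul]
  exact mul_le_mul_of_nonneg_right (hC x) (norm_nonneg _)

/-- Multiplication by a simple function on `L^{1/r}(μ)`. -/
def simpleMul (r : Exponent) (f : SimpleFunc Ω ℝ) (μ : FinMeas Ω) :
    Lp ℝ r.inv μ.1 →ₗ[ℝ] Lp ℝ r.inv μ.1 where
  toFun φ := (memLp_simple_mul r μ f φ).toLp _
  map_add' φ ψ := by
    rw [← MemLp.toLp_add, MemLp.toLp_eq_toLp_iff]
    filter_upwards [Lp.coeFn_add φ ψ] with x hx
    simp only [hx, Pi.add_apply, mul_add]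
  map_smul' c φ := by
    rw [RingHom.id_apply, ← MemLp.toLp_const_smul, MemLp.toLp_eq_toLp_iff]
    filter_upwards [Lp.coeFn_smul c φ] with x hx
    simp only [hx, Pi.smul_apply, smul_eq_mul]
    ring

theorem coeFn_simpleMul (r : Exponent) (f : SimpleFunc Ω ℝ) (μ : FinMeas Ω)
    (φ : Lp ℝ r.inv μ.1) : simpleMul r f μ φ =ᵐ[μ.1] fun x => f x * φ x :=
  MemLp.coeFn_toLp (memLp_simple_mul r μ f φ)

theorem simpleMul_one (r : Exponent) (f : SimpleFunc Ω ℝ) (μ : FinMeas Ω) :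
    simpleMul r f μ (Lp.const r.inv μ.1 (1 : ℝ)) = simpleLp r μ f := by
  refine Lp.ext ((coeFn_simpleMul r f μ _).trans ?_)
  filter_upwards [Lp.coeFn_const (p := r.inv) (μ := μ.1) (1 : ℝ), coeFn_simpleLp r μ f]
    with x hx hx'
  rw [hx, hx', Function.const_apply, mul_one]

/-- Multiplication by a simple function on `S^r(Ω)`, as a linear map. -/
def simpleActₗ (r : Exponent) (f : SimpleFunc Ω ℝ) : RootMeas r Ω →ₗ[ℝ] RootMeas r Ω := by
  classical
  exact Module.DirectLimit.lift ℝ (FinMeas Ω) (fun μ : FinMeas Ω => Lp ℝ r.inv μ.1)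
    (fun _ _ h => rescale r h) (fun μ => densityPow r μ ∘ₗ simpleMul r f μ) fun μ ν h φ => by
      rw [LinearMap.comp_apply, LinearMap.comp_apply, ← densityPow_rescale r h]
      congr 1
      refine Lp.ext ((coeFn_simpleMul r f ν _).trans ?_)
      refine Filter.EventuallyEq.trans ?_ (coeFn_rescale r h _).symm
      filter_upwards [coeFn_rescale r h φ, ae_imp_rescale r ν (coeFn_simpleMul r f μ φ)]
        with x hx hx'
      rw [hx, hx', mul_assoc]

theorem simpleActₗ_densityPow (r : Exponent) (f : SimpleFunc Ω ℝ) (μ : FinMeas Ω)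
    (φ : Lp ℝ r.inv μ.1) :
    simpleActₗ r f (densityPow r μ φ) = densityPow r μ (simpleMul r f μ φ) := by
  classical
  exact Module.DirectLimit.lift_of _ _ _

/-- Multiplication by a simple function on `S^r(Ω)`. -/
def simpleAct (r : Exponent) (f : SimpleFunc Ω ℝ) : RootMeas r Ω →L[ℝ] RootMeas r Ω :=
  (simpleActₗ r f).mkContinuous f.exists_forall_norm_le.choose fun x => by
    obtain ⟨μ, φ, rfl⟩ := exists_densityPow r x
    rw [simpleActₗ_densityPow, norm_densityPow, norm_densityPow]
    refine Lp.norm_le_mul_norm_of_ae_le_mul ?_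
    filter_upwards [coeFn_simpleMul r f μ φ] with x hx
    rw [hx, norm_mul]
    exact mul_le_mul_of_nonneg_right (f.exists_forall_norm_le.choose_spec x) (norm_nonneg _)

theorem simpleAct_densityPow (r : Exponent) (f : SimpleFunc Ω ℝ) (μ : FinMeas Ω)
    (φ : Lp ℝ r.inv μ.1) :
    simpleAct r f (densityPow r μ φ) = densityPow r μ (simpleMul r f μ φ) :=
  simpleActₗ_densityPow r f μ φ

theorem simpleAct_rootPow (r : Exponent) (f : SimpleFunc Ω ℝ) (μ : FinMeas Ω) :
    simpleAct r f (rootPow r μ) = densityPow r μ (simpleLp r μ f) := by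
  rw [rootPow, simpleAct_densityPow, simpleMul_one]

theorem densityPow_injective (r : Exponent) (μ : FinMeas Ω) :
    Function.Injective (densityPow r μ) := by
  rw [injective_iff_map_eq_zero]
  intro φ h
  rw [← norm_eq_zero, ← norm_densityPow, h, norm_zero]

theorem densityPow_eq (r : Exponent) {μ ν : FinMeas Ω} (h : μ ≤ ν) {φ : Lp ℝ r.inv μ.1}
    {ψ : Lp ℝ r.inv ν.1}
    (hψ : ψ =ᵐ[ν.1] fun x => φ x * ((μ.1.rnDeriv ν.1 x).toReal) ^ (r : ℝ)) :
    densityPow r μ φ = densityPow r ν ψ := by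
  rw [← densityPow_rescale r h]
  congr 1
  exact Lp.ext ((coeFn_rescale r h φ).trans hψ.symm)

theorem rootPow_eq (r : Exponent) {μ ν : FinMeas Ω} (h : μ ≤ ν)
    {ψ : Lp ℝ r.inv ν.1} (hψ : ψ =ᵐ[ν.1] fun x => ((μ.1.rnDeriv ν.1 x).toReal) ^ (r : ℝ)) :
    rootPow r μ = densityPow r ν ψ := by
  refine densityPow_eq r h (hψ.trans ?_)
  refine Filter.EventuallyEq.trans ?_ (ae_imp_rescale r ν (Lp.coeFn_const ..)).symm
  exact ae_of_all _ fun x => by simp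

/-- The indicator function of a measurable set. -/
def indicatorSimple (A : Set Ω) (hA : MeasurableSet A) : SimpleFunc Ω ℝ :=
  SimpleFunc.piecewise A hA (SimpleFunc.const Ω 1) (SimpleFunc.const Ω 0)

theorem coe_indicatorSimple {A : Set Ω} (hA : MeasurableSet A) :
    ⇑(indicatorSimple A hA) = A.indicator 1 := by
  classical
  ext x
  simp [indicatorSimple, SimpleFunc.coe_piecewise, Set.indicator, Set.piecewise]

theorem norm_simpleLp_indicator (r : Exponent) (μ : FinMeas Ω) {A : Set Ω}
    (hA : MeasurableSet A) :
    ‖simpleLp r μ (indicatorSimple A hA)‖ = μ.1.real A ^ (r : ℝ) := by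
  have h : simpleLp r μ (indicatorSimple A hA)
      = indicatorConstLp r.inv hA (measure_ne_top μ.1 A) (1 : ℝ) := by
    refine Lp.ext ((coeFn_simpleLp r μ _).trans ?_)
    refine Filter.EventuallyEq.trans ?_ indicatorConstLp_coeFn.symm
    rw [coe_indicatorSimple]
    rfl
  rw [h, norm_indicatorConstLp r.inv_ne_zero r.inv_ne_top, r.toReal_inv]
  simp

/-- The mass is a norm, `ν(A) = ‖1_A ν^r‖^{1/r}`, and multiplication by `1_A` is continuous on
`S^r(Ω)`. -/
theorem tendsto_measure_real (r : Exponent) {ι : Type*} {l : Filter ι} {ν : ι → FinMeas Ω}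
    {ν₀ : FinMeas Ω} (h : Filter.Tendsto (fun i => rootPow r (ν i)) l (𝓝 (rootPow r ν₀)))
    {A : Set Ω} (hA : MeasurableSet A) :
    Filter.Tendsto (fun i => (ν i).1.real A) l (𝓝 (ν₀.1.real A)) := by
  have h1 := (((simpleAct r (indicatorSimple A hA)).continuous.tendsto _).comp h).norm
  have h2 := h1.rpow_const (p := 1 / (r : ℝ)) (Or.inr (one_div_nonneg.2 r.2.1.le))
  have h3 : ∀ ν : FinMeas Ω, ‖simpleAct r (indicatorSimple A hA) (rootPow r ν)‖ ^ (1 / (r : ℝ))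
      = ν.1.real A := fun ν => by
    rw [simpleAct_rootPow, norm_densityPow, norm_simpleLp_indicator,
      ← Real.rpow_mul measureReal_nonneg, mul_one_div_cancel r.2.1.ne', Real.rpow_one]
  simpa only [Function.comp_apply, h3] using h2

theorem tendsto_integral_simple (r : Exponent) {ι : Type*} {l : Filter ι} {ν : ι → FinMeas Ω}
    {ν₀ : FinMeas Ω} (h : Filter.Tendsto (fun i => rootPow r (ν i)) l (𝓝 (rootPow r ν₀)))
    (f : SimpleFunc Ω ℝ) :
    Filter.Tendsto (fun i => ∫ x, f x ∂(ν i).1) l (𝓝 (∫ x, f x ∂ν₀.1)) := by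
  simp only [SimpleFunc.integral_eq_sum f (f.integrable_of_isFiniteMeasure)]
  exact tendsto_finsetSum _ fun y _ =>
    (tendsto_measure_real r h (f.measurableSet_fiber y)).smul_const y

end SimpleAction

/-! ### Projections to the tangent spaces and simple vector fields -/

section Projection

variable {Ω : Type u} [MeasurableSpace Ω] {s : Setting} {r : Exponent}

/-- The linear form whose kernel is the tangent space. -/
def tangentForm (s : Setting) (r : Exponent) (μ : FinMeas Ω) : Lp ℝ r.inv μ.1 →ₗ[ℝ] ℝ :=
  match s with
  | .measures => 0
  | .probabilities =>
    { toFun := fun φ => ∫ x, φ x ∂μ.1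
      map_add' := fun φ ψ => by
        rw [integral_congr_ae (Lp.coeFn_add φ ψ)]
        exact integral_add (integrable_of_Lp r μ φ) (integrable_of_Lp r μ ψ)
      map_smul' := fun c φ => by
        rw [integral_congr_ae (Lp.coeFn_smul c φ)]
        exact integral_const_mul c _ }

theorem mem_tangent_iff {μ : FinMeas Ω} {φ : Lp ℝ r.inv μ.1} :
    φ ∈ tangent s r μ ↔ tangentForm s r μ φ = 0 := by
  cases s with
  | measures => exact ⟨fun _ => rfl, fun _ => Submodule.mem_top⟩
  | probabilities => exact Iff.rfl

theorem tangentForm_one (μ : Point s Ω) {φ : Lp ℝ r.inv μ.base.1} :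
    tangentForm s r μ.base (φ - tangentForm s r μ.base φ • Lp.const r.inv μ.base.1 (1 : ℝ))
      = 0 := by
  cases s with
  | measures => rfl
  | probabilities =>
    have h1 : tangentForm .probabilities r μ.base (Lp.const r.inv μ.base.1 (1 : ℝ)) = 1 := by
      change ∫ x, (Lp.const r.inv μ.base.1 (1 : ℝ)) x ∂μ.base.1 = 1
      have h : μ.base.1 univ = 1 := μ.admits
      rw [integral_congr_ae (Lp.coeFn_const ..)]
      simp [Measure.real, h]
    rw [map_sub, map_smul, h1, smul_eq_mul, mul_one, sub_self]

/-- The projection of `L^{1/r}(μ)` to the tangent space. -/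
def tangentProj (s : Setting) (r : Exponent) (μ : Point s Ω) :
    Lp ℝ r.inv μ.base.1 →ₗ[ℝ] tangent s r μ.base where
  toFun φ := ⟨φ - tangentForm s r μ.base φ • Lp.const r.inv μ.base.1 (1 : ℝ),
    mem_tangent_iff.2 (tangentForm_one μ)⟩
  map_add' φ ψ := by
    ext1
    simp only [map_add, Submodule.coe_add]
    module
  map_smul' c φ := by
    ext1
    simp only [map_smul, Submodule.coe_smul, RingHom.id_apply, smul_eq_mul]
    module

theorem tangentProj_coe (μ : Point s Ω) (φ : Lp ℝ r.inv μ.base.1) :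
    (tangentProj s r μ φ : Lp ℝ r.inv μ.base.1) =
      φ - tangentForm s r μ.base φ • Lp.const r.inv μ.base.1 (1 : ℝ) := rfl

theorem tangentProj_of_mem (μ : Point s Ω) (φ : tangent s r μ.base) :
    tangentProj s r μ φ = φ := by
  ext1
  rw [tangentProj_coe, mem_tangent_iff.1 φ.2, zero_smul, sub_zero]

theorem tendsto_tangentForm_simple {ι : Type*} {l : Filter ι} {ν : ι → FinMeas Ω}
    {ν₀ : FinMeas Ω} (h : Filter.Tendsto (fun i => rootPow r (ν i)) l (𝓝 (rootPow r ν₀)))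
    (f : SimpleFunc Ω ℝ) :
    Filter.Tendsto (fun i => tangentForm s r (ν i) (simpleLp r (ν i) f)) l
      (𝓝 (tangentForm s r ν₀ (simpleLp r ν₀ f))) := by
  cases s with
  | measures => exact tendsto_const_nhds
  | probabilities =>
    have h1 : ∀ ν : FinMeas Ω, tangentForm .probabilities r ν (simpleLp r ν f)
        = ∫ x, f x ∂ν.1 := fun ν => integral_congr_ae (coeFn_simpleLp r ν f)
    simp only [h1]
    exact tendsto_integral_simple r h f

theorem continuous_powTopology_iff {Y : Type*} [TopologicalSpace Y] {F : Point s Ω → Y} :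
    Continuous[powTopology s r Ω, inferInstance] F ↔
      ∀ μ, Filter.Tendsto F
        (Filter.comap (fun ν : Point s Ω => rootPow r ν.base) (𝓝 (rootPow r μ.base)))
        (𝓝 (F μ)) := by
  let := powTopology s r Ω
  rw [continuous_iff_continuousAt]
  refine forall_congr' fun μ => ?_
  rw [ContinuousAt, nhds_induced]

theorem tendsto_of_continuous_powTopology {Y : Type*} [TopologicalSpace Y] {F : Point s Ω → Y}
    (hF : Continuous[powTopology s r Ω, inferInstance] F) {ι : Type*} {l : Filter ι}
    {ν : ι → Point s Ω} {ν₀ : Point s Ω}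
    (h : Filter.Tendsto (fun i => rootPow r (ν i).base) l (𝓝 (rootPow r ν₀.base))) :
    Filter.Tendsto (fun i => F (ν i)) l (𝓝 (F ν₀)) :=
  (continuous_powTopology_iff.1 hF ν₀).comp (Filter.tendsto_comap_iff.2 h)

/-- The vector field given by a simple function, projected to the tangent spaces. -/
def simpleField (s : Setting) (r : Exponent) (f : SimpleFunc Ω ℝ) : VectorField s r Ω where
  val μ := tangentProj s r μ (simpleLp r μ.base f)
  continuous_val := by
    refine continuous_powTopology_iff.2 fun μ => ?_
    have h : Filter.Tendsto (fun ν : Point s Ω => rootPow r ν.base)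
        (Filter.comap (fun ν : Point s Ω => rootPow r ν.base) (𝓝 (rootPow r μ.base)))
        (𝓝 (rootPow r μ.base)) := Filter.tendsto_comap
    simp only [tangentProj_coe, map_sub, map_smul, ← simpleAct_rootPow]
    exact (((simpleAct r f).continuous.tendsto _).comp h).sub
      ((tendsto_tangentForm_simple h f).smul h)

/-- The constant is `0` for measures and `1` for probability measures, so that both settings share
one estimate of the correction term in `spikeField`. -/
theorem exists_tangentForm_indicator (s : Setting) (r : Exponent) {A : Set Ω}
    (hA : MeasurableSet A) : ∃ c : ℝ, ∀ ν : FinMeas Ω,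
      tangentForm s r ν (simpleLp r ν (indicatorSimple A hA)) = c * ν.1.real A := by
  cases s with
  | measures => exact ⟨0, fun ν => (zero_mul _).symm⟩
  | probabilities =>
    refine ⟨1, fun ν => (integral_congr_ae (coeFn_simpleLp r ν _)).trans ?_⟩
    rw [coe_indicatorSimple, integral_indicator_one hA, one_mul]

/-- The vector field `ν ↦ ν(A)^{-a} 1_A`, `0 < a < r`, projected to the tangent spaces. -/
def spikeField (s : Setting) (r : Exponent) {A : Set Ω} (hA : MeasurableSet A) {a : ℝ}
    (ha : 0 < a) (har : a < r) : VectorField s r Ω where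
  val μ := (μ.base.1.real A ^ (-a)) • tangentProj s r μ (simpleLp r μ.base (indicatorSimple A hA))
  continuous_val := by
    refine continuous_powTopology_iff.2 fun μ => ?_
    have h : Filter.Tendsto (fun ν : Point s Ω => rootPow r ν.base)
        (Filter.comap (fun ν : Point s Ω => rootPow r ν.base) (𝓝 (rootPow r μ.base)))
        (𝓝 (rootPow r μ.base)) := Filter.tendsto_comap
    have hm := tendsto_measure_real r h hA
    simp only [Submodule.coe_smul, map_smul]
    -- At points with `ν(A) = 0` the convention `0 ^ (-a) = 0` makes the field vanish. Near such a
    -- point the main term has norm `ν(A)^{r-a}` and the correction has coefficient `c ν(A)^{1-a}`;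
    -- both tend to zero because `a < r ≤ 1`.
    by_cases h0 : μ.base.1.real A = 0
    · have hx : ∀ {b : ℝ}, a < b → ∀ x : ℝ, 0 ≤ x → x ^ (-a) * x ^ b = x ^ (b - a) := by
        intro b hb x hx
        rcases hx.eq_or_lt with rfl | hx
        · rw [Real.zero_rpow (x := b - a) (by linarith), Real.zero_rpow (x := -a) (by linarith),
            zero_mul]
        · rw [← Real.rpow_add hx, neg_add_eq_sub]
      have hlim : ∀ {b : ℝ}, a < b → Filter.Tendsto
          (fun ν : Point s Ω => ν.base.1.real A ^ (-a) * ν.base.1.real A ^ b)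
          (Filter.comap (fun ν : Point s Ω => rootPow r ν.base) (𝓝 (rootPow r μ.base)))
          (𝓝 0) := by
        intro b hb
        simp only [hx hb _ measureReal_nonneg]
        have h1 := hm.rpow_const (p := b - a) (Or.inr (by linarith))
        rwa [h0, Real.zero_rpow (by linarith)] at h1
      obtain ⟨c, hc⟩ := exists_tangentForm_indicator (Ω := Ω) s r hA
      rw [h0, Real.zero_rpow (by linarith), zero_smul]
      simp only [tangentProj_coe, map_sub, map_smul, smul_sub, hc, smul_smul]
      rw [← sub_zero (0 : RootMeas r Ω)]
      refine Filter.Tendsto.sub ?_ ?_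
      · rw [tendsto_zero_iff_norm_tendsto_zero]
        refine (hlim har).congr fun ν => ?_
        rw [norm_smul, norm_densityPow, norm_simpleLp_indicator, Real.norm_of_nonneg
          (Real.rpow_nonneg measureReal_nonneg _)]
      · have h1 := ((hlim (har.trans_le r.2.2)).const_mul c).smul h
        rw [mul_zero, zero_smul] at h1
        refine h1.congr fun ν => ?_
        rw [Real.rpow_one, mul_left_comm]
        rfl
    · exact (hm.rpow_const (Or.inl h0)).smul
        (tendsto_of_continuous_powTopology (simpleField s r (indicatorSimple A hA)).continuous_val
          h)

end Projection

/-! ### Evaluation on simple functions -/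

section Evaluation

variable {Ω : Type u} [MeasurableSpace Ω] {s : Setting} {r : Exponent} {n : ℕ}

/-- The value of a tensor field on (projected) simple functions. -/
def evalSimple (Ψ : TensorField s r n Ω) (ν : Point s Ω) :
    MultilinearMap ℝ (fun _ : Fin n => SimpleFunc Ω ℝ) ℝ :=
  (Ψ.form ν).compLinearMap fun _ => tangentProj s r ν ∘ₗ simpleLp r ν.base

theorem evalSimple_apply (Ψ : TensorField s r n Ω) (ν : Point s Ω) (f : Fin n → SimpleFunc Ω ℝ) :
    evalSimple Ψ ν f = Ψ.form ν fun i => tangentProj s r ν (simpleLp r ν.base (f i)) := rfl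

/-- The product over the blocks `B` of `R` of the joint moments `∫ ∏_{i ∈ B} f_i dμ`. -/
def momentProd (μ : FinMeas Ω) (R : ArgPartition n) (f : Fin n → Ω → ℝ) : ℝ :=
  ∏ B ∈ R.parts, ∫ x, ∏ i ∈ B, f i x ∂μ.1

/-- The factors `r^{-|B|}` multiply to `r^{-n}` for every partition, because the block sizes add up
to `n`. The normalisation can thus be ignored until the end. -/
theorem partitionTensor_eq_momentProd (r : Exponent) (μ : FinMeas Ω) (R : ArgPartition n)
    {φ : Fin n → Lp ℝ r.inv μ.1} {f : Fin n → Ω → ℝ} (h : ∀ i, φ i =ᵐ[μ.1] f i) :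
    partitionTensor r μ R φ = 1 / (r : ℝ) ^ n * momentProd μ R f := by
  have h1 : ∀ B ∈ R.parts, canonicalTensor r μ (fun j : B => φ j)
      = (1 / (r : ℝ)) ^ B.card * ∫ x, ∏ i ∈ B, f i x ∂μ.1 := fun B _ => by
    rw [canonicalTensor, Fintype.card_coe, one_div_pow]
    congr 1
    refine integral_congr_ae ?_
    filter_upwards [ae_all_iff.2 h] with x hx
    rw [← Finset.prod_coe_sort B]
    exact Finset.prod_congr rfl fun i _ => hx i
  rw [partitionTensor, Finset.prod_congr rfl h1, Finset.prod_mul_distrib,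
    Finset.prod_pow_eq_pow_sum, R.sum_card_parts, Finset.card_univ, Fintype.card_fin, one_div_pow]
  rfl

/-- The image of a point under a measurable map. -/
def Point.map {I : Type u} [MeasurableSpace I] {κ : Ω → I} (hκ : Measurable κ) (ν : Point s Ω) :
    Point s I where
  base := ⟨ν.base.1.map κ, inferInstance⟩
  admits := by
    cases s with
    | measures => trivial
    | probabilities =>
      exact (Measure.map_apply hκ MeasurableSet.univ).trans ν.admits

theorem momentProd_map {I : Type u} [MeasurableSpace I] {κ : Ω → I} (hκ : Measurable κ)
    (ν : Point s Ω) (R : ArgPartition n) (f : Fin n → SimpleFunc I ℝ) :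
    momentProd (ν.map hκ).base R (fun i => f i)
      = momentProd ν.base R fun i => (f i).comp κ hκ :=
  Finset.prod_congr rfl fun B _ => integral_map hκ.aemeasurable
    (Finset.measurable_prod B fun i _ => (f i).measurable).aestronglyMeasurable

theorem tangentForm_formalDeriv {Ω' : Type u} [MeasurableSpace Ω'] (K : Kernel Ω Ω')
    [IsMarkovKernel K] (μ : FinMeas Ω) (φ : Lp ℝ r.inv μ.1) :
    tangentForm s r (μ.push K) (formalDeriv r K μ φ) = tangentForm s r μ φ := by
  cases s with
  | measures => rfl
  | probabilities => exact integral_formalDeriv r K μ φ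

theorem formalDeriv_simpleLp {Ω' : Type u} [MeasurableSpace Ω'] {K : Kernel Ω Ω'}
    [IsMarkovKernel K] {κ : Ω' → Ω} (hκ : Measurable κ)
    (h : ∀ ω, (K ω).map κ = Measure.dirac ω) (μ : FinMeas Ω) (f : SimpleFunc Ω ℝ) :
    formalDeriv r K μ (simpleLp r μ f) = simpleLp r (μ.push K) (f.comp κ hκ) := by
  refine Lp.ext ((formalDeriv_congruent r hκ h μ _).trans ?_)
  refine Filter.EventuallyEq.trans ?_ (coeFn_simpleLp r _ _).symm
  exact ae_comp_congruent hκ h μ (coeFn_simpleLp r μ f)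

theorem tangentMap_proj {Ω' : Type u} [MeasurableSpace Ω'] {K : Kernel Ω Ω'}
    [IsMarkovKernel K] {κ : Ω' → Ω} (hκ : Measurable κ)
    (h : ∀ ω, (K ω).map κ = Measure.dirac ω) (μ : Point s Ω) (f : SimpleFunc Ω ℝ) :
    tangentMap s r K μ (tangentProj s r μ (simpleLp r μ.base f)) =
      tangentProj s r (μ.push K) (simpleLp r (μ.push K).base (f.comp κ hκ)) := by
  ext1
  change formalDeriv r K μ.base (tangentProj s r μ (simpleLp r μ.base f)) = _
  rw [tangentProj_coe, tangentProj_coe, map_sub, map_smul, ← simpleLp_one, ← simpleLp_one,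
    formalDeriv_simpleLp hκ h, formalDeriv_simpleLp hκ h, ← formalDeriv_simpleLp hκ h μ.base f,
    tangentForm_formalDeriv]
  rfl

/-- Congruence is applied to the conditional kernel of `ν` given `κ`, which carries `κ_* ν` to `ν`
and the tangent vector `f` to `f ∘ κ`. -/
theorem evalSimple_map {Θ : TensorFamily.{u} s r n} (hΘ : IsFinitelyCongruentFamily Θ)
    {I : Type u} [Finite I] [MeasurableSpace I] [DiscreteMeasurableSpace I] {κ : Ω → I}
    (hκ : Measurable κ) (hs : Function.Surjective κ) (ν : Point s Ω)
    (f : Fin n → SimpleFunc I ℝ) :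
    evalSimple (Θ I) (ν.map hκ) f = evalSimple (Θ Ω) ν fun i => (f i).comp κ hκ := by
  obtain ⟨K, _, h, hK⟩ := exists_congruent_kernel hκ hs ν.base.1
  have hν : (ν.map hκ).push K = ν := by
    obtain ⟨⟨ν, _⟩, _⟩ := ν
    simp only [Point.push, Point.map, FinMeas.push] at hK ⊢
    simp only [hK]
  -- The tangent spaces depend on the point, so the equality `hν` is used by substitution for a
  -- variable point rather than by rewriting.
  have key : ∀ ν' : Point s Ω, (ν.map hκ).push K = ν' →
      evalSimple (Θ I) (ν.map hκ) f = evalSimple (Θ Ω) ν' fun i => (f i).comp κ hκ := by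
    rintro ν' rfl
    rw [evalSimple_apply, evalSimple_apply, ← hΘ I Ω K ⟨κ, hκ, h⟩, pullback,
      MultilinearMap.compLinearMap_apply]
    simp only [tangentMap_proj hκ h]
  exact key ν hν

end Evaluation

/-! ### Finite sample spaces -/

section FiniteSpaces

/-- The total masses of the nonzero measures of a setting. -/
def Setting.masses : Setting → Set ℝ
  | .measures => Set.Ioi 0
  | .probabilities => {1}

theorem Setting.masses_pos {s : Setting} {m : ℝ} (hm : m ∈ s.masses) : 0 < m := by
  cases s with
  | measures => exact hm
  | probabilities => rw [show m = 1 from hm]; exact one_pos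

theorem Point.mass_mem {s : Setting} {Ω : Type u} [MeasurableSpace Ω] (ν : Point s Ω)
    (h : 0 < ν.base.mass) : ν.base.mass ∈ s.masses := by
  cases s with
  | measures => exact h
  | probabilities =>
    have h : ν.base.1 univ = 1 := ν.admits
    simp [Setting.masses, FinMeas.mass, Measure.real, h]

theorem Point.mass_map {s : Setting} {Ω I : Type u} [MeasurableSpace Ω] [MeasurableSpace I]
    {κ : Ω → I} (hκ : Measurable κ) (ν : Point s Ω) : (ν.map hκ).base.mass = ν.base.mass :=
  congrArg ENNReal.toReal (Measure.map_apply hκ MeasurableSet.univ)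

variable {s : Setting} {r : Exponent} {n : ℕ} {I : Type u} [Fintype I] [MeasurableSpace I]

theorem Point.ext_singleton {ν ν' : Point s I}
    (h : ∀ x, ν.base.1.real {x} = ν'.base.1.real {x}) : ν = ν' := by
  obtain ⟨⟨ν, _⟩, _⟩ := ν
  obtain ⟨⟨ν', _⟩, _⟩ := ν'
  have : ν = ν' := Measure.ext_of_singleton fun x =>
    (ENNReal.toReal_eq_toReal_iff' (measure_ne_top _ _) (measure_ne_top _ _)).1 (h x)
  subst this
  rfl

variable [DiscreteMeasurableSpace I]

theorem mass_eq_sum_singleton (μ : FinMeas I) : μ.mass = ∑ x, μ.1.real {x} := by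
  rw [FinMeas.mass, ← Finset.coe_univ, sum_measureReal_singleton]

theorem Point.exists_of_weights (w : I → ℝ) (hw : ∀ x, 0 ≤ w x) (hs : ∑ x, w x ∈ s.masses) :
    ∃ ν : Point s I, ∀ x, ν.base.1.real {x} = w x := by
  let μ : Measure I := Measure.sum fun x => ENNReal.ofReal (w x) • Measure.dirac x
  have hμ : ∀ x, μ {x} = ENNReal.ofReal (w x) := fun x => by
    rw [Measure.sum_smul_dirac_singleton]
  have huniv : μ univ = ENNReal.ofReal (∑ x, w x) := by
    rw [← Finset.coe_univ, ← sum_measure_singleton, ENNReal.ofReal_sum_of_nonneg fun x _ => hw x]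
    exact Finset.sum_congr rfl fun x _ => hμ x
  refine ⟨⟨⟨μ, ⟨by rw [huniv]; exact ENNReal.ofReal_lt_top⟩⟩, ?_⟩, fun x => ?_⟩
  · cases s with
    | measures => trivial
    | probabilities =>
      change μ univ = 1
      rw [huniv, show ∑ x, w x = 1 from hs, ENNReal.ofReal_one]
  · rw [Measure.real, hμ, ENNReal.toReal_ofReal (hw x)]

theorem map_real_singleton {Ω : Type u} [Fintype Ω] [MeasurableSpace Ω]
    [DiscreteMeasurableSpace Ω] [DecidableEq I] {κ : Ω → I} (hκ : Measurable κ) (ν : Point s Ω)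
    (x : I) : (ν.map hκ).base.1.real {x} = ∑ y with κ y = x, ν.base.1.real {y} := by
  rw [sum_measureReal_singleton, Measure.real, Point.map, Measure.map_apply hκ (by simp)]
  congr 2
  ext y
  simp

theorem integral_eq_sum_singleton (μ : FinMeas I) (f : I → ℝ) :
    ∫ x, f x ∂μ.1 = ∑ x, μ.1.real {x} * f x := by
  rw [integral_fintype (Integrable.of_finite)]
  rfl

theorem momentProd_uniform {μ : FinMeas I} {w : ℝ} (h : ∀ x, μ.1.real {x} = w)
    (R : ArgPartition n) (f : Fin n → I → ℝ) :
    momentProd μ R f = w ^ R.parts.card * blockSum R f := by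
  rw [momentProd, blockSum_apply, ← Finset.prod_const, ← Finset.prod_mul_distrib]
  refine Finset.prod_congr rfl fun B _ => ?_
  rw [integral_eq_sum_singleton, Finset.mul_sum]
  simp only [h]

/-- Functions on a finite discrete space are simple functions. -/
def simpleOfFinite : (I → ℝ) →ₗ[ℝ] SimpleFunc I ℝ where
  toFun f := SimpleFunc.ofFinite f
  map_add' f g := by ext; rfl
  map_smul' c f := by ext; rfl

theorem coe_simpleOfFinite (f : I → ℝ) : ⇑(simpleOfFinite f) = f := rfl

theorem simpleOfFinite_coe (f : SimpleFunc I ℝ) : simpleOfFinite ⇑f = f := by ext; rfl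

variable {Θ : TensorFamily.{u} s r n}

/-- Permutations of `I` preserve equal weights, so `evalSimple_map` yields the invariance that
`exists_eq_sum_blockSum` requires. -/
theorem exists_evalSimple_uniform (hΘ : IsFinitelyCongruentFamily Θ) {ν : Point s I} {w : ℝ}
    (hw : w ≠ 0) (hν : ∀ x, ν.base.1.real {x} = w) :
    ∃ c : ArgPartition n → ℝ, ∀ f : Fin n → SimpleFunc I ℝ,
      evalSimple (Θ I) ν f = ∑ R, c R * momentProd ν.base R fun i => f i := by
  classical
  obtain ⟨c, hc⟩ := exists_eq_sum_blockSum
    ((evalSimple (Θ I) ν).compLinearMap fun _ => simpleOfFinite) fun σ f => by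
      have hσ : Measurable σ := Measurable.of_discrete
      have h1 : ν.map hσ = ν := Point.ext_singleton fun x => by
        rw [map_real_singleton]
        simp only [hν]
        rw [Finset.sum_const, show (Finset.univ.filter fun y => σ y = x) = {σ.symm x} by
          ext y; simp [Equiv.eq_symm_apply]]
        simp
      have h2 := evalSimple_map hΘ hσ σ.surjective ν fun k => simpleOfFinite (f k)
      rw [h1] at h2
      rw [MultilinearMap.compLinearMap_apply, MultilinearMap.compLinearMap_apply, h2]
      rfl
  -- Each block integral contains the weight `w` once, in contrast to the unweighted block sum.
  refine ⟨fun R => c R / w ^ R.parts.card, fun f => ?_⟩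
  have h1 := hc fun i => f i
  rw [MultilinearMap.compLinearMap_apply] at h1
  simp only [simpleOfFinite_coe] at h1
  rw [h1]
  refine Finset.sum_congr rfl fun R _ => ?_
  rw [momentProd_uniform hν]
  field_simp

theorem eq_zero_of_sum_momentProd {μ : FinMeas I} {w : ℝ} (hw : w ≠ 0)
    (hμ : ∀ x, μ.1.real {x} = w) (hI : n ≤ Fintype.card I) (c : ArgPartition n → ℝ)
    (h : ∀ f : Fin n → I → ℝ, ∑ R, c R * momentProd μ R f = 0) : c = 0 := by
  have h1 := eq_zero_of_sum_blockSum_eq_zero hI (fun R => c R * w ^ R.parts.card) fun f => by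
    rw [← h f]
    refine Finset.sum_congr rfl fun R _ => ?_
    rw [momentProd_uniform hμ, mul_assoc]
  funext R
  have h2 := congrFun h1 R
  simpa [hw] using h2

end FiniteSpaces

/-! ### The coefficients of a congruent family -/

section Coefficients

variable {s : Setting} {r : Exponent} {n : ℕ} {Θ : TensorFamily.{u} s r n}

/-- On simple functions, the family is given by the coefficients `c` at all measures of mass `m` on
finite spaces with equal weights. -/
theorem exists_coeff_uniform (hn : 1 ≤ n) (hΘ : IsFinitelyCongruentFamily Θ) {m : ℝ}
    (hm : m ∈ s.masses) :
    ∃ c : ArgPartition n → ℝ, ∀ (I : Type u) [Fintype I] [MeasurableSpace I]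
      [DiscreteMeasurableSpace I] [Nonempty I] (ν : Point s I),
      (∀ x, ν.base.1.real {x} = m / Fintype.card I) → ∀ f : Fin n → SimpleFunc I ℝ,
        evalSimple (Θ I) ν f = ∑ R, c R * momentProd ν.base R fun i => f i := by
  classical
  have hm0 := Setting.masses_pos hm
  have huniform : ∀ (I : Type u) [Fintype I] [MeasurableSpace I] [DiscreteMeasurableSpace I]
      [Nonempty I], ∃ ν : Point s I, ∀ x, ν.base.1.real {x} = m / Fintype.card I := by
    intro I _ _ _ _
    refine Point.exists_of_weights _ (fun x => by positivity) ?_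
    rw [Finset.sum_const, Finset.card_univ, nsmul_eq_mul, mul_div_cancel₀ _ (by simp)]
    exact hm
  -- A reference space with `n` points, just enough for the coefficients to be determined by the
  -- form.
  let J := ULift.{u} (Fin n)
  let _ : MeasurableSpace J := ⊤
  have : DiscreteMeasurableSpace J := ⟨fun _ => trivial⟩
  have : Nonempty J := ⟨⟨⟨0, hn⟩⟩⟩
  have hJ : Fintype.card J = n := by simp [J]
  obtain ⟨ν₀, hν₀⟩ := huniform J
  obtain ⟨c, hc⟩ := exists_evalSimple_uniform hΘ (by positivity) hν₀
  refine ⟨c, fun I _ _ _ _ ν hν f => ?_⟩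
  -- Equal weights on `I × J` project to equal weights on both factors. The coefficients `d` found
  -- upstairs are therefore valid on `J`, where they must equal `c`, and on `I`.
  let _ : MeasurableSpace (I × J) := ⊤
  have : DiscreteMeasurableSpace (I × J) := ⟨fun _ => trivial⟩
  obtain ⟨ρ, hρ⟩ := huniform (I × J)
  obtain ⟨d, hd⟩ := exists_evalSimple_uniform hΘ (by positivity) hρ
  have h1 : Measurable (Prod.fst : I × J → I) := Measurable.of_discrete
  have h2 : Measurable (Prod.snd : I × J → J) := Measurable.of_discrete
  have e1 : ρ.map h1 = ν := Point.ext_singleton fun x => by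
    rw [map_real_singleton, hν, Finset.sum_congr rfl fun y _ => hρ y, Finset.sum_const,
      show (Finset.univ.filter fun y : I × J => y.1 = x) = {x} ×ˢ Finset.univ by
        ext ⟨y, z⟩; simp [eq_comm],
      Finset.card_product, Fintype.card_prod]
    simp
    field_simp
  have e2 : ρ.map h2 = ν₀ := Point.ext_singleton fun x => by
    rw [map_real_singleton, hν₀, Finset.sum_congr rfl fun y _ => hρ y, Finset.sum_const,
      show (Finset.univ.filter fun y : I × J => y.2 = x) = Finset.univ ×ˢ {x} by
        ext ⟨y, z⟩; simp [eq_comm],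
      Finset.card_product, Fintype.card_prod]
    simp
    field_simp
  have hcd : d - c = 0 := by
    refine eq_zero_of_sum_momentProd (by positivity) hν₀ hJ.ge (d - c) fun g => ?_
    have h3 := evalSimple_map hΘ h2 Prod.snd_surjective ρ fun i => simpleOfFinite (g i)
    rw [hd] at h3
    simp only [← momentProd_map] at h3
    rw [e2, hc] at h3
    simp only [coe_simpleOfFinite] at h3
    simp only [Pi.sub_apply, sub_mul, Finset.sum_sub_distrib]
    exact sub_eq_zero.2 h3.symm
  have h3 := evalSimple_map hΘ h1 Prod.fst_surjective ρ f
  rw [hd] at h3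
  simp only [← momentProd_map] at h3
  rwa [e1, sub_eq_zero.1 hcd] at h3

/-- Every measure on a finite space is expressed through the counting measure. Convergence in `S^r`
then follows from convergence of the weights, by continuity of a linear map on a finite-dimensional
space. -/
theorem rootPow_eq_of_finite {I : Type u} [Fintype I] [MeasurableSpace I]
    [DiscreteMeasurableSpace I] (r : Exponent) (ν : FinMeas I) :
    rootPow r ν = densityPow r ⟨Measure.count, inferInstance⟩
      (simpleLp r _ (simpleOfFinite fun x => ν.1.real {x} ^ (r : ℝ))) := by
  have hg : Measurable fun x : I => ν.1 {x} := Measurable.of_discrete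
  have h : ν.1 = Measure.count.withDensity fun x => ν.1 {x} := by
    refine Measure.ext_of_singleton fun x => ?_
    rw [withDensity_apply _ (by simp), lintegral_singleton, Measure.count_singleton, mul_one]
  refine rootPow_eq r ?_ ((coeFn_simpleLp r _ _).trans ?_)
  · rw [FinMeas.le_def, h]
    exact withDensity_absolutelyContinuous _ _
  · have h1 := Measure.rnDeriv_withDensity (Measure.count : Measure I) hg
    rw [← h] at h1
    filter_upwards [h1] with x hx
    rw [hx]
    rfl

theorem tendsto_rootPow_of_finite {I : Type u} [Fintype I] [MeasurableSpace I]
    [DiscreteMeasurableSpace I] (r : Exponent) {ι : Type*} {l : Filter ι} {ν : ι → FinMeas I}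
    {ν₀ : FinMeas I}
    (h : ∀ x, Filter.Tendsto (fun k => (ν k).1.real {x}) l (𝓝 (ν₀.1.real {x}))) :
    Filter.Tendsto (fun k => rootPow r (ν k)) l (𝓝 (rootPow r ν₀)) := by
  simp only [rootPow_eq_of_finite]
  let L : (I → ℝ) →ₗ[ℝ] RootMeas r I :=
    densityPow r _ ∘ₗ simpleLp r ⟨Measure.count, inferInstance⟩ ∘ₗ simpleOfFinite
  have hL : Continuous L := L.continuous_of_finiteDimensional
  exact (hL.tendsto _).comp (tendsto_pi_nhds.2 fun x =>
    (h x).rpow_const (Or.inr r.2.1.le))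

theorem tendsto_evalSimple {Ω : Type u} [MeasurableSpace Ω] (Ψ : TensorField s r n Ω) {ι : Type*}
    {l : Filter ι} {ν : ι → Point s Ω} {ν₀ : Point s Ω}
    (h : Filter.Tendsto (fun k => rootPow r (ν k).base) l (𝓝 (rootPow r ν₀.base)))
    (f : Fin n → SimpleFunc Ω ℝ) :
    Filter.Tendsto (fun k => evalSimple Ψ (ν k) f) l (𝓝 (evalSimple Ψ ν₀ f)) :=
  tendsto_of_continuous_powTopology (Ψ.continuous_form fun i => simpleField s r (f i)) h

theorem tendsto_momentProd {I : Type u} [Fintype I] [MeasurableSpace I]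
    [DiscreteMeasurableSpace I] {ι : Type*} {l : Filter ι} {ν : ι → FinMeas I}
    {ν₀ : FinMeas I}
    (h : ∀ x, Filter.Tendsto (fun k => (ν k).1.real {x}) l (𝓝 (ν₀.1.real {x})))
    (R : ArgPartition n) (f : Fin n → I → ℝ) :
    Filter.Tendsto (fun k => momentProd (ν k) R f) l (𝓝 (momentProd ν₀ R f)) := by
  simp only [momentProd, integral_eq_sum_singleton]
  exact tendsto_finsetProd _ fun B _ => tendsto_finsetSum _ fun x _ => (h x).mul_const _

/-- On simple functions, the family is given by the coefficients `c` at all measures of mass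
`m`. -/
def HasCoeff (Θ : TensorFamily.{u} s r n) (m : ℝ) (c : ArgPartition n → ℝ) : Prop :=
  ∀ (Ω : Type u) [MeasurableSpace Ω] (ν : Point s Ω), ν.base.mass = m →
    ∀ f : Fin n → SimpleFunc Ω ℝ,
      evalSimple (Θ Ω) ν f = ∑ R, c R * momentProd ν.base R fun i => f i

/-- Weights in rational proportion are images of equal weights on a larger set. General weights are
limits of these at fixed total mass `m`, and both sides are continuous. -/
theorem evalSimple_eq_of_finite (hΘ : IsFinitelyCongruentFamily Θ) {m : ℝ}
    (hm : m ∈ s.masses) {c : ArgPartition n → ℝ}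
    (hc : ∀ (I : Type u) [Fintype I] [MeasurableSpace I]
      [DiscreteMeasurableSpace I] [Nonempty I] (ν : Point s I),
      (∀ x, ν.base.1.real {x} = m / Fintype.card I) → ∀ f : Fin n → SimpleFunc I ℝ,
        evalSimple (Θ I) ν f = ∑ R, c R * momentProd ν.base R fun i => f i)
    {I : Type u} [Fintype I] [MeasurableSpace I] [DiscreteMeasurableSpace I]
    (ν : Point s I) (hν : ν.base.mass = m) (f : Fin n → SimpleFunc I ℝ) :
    evalSimple (Θ I) ν f = ∑ R, c R * momentProd ν.base R fun i => f i := by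
  classical
  have hm0 := Setting.masses_pos hm
  have hsum : ∑ x, ν.base.1.real {x} = m := by rw [← mass_eq_sum_singleton, hν]
  have hI : Nonempty I := by
    by_contra hI
    rw [not_nonempty_iff] at hI
    rw [Finset.univ_eq_empty, Finset.sum_empty] at hsum
    exact hm0.ne hsum
  let w : I → ℝ := fun x => ν.base.1.real {x}
  -- The number of equal atoms placed over `x`. The added one keeps every fibre nonempty, so that
  -- the projection is surjective, and is negligible after division by `k`.
  let a : ℕ → I → ℕ := fun k x => ⌊w x * k⌋₊ + 1
  have approx : ∀ k : ℕ, ∃ ν' : Point s I,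
      (∀ x, ν'.base.1.real {x} = m / (∑ y, (a k y : ℝ)) * a k x) ∧
        ∀ f : Fin n → SimpleFunc I ℝ,
          evalSimple (Θ I) ν' f = ∑ R, c R * momentProd ν'.base R fun i => f i := by
    intro k
    let J := Σ x : I, Fin (a k x)
    let _ : MeasurableSpace J := ⊤
    have : DiscreteMeasurableSpace J := ⟨fun _ => trivial⟩
    have hs : Function.Surjective (Sigma.fst : J → I) := fun x =>
      ⟨⟨x, ⟨0, Nat.succ_pos _⟩⟩, rfl⟩
    have : Nonempty J := hI.map fun x => ⟨x, ⟨0, Nat.succ_pos _⟩⟩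
    have hJ : (Fintype.card J : ℝ) = ∑ y, (a k y : ℝ) := by
      rw [Fintype.card_sigma]
      simp
    obtain ⟨ρ, hρ⟩ := Point.exists_of_weights (s := s) (I := J) (fun _ => m / Fintype.card J)
      (fun x => by positivity) (by
        rw [Finset.sum_const, Finset.card_univ, nsmul_eq_mul, mul_div_cancel₀ _ (by simp)]
        exact hm)
    have h1 : Measurable (Sigma.fst : J → I) := Measurable.of_discrete
    refine ⟨ρ.map h1, fun x => ?_, fun f => ?_⟩
    · rw [map_real_singleton, Finset.sum_congr rfl fun y _ => hρ y, Finset.sum_const, ← hJ,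
        nsmul_eq_mul, mul_comm]
      congr 2
      rw [← Fintype.card_fin (a k x), ← Finset.card_univ, ← Finset.card_map
        (Function.Embedding.sigmaMk (β := fun y => Fin (a k y)) x)]
      congr 1
      ext ⟨y, i⟩
      simp only [Finset.mem_filter, Finset.mem_univ, true_and, Finset.mem_map,
        Function.Embedding.sigmaMk_apply]
      constructor
      · rintro rfl
        exact ⟨i, rfl⟩
      · rintro ⟨i', h⟩
        exact (congrArg Sigma.fst h).symm
    · rw [evalSimple_map hΘ h1 hs, hc J ρ hρ]
      simp only [momentProd_map]
  choose ν' hν' hf using approx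
  have ha : ∀ x, Filter.Tendsto (fun k : ℕ => (a k x : ℝ) / k) Filter.atTop (𝓝 (w x)) := by
    intro x
    have h1 := (tendsto_nat_floor_mul_div_atTop (measureReal_nonneg : 0 ≤ w x)).comp
      (tendsto_natCast_atTop_atTop (R := ℝ))
    have h2 := h1.add (tendsto_one_div_atTop_nhds_zero_nat (𝕜 := ℝ))
    rw [add_zero] at h2
    refine h2.congr fun k => ?_
    simp only [a, Function.comp_apply, Nat.cast_add, Nat.cast_one, add_div]
    rfl
  have hlim : ∀ x, Filter.Tendsto (fun k => (ν' k).base.1.real {x}) Filter.atTop (𝓝 (w x)) := by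
    intro x
    have h1 := (tendsto_finsetSum Finset.univ fun y _ => ha y)
    have h2 := ((tendsto_const_nhds (x := m)).div h1 (hsum.trans_ne hm0.ne')).mul (ha x)
    rw [hsum, div_self hm0.ne', one_mul] at h2
    refine h2.congr' ?_
    filter_upwards [Filter.eventually_gt_atTop 0] with k hk
    have hk' : (k : ℝ) ≠ 0 := by positivity
    rw [hν']
    simp only [Pi.div_apply, ← Finset.sum_div]
    field_simp
  refine tendsto_nhds_unique
    ((tendsto_evalSimple (Θ I) (tendsto_rootPow_of_finite r hlim) f).congr (hf · f)) ?_
  exact tendsto_finsetSum _ fun R _ => (tendsto_momentProd hlim R _).const_mul _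

/-- Finitely many simple functions factor through the finite set of their joint values, where the
finite case applies. -/
theorem exists_hasCoeff (hn : 1 ≤ n) (hΘ : IsFinitelyCongruentFamily Θ) {m : ℝ}
    (hm : m ∈ s.masses) : ∃ c, HasCoeff Θ m c := by
  obtain ⟨c, hc⟩ := exists_coeff_uniform hn hΘ hm
  refine ⟨c, fun Ω _ ν hν f => ?_⟩
  let F : Ω → Fin n → ℝ := fun x i => f i x
  have hF : Measurable F := measurable_pi_iff.2 fun i => (f i).measurable
  have hfin : (Set.range F).Finite :=
    (Set.Finite.pi' fun i => (f i).finite_range).subset (by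
      rintro _ ⟨x, rfl⟩ i
      exact mem_range_self x)
  -- The quotient of `Ω` stands in for the range of `F`: it lies in the universe of `Ω`, as the
  -- family requires, and the projection onto it is surjective.
  let I := Quotient (Setoid.ker F)
  let _ : MeasurableSpace I := ⊤
  have : DiscreteMeasurableSpace I := ⟨fun _ => trivial⟩
  have : Finite I := by
    have := hfin.to_subtype
    exact Finite.of_equiv _ (Setoid.quotientKerEquivRange F).symm
  have := Fintype.ofFinite I
  let κ : Ω → I := Quotient.mk _
  have hκ : Measurable κ := fun A _ => by
    have h1 : κ ⁻¹' A = F ⁻¹' (F '' (κ ⁻¹' A)) := by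
      refine Set.Subset.antisymm (Set.subset_preimage_image _ _) ?_
      rintro x ⟨y, hy, hxy⟩
      have h2 : κ y = κ x := Quotient.sound hxy
      change κ x ∈ A
      rw [← h2]
      exact hy
    rw [h1]
    exact hF (hfin.subset (Set.image_subset_range _ _)).measurableSet
  let g : Fin n → SimpleFunc I ℝ := fun i => SimpleFunc.ofFinite
    (Quotient.lift (fun x => f i x) fun x y h => congrFun h i)
  have hg : ∀ i, (g i).comp κ hκ = f i := fun i => by ext x; rfl
  have h1 := evalSimple_eq_of_finite hΘ hm hc (ν.map hκ) ((ν.mass_map hκ).trans hν) g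
  rw [evalSimple_map hΘ hκ Quotient.mk_surjective] at h1
  simp only [momentProd_map, hg] at h1
  exact h1

end Coefficients

/-! ### Large blocks and continuity of the coefficients -/

section LargeBlocks

variable {s : Setting} {r : Exponent} {n : ℕ} {Θ : TensorFamily.{u} s r n}

theorem momentProd_eq_prod_sum {I : Type u} [Fintype I] [MeasurableSpace I]
    [DiscreteMeasurableSpace I] (μ : FinMeas I) (R : ArgPartition n) (f : Fin n → I → ℝ) :
    momentProd μ R f = ∏ B ∈ R.parts, ∑ x, μ.1.real {x} * ∏ i ∈ B, f i x := by
  simp only [momentProd, integral_eq_sum_singleton]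

/-- Weights of total mass `m` on `n + 1` points: `ε` at `none` and the rest equally distributed. -/
def spikeWeight (n : ℕ) (m ε : ℝ) : Option (ULift.{u} (Fin n)) → ℝ
  | none => ε
  | some _ => (m - ε) / n

theorem sum_spikeWeight (hn : 1 ≤ n) (m ε : ℝ) : ∑ x, spikeWeight.{u} n m ε x = m := by
  have : (n : ℝ) ≠ 0 := by positivity
  rw [Fintype.sum_option]
  simp only [spikeWeight, Finset.sum_const, Finset.card_univ, Fintype.card_ulift, Fintype.card_fin,
    nsmul_eq_mul]
  field_simp
  ring

open Classical in
-- The block `p` is placed exactly at the point that carries the small mass; the other blocks go to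
-- distinct points of fixed positive mass.
theorem exists_isKernelOf_spike {Q : ArgPartition n} {p : Finset (Fin n)} (hp : p ∈ Q.parts) :
    ∃ j : Fin n → Option (ULift.{u} (Fin n)), IsKernelOf Q j ∧ ∀ i, j i = none ↔ i ∈ p := by
  obtain ⟨j', hj'⟩ := exists_isKernelOf_fin Q
  have hpart : ∀ i, i ∈ p ↔ Q.part i = p := fun i => (Q.part_eq_iff_mem hp).symm
  refine ⟨fun i => if i ∈ p then none else some ⟨j' i⟩, fun x y => ?_, fun i => by simp⟩
  by_cases hx : x ∈ p <;> by_cases hy : y ∈ p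
  · simp [hx, hy, (hpart x).1 hx, (hpart y).1 hy]
  · simp only [hx, hy, if_true, if_false, (hpart x).1 hx, reduceCtorEq, false_iff]
    exact fun h => hy ((hpart y).2 h.symm)
  · simp only [hx, hy, if_true, if_false, (hpart y).1 hy, reduceCtorEq, false_iff]
    exact fun h => hx ((hpart x).2 h)
  · simp only [hx, hy, if_false, Option.some.injEq, ULift.up.injEq]
    exact hj' x y

open Classical in
/-- The limit at `ε = 0` of `ε⁻¹ ∏_B ∑_x w_x ∏_i f_i(x)`, for the weights `spikeWeight` and indicator
functions `f_i` of points. -/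
theorem spike_limit {Q R : ArgPartition n} {p : Finset (Fin n)}
    {j : Fin n → Option (ULift.{u} (Fin n))} (hj : IsKernelOf Q j)
    (hjp : ∀ i, j i = none ↔ i ∈ p) {i₀ : Fin n} (hi₀ : i₀ ∈ p) (m : ℝ) :
    (if ∀ k ∈ R.part i₀, ∀ l ∈ R.part i₀, j k = j l then (1 : ℝ) else 0) *
        ∏ B ∈ R.parts.erase (R.part i₀),
          ∑ x, spikeWeight n m 0 x * ∏ i ∈ B, (Pi.single (j i) (1 : ℝ) : _ → ℝ) x
      = if R ≤ Q then if p ∈ R.parts then (m / n) ^ (R.parts.card - 1) else 0 else 0 := by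
  have hR := R.part_mem.2 (Finset.mem_univ i₀)
  by_cases hRQ : R ≤ Q
  · have hconst := hj.constOnBlocks_iff.2 hRQ
    rw [if_pos hRQ, if_pos (hconst _ hR), one_mul]
    split_ifs with hpR
    · have hpart : R.part i₀ = p := R.part_eq_of_mem hpR hi₀
      rw [hpart, ← Finset.card_erase_of_mem hpR, ← Finset.prod_const]
      refine Finset.prod_congr rfl fun B hB => ?_
      have hB' := Finset.mem_of_mem_erase hB
      obtain ⟨i, hi⟩ := R.nonempty_of_mem_parts hB'
      rw [sum_mul_prod_single hi, if_pos (hconst B hB')]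
      have hji : j i ≠ none := fun h =>
        Finset.ne_of_mem_erase hB (R.eq_of_mem_parts hB' hpR hi ((hjp i).1 h))
      obtain ⟨y, hy⟩ := Option.ne_none_iff_exists'.1 hji
      rw [hy]
      simp [spikeWeight]
    -- If `p` is not a block of `R`, then it splits into several blocks of `R`. Besides the block of
    -- `i₀`, another one sits at `none`, where the limiting weight is zero.
    · have hsub : R.part i₀ ⊆ p := fun k hk => by
        rw [← hjp, hconst _ hR k hk i₀ (R.mem_part_self.2 (Finset.mem_univ _)), hjp]
        exact hi₀
      obtain ⟨i₁, hi₁, hi₁'⟩ : ∃ i ∈ p, i ∉ R.part i₀ := by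
        by_contra! h
        exact hpR (hsub.antisymm h ▸ hR)
      refine Finset.prod_eq_zero (i := R.part i₁) (Finset.mem_erase.2 ⟨?_,
        R.part_mem.2 (Finset.mem_univ _)⟩) ?_
      · intro h
        exact hi₁' (h ▸ R.mem_part_self.2 (Finset.mem_univ _))
      · rw [sum_mul_prod_single (R.mem_part_self.2 (Finset.mem_univ i₁)), (hjp i₁).2 hi₁]
        simp [spikeWeight]
  · rw [if_neg hRQ]
    rw [← hj.constOnBlocks_iff] at hRQ
    have hB : ∃ B ∈ R.parts, ¬ ∀ k ∈ B, ∀ l ∈ B, j k = j l := by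
      by_contra! h
      exact hRQ h
    obtain ⟨B, hB, hBc⟩ := hB
    by_cases hBe : B = R.part i₀
    · rw [← hBe, if_neg hBc, zero_mul]
    · refine mul_eq_zero_of_right _ (Finset.prod_eq_zero (Finset.mem_erase.2 ⟨hBe, hB⟩) ?_)
      obtain ⟨i, hi⟩ := R.nonempty_of_mem_parts hB
      rw [sum_mul_prod_single hi, if_neg hBc]

/-- The arguments in `p` are tested with spike fields along measures whose mass `ε` at one point
tends to zero. The value is `ε^{1 - a|p|}` times an expression with a finite limit. Continuity makes
the value converge although the exponent is negative, so that limit must vanish, and inversion over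
the partitions that contain `p` isolates `c R`. -/
theorem HasCoeff.eq_zero_of_large_block (hn : 1 ≤ n) {m : ℝ} (hm : m ∈ s.masses)
    {c : ArgPartition n → ℝ} (hc : HasCoeff Θ m c) {p : Finset (Fin n)}
    (hp : 1 / (r : ℝ) < p.card) {R : ArgPartition n} (hR : p ∈ R.parts) : c R = 0 := by
  classical
  have hm0 := Setting.masses_pos hm
  have hn0 : (0 : ℝ) < n := by exact_mod_cast hn
  have hr := r.2.1
  let I := Option (ULift.{u} (Fin n))
  let _ : MeasurableSpace I := ⊤
  have : DiscreteMeasurableSpace I := ⟨fun _ => trivial⟩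
  let ε : ℕ → ℝ := fun k => m * (1 / ((k : ℝ) + 1))
  have hε0 : ∀ k, 0 < ε k := fun k => by positivity
  have hεm : ∀ k, ε k ≤ m := fun k => by
    have : 1 / ((k : ℝ) + 1) ≤ 1 := by
      rw [div_le_one (by positivity)]
      linarith [(Nat.cast_nonneg k : (0 : ℝ) ≤ k)]
    exact mul_le_of_le_one_right hm0.le this
  have hε : Filter.Tendsto ε Filter.atTop (𝓝 0) := by
    have := (tendsto_one_div_add_atTop_nhds_zero_nat (𝕜 := ℝ)).const_mul m
    rwa [mul_zero] at this
  have hex : ∀ e, 0 ≤ e → e ≤ m →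
      ∃ ν : Point s I, ∀ x, ν.base.1.real {x} = spikeWeight n m e x := fun e he hem =>
    Point.exists_of_weights _ (fun x => by
      cases x with
      | none => exact he
      | some _ => exact div_nonneg (sub_nonneg.2 hem) hn0.le) (by rwa [sum_spikeWeight hn])
  choose ν hν using fun k => hex (ε k) (hε0 k).le (hεm k)
  obtain ⟨ν₀, hν₀⟩ := hex 0 le_rfl hm0.le
  have hw : ∀ x, Filter.Tendsto (fun k => spikeWeight.{u} n m (ε k) x) Filter.atTop
      (𝓝 (spikeWeight n m 0 x)) := fun x => by
    cases x with
    | none => exact hε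
    | some _ => exact (tendsto_const_nhds.sub hε).div_const _
  have hlim : Filter.Tendsto (fun k => rootPow r (ν k).base) Filter.atTop
      (𝓝 (rootPow r ν₀.base)) := tendsto_rootPow_of_finite r fun x => by
    simp only [hν, hν₀]
    exact hw x
  -- The bound `a < r` makes the spike field continuous and `1/|p| < a` makes the moment diverge;
  -- the interval is nonempty precisely because `1/r < |p|`.
  obtain ⟨a, ha1, ha2⟩ : ∃ a : ℝ, 1 / (p.card : ℝ) < a ∧ a < r := by
    refine exists_between ?_
    have h0 : 0 < 1 / (r : ℝ) := by positivity
    rwa [one_div_lt (h0.trans hp) hr]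
  have hp0 : (0 : ℝ) < p.card := lt_trans (by positivity) hp
  have ha0 : 0 < a := lt_trans (by positivity) ha1
  have hap : 0 < a * p.card - 1 := by
    rw [div_lt_iff₀ hp0] at ha1
    linarith
  have key : ∀ Q : ArgPartition n, p ∈ Q.parts →
      ∑ R, c R * (if R ≤ Q then if p ∈ R.parts then (m / n) ^ (R.parts.card - 1) else 0 else 0)
        = 0 := by
    intro Q hQ
    obtain ⟨j, hj, hjp⟩ := exists_isKernelOf_spike.{u} hQ
    obtain ⟨i₀, hi₀⟩ := Q.nonempty_of_mem_parts hQ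
    let f : Fin n → I → ℝ := fun i => Pi.single (j i) 1
    let X : Fin n → VectorField s r I := fun i => if i ∈ p then
        spikeField s r (measurableSet_singleton none) ha0 ha2
      else simpleField s r (simpleOfFinite (f i))
    have hind : ∀ i ∈ p, indicatorSimple {none} (measurableSet_singleton none)
        = simpleOfFinite (f i) := fun i hi => by
      ext x
      rw [coe_indicatorSimple, coe_simpleOfFinite]
      simp only [f, (hjp i).2 hi, Set.indicator, Pi.single_apply, mem_singleton_iff, Pi.one_apply]
    have hX : ∀ (ν : Point s I) (i : Fin n), (X i).val ν =
        (if i ∈ p then ν.base.1.real {none} ^ (-a) else 1) •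
          tangentProj s r ν (simpleLp r ν.base (simpleOfFinite (f i))) := fun ν i => by
      simp only [X]
      split_ifs with hi
      · rw [← hind i hi]
        rfl
      · rw [one_smul]
        rfl
    have hform : ∀ ν : Point s I, (Θ I).form ν (fun i => (X i).val ν) =
        (ν.base.1.real {none} ^ (-a)) ^ p.card *
          evalSimple (Θ I) ν fun i => simpleOfFinite (f i) := fun ν => by
      simp only [hX]
      rw [MultilinearMap.map_smul_univ, Finset.prod_ite_mem, Finset.univ_inter, Finset.prod_const,
        smul_eq_mul]
      rfl
    have hmass : ∀ k, (ν k).base.mass = m := fun k => by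
      rw [mass_eq_sum_singleton]
      simp only [hν]
      exact sum_spikeWeight hn m _
    have h1 := tendsto_of_continuous_powTopology ((Θ I).continuous_form X) hlim
    have hz : (Θ I).form ν₀ (fun i => (X i).val ν₀) = 0 := by
      refine MultilinearMap.map_coord_zero _ i₀ ?_
      rw [hX, if_pos hi₀, hν₀]
      simp [spikeWeight, Real.zero_rpow (neg_ne_zero.2 ha0.ne')]
    rw [hz] at h1
    -- This factor cancels the divergence `ε^{1 - a|p|}` exactly. It tends to zero and the tensor
    -- values converge, so the renormalised sum has limit zero.
    have h2 : Filter.Tendsto (fun k => ε k ^ (a * p.card - 1)) Filter.atTop (𝓝 0) := by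
      have := hε.rpow_const (p := a * p.card - 1) (Or.inr hap.le)
      rwa [Real.zero_rpow hap.ne'] at this
    have h3 := h2.mul h1
    rw [mul_zero] at h3
    have hBW : ∀ k R, momentProd (ν k).base R f = ε k *
        ((if ∀ k ∈ R.part i₀, ∀ l ∈ R.part i₀, j k = j l then (1 : ℝ) else 0) *
        ∏ B ∈ R.parts.erase (R.part i₀),
          ∑ x, spikeWeight n m (ε k) x * ∏ i ∈ B, (Pi.single (j i) (1 : ℝ) : _ → ℝ) x) := by
      intro k R
      rw [momentProd_eq_prod_sum, ← Finset.mul_prod_erase _ _ (R.part_mem.2 (Finset.mem_univ i₀)),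
        ← mul_assoc]
      simp only [hν]
      congr 1
      rw [sum_mul_prod_single (R.mem_part_self.2 (Finset.mem_univ i₀)), (hjp i₀).2 hi₀]
      simp [spikeWeight]
    have h4 : ∀ k, ε k ^ (a * p.card - 1) * (Θ I).form (ν k) (fun i => (X i).val (ν k)) =
        ∑ R, c R * ((if ∀ k ∈ R.part i₀, ∀ l ∈ R.part i₀, j k = j l then (1 : ℝ) else 0) *
        ∏ B ∈ R.parts.erase (R.part i₀),
          ∑ x, spikeWeight n m (ε k) x * ∏ i ∈ B, (Pi.single (j i) (1 : ℝ) : _ → ℝ) x) := by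
      intro k
      rw [hform, hc I (ν k) (hmass k)]
      simp only [coe_simpleOfFinite, hBW, hν]
      rw [← Real.rpow_natCast, show spikeWeight.{u} n m (ε k) none = ε k from rfl,
        ← Real.rpow_mul (hε0 k).le, ← mul_assoc, ← Real.rpow_add (hε0 k),
        show a * p.card - 1 + -a * p.card = -1 by ring, Real.rpow_neg_one, Finset.mul_sum]
      refine Finset.sum_congr rfl fun R _ => ?_
      have := (hε0 k).ne'
      field_simp
    have h5 : Filter.Tendsto (fun k =>
        ∑ R, c R * ((if ∀ k ∈ R.part i₀, ∀ l ∈ R.part i₀, j k = j l then (1 : ℝ) else 0) *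
        ∏ B ∈ R.parts.erase (R.part i₀),
          ∑ x, spikeWeight n m (ε k) x * ∏ i ∈ B, (Pi.single (j i) (1 : ℝ) : _ → ℝ) x))
        Filter.atTop (𝓝 (∑ R, c R *
          ((if ∀ k ∈ R.part i₀, ∀ l ∈ R.part i₀, j k = j l then (1 : ℝ) else 0) *
        ∏ B ∈ R.parts.erase (R.part i₀),
          ∑ x, spikeWeight n m 0 x * ∏ i ∈ B, (Pi.single (j i) (1 : ℝ) : _ → ℝ) x))) :=
      tendsto_finsetSum _ fun R _ => Filter.Tendsto.const_mul _ (Filter.Tendsto.const_mul _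
        (tendsto_finsetProd _ fun B _ => tendsto_finsetSum _ fun x _ => (hw x).mul_const _))
    have h6 := tendsto_nhds_unique h5 (h3.congr h4)
    simpa only [spike_limit hj hjp hi₀ m] using h6
  -- For `Q` without the block `p` the unknown is zero by definition; for `Q` with it, the equation
  -- is `key Q`.
  have hd := eq_zero_of_sum_Iic
    (fun R : ArgPartition n => if p ∈ R.parts then c R * (m / n) ^ (R.parts.card - 1) else 0)
    fun Q => by
      by_cases hQ : p ∈ Q.parts
      · right
        refine (Finset.sum_congr rfl fun R _ => ?_).trans (key Q hQ)
        split_ifs <;> simp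
      · left
        simp [hQ]
  have h := congrFun hd R
  simp only [hR, if_true, Pi.zero_apply] at h
  exact (mul_eq_zero.1 h).resolve_right (by positivity)

/-- Equal weights on `n` points vary continuously with the mass. The values on indicators are thus
continuous and triangular in the coefficients, which can be peeled off by induction over refinement.
-/
theorem continuousOn_coeff (hn : 1 ≤ n) {c : ℝ → ArgPartition n → ℝ}
    (hc : ∀ m ∈ s.masses, HasCoeff Θ m (c m)) (R : ArgPartition n) :
    ContinuousOn (fun m => c m R) s.masses := by
  classical
  cases s with
  | probabilities => exact continuousOn_singleton _ _
  | measures =>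
  have hn0 : (0 : ℝ) < n := by exact_mod_cast hn
  let I := ULift.{u} (Fin n)
  let _ : MeasurableSpace I := ⊤
  have : DiscreteMeasurableSpace I := ⟨fun _ => trivial⟩
  have hI : Fintype.card I = n := by simp [I]
  -- For `m ≤ 0` the zero measure is an arbitrary filler, making `ν` a function on all of `ℝ`.
  have hex : ∀ m : ℝ, ∃ ν : Point .measures I, 0 < m → ∀ x, ν.base.1.real {x} = m / n := by
    intro m
    by_cases hm : 0 < m
    · obtain ⟨ν, hν⟩ := Point.exists_of_weights (s := .measures) (I := I) (fun _ => m / n)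
        (fun _ => by positivity) (by
          rw [Finset.sum_const, Finset.card_univ, hI, nsmul_eq_mul, mul_div_cancel₀ _ hn0.ne']
          exact hm)
      exact ⟨ν, fun _ => hν⟩
    · exact ⟨⟨⟨0, inferInstance⟩, trivial⟩, fun h => absurd h hm⟩
  choose ν hν using hex
  have hroot : ∀ m₀ : ℝ, 0 < m₀ → Filter.Tendsto (fun m => rootPow r (ν m).base)
      (𝓝[Set.Ioi 0] m₀) (𝓝 (rootPow r (ν m₀).base)) := fun m₀ hm₀ =>
    tendsto_rootPow_of_finite r fun x => by
      rw [hν m₀ hm₀]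
      refine Filter.Tendsto.congr' ?_
        ((Filter.tendsto_id.mono_left nhdsWithin_le_nhds).div_const (n : ℝ))
      filter_upwards [self_mem_nhdsWithin] with m hm
      exact (hν m hm x).symm
  have key : ∀ Q : ArgPartition n,
      ContinuousOn (fun m => ∑ R, if R ≤ Q then c m R * (m / n) ^ R.parts.card else 0)
        (Set.Ioi 0) := by
    intro Q
    obtain ⟨j, hj⟩ := exists_isKernelOf_of_le_card hI.ge Q
    have heval : ∀ m : ℝ, 0 < m →
        evalSimple (Θ I) (ν m) (fun i => simpleOfFinite (Pi.single (j i) 1)) =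
          ∑ R, if R ≤ Q then c m R * (m / n) ^ R.parts.card else 0 := by
      intro m hm
      rw [hc m hm I (ν m) (by
        rw [mass_eq_sum_singleton]
        simp only [hν m hm]
        rw [Finset.sum_const, Finset.card_univ, hI, nsmul_eq_mul, mul_div_cancel₀ _ hn0.ne'])]
      simp only [coe_simpleOfFinite]
      refine Finset.sum_congr rfl fun R _ => ?_
      rw [momentProd_uniform (hν m hm), blockSum_single, hj.constOnBlocks_iff]
      split_ifs <;> simp
    intro m₀ hm₀
    have h1 := tendsto_evalSimple (Θ I) (hroot m₀ hm₀)
      fun i => simpleOfFinite (Pi.single (j i) 1)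
    rw [heval m₀ hm₀] at h1
    refine h1.congr' ?_
    filter_upwards [self_mem_nhdsWithin] with m hm
    exact heval m hm
  have key2 : ∀ Q : ArgPartition n,
      ContinuousOn (fun m => c m Q * (m / n) ^ Q.parts.card) (Set.Ioi 0) := by
    intro Q
    induction Q using WellFoundedLT.induction with
    | ind Q ih =>
      have h1 : ContinuousOn
          (fun m => ∑ R, if R < Q then c m R * (m / n) ^ R.parts.card else 0) (Set.Ioi 0) := by
        refine continuousOn_finsetSum _ fun R _ => ?_
        by_cases hR : R < Q
        · simpa only [hR, if_true] using ih R hR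
        · simpa only [hR, if_false] using continuousOn_const
      refine ((key Q).sub h1).congr fun m _ => ?_
      rw [Pi.sub_apply, ← Finset.sum_sub_distrib, Finset.sum_eq_single Q]
      · simp
      · intro R _ hR
        have : R ≤ Q ↔ R < Q := ⟨fun h => lt_of_le_of_ne h hR, le_of_lt⟩
        simp [this]
      · simp
  refine ContinuousOn.congr ((key2 R).div (f := _) (g := fun m : ℝ => (m / n) ^ R.parts.card)
    ((continuous_id.div_const _).pow _).continuousOn fun m hm => ?_) fun m hm => ?_
  · have : (0 : ℝ) < m := hm
    positivity
  · have : (0 : ℝ) < m := hm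
    rw [Pi.div_apply]
    field_simp

end LargeBlocks

/-! ### Integrals of products -/

section Products

/-- Either all factors are at most one, or the largest exceeds one and its power bounds the product.
This elementary bound serves in place of Hölder's inequality. -/
theorem prod_abs_le_one_add_sum {ι : Type*} [Fintype ι] {p : ℝ} (hp : (Fintype.card ι : ℝ) ≤ p)
    (x : ι → ℝ) : ∏ i, |x i| ≤ 1 + ∑ i, |x i| ^ p := by
  have hnn : ∀ i, 0 ≤ |x i| ^ p := fun i => Real.rpow_nonneg (abs_nonneg _) _
  by_cases h : ∀ i, |x i| ≤ 1
  · have h1 : ∏ i, |x i| ≤ 1 := Finset.prod_le_one (fun i _ => abs_nonneg _) fun i _ => h i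
    linarith [Finset.sum_nonneg fun i (_ : i ∈ Finset.univ) => hnn i]
  · push Not at h
    obtain ⟨i, hi⟩ := h
    obtain ⟨j, -, hj⟩ := Finset.exists_max_image Finset.univ (fun i => |x i|)
      ⟨i, Finset.mem_univ i⟩
    have hj1 : 1 ≤ |x j| := hi.le.trans (hj i (Finset.mem_univ i))
    have h1 : ∏ i, |x i| ≤ |x j| ^ p := by
      refine (Finset.prod_le_prod (fun i _ => abs_nonneg _) hj).trans ?_
      rw [Finset.prod_const, Finset.card_univ, ← Real.rpow_natCast]
      exact Real.rpow_le_rpow_of_exponent_le hj1 hp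
    linarith [Finset.single_le_sum (fun i _ => hnn i) (Finset.mem_univ j)]

variable {Ω : Type u} [MeasurableSpace Ω]

theorem integrable_abs_rpow (r : Exponent) {μ : FinMeas Ω} (φ : Lp ℝ r.inv μ.1) :
    Integrable (fun x => |φ x| ^ (1 / (r : ℝ))) μ.1 := by
  have := (Lp.memLp φ).integrable_norm_rpow r.inv_ne_zero r.inv_ne_top
  rwa [r.toReal_inv] at this

theorem integral_abs_rpow (r : Exponent) {μ : FinMeas Ω} (φ : Lp ℝ r.inv μ.1) :
    ∫ x, |φ x| ^ (1 / (r : ℝ)) ∂μ.1 = ‖φ‖ ^ (1 / (r : ℝ)) := by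
  have hr := r.2.1
  have h0 : 0 ≤ ∫ x, |φ x| ^ (1 / (r : ℝ)) ∂μ.1 :=
    integral_nonneg fun x => Real.rpow_nonneg (abs_nonneg _) _
  rw [Lp.norm_def, (Lp.memLp φ).eLpNorm_eq_integral_rpow_norm r.inv_ne_zero r.inv_ne_top,
    r.toReal_inv, ENNReal.toReal_ofReal (by positivity)]
  simp only [Real.norm_eq_abs]
  rw [← Real.rpow_mul h0, inv_mul_cancel₀ (by positivity), Real.rpow_one]

variable {ι : Type*} [Fintype ι]

theorem integrable_prod_Lp (r : Exponent) (hι : (Fintype.card ι : ℝ) ≤ 1 / (r : ℝ))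
    {μ : FinMeas Ω} (φ : ι → Lp ℝ r.inv μ.1) : Integrable (fun x => ∏ i, φ i x) μ.1 := by
  refine Integrable.mono' ((integrable_const (1 : ℝ)).add
    (integrable_finsetSum Finset.univ fun i _ => integrable_abs_rpow r (φ i)))
    (Finset.measurable_prod _ fun i _ =>
      (Lp.stronglyMeasurable (φ i)).measurable).aestronglyMeasurable (ae_of_all _ fun x => ?_)
  rw [Real.norm_eq_abs, Finset.abs_prod]
  exact prod_abs_le_one_add_sum hι fun i => φ i x

theorem prod_update_coeFn [DecidableEq ι] {r : Exponent} {μ : FinMeas Ω}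
    (φ : ι → Lp ℝ r.inv μ.1) (i : ι) (a : Lp ℝ r.inv μ.1) (x : Ω) :
    ∏ k, Function.update φ i a k x = a x * ∏ k ∈ Finset.univ.erase i, φ k x := by
  rw [← Finset.mul_prod_erase Finset.univ _ (Finset.mem_univ i), Function.update_self]
  congr 1
  refine Finset.prod_congr rfl fun k hk => ?_
  rw [Function.update_of_ne (Finset.ne_of_mem_erase hk)]

/-- The form `(φ_i) ↦ ∫ ∏ φ_i dμ` on `L^{1/r}(μ)`. -/
def prodIntegral (r : Exponent) (hι : (Fintype.card ι : ℝ) ≤ 1 / (r : ℝ)) (μ : FinMeas Ω) :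
    MultilinearMap ℝ (fun _ : ι => Lp ℝ r.inv μ.1) ℝ where
  toFun φ := ∫ x, ∏ i, φ i x ∂μ.1
  map_update_add' φ i a b := by
    rw [← integral_add (integrable_prod_Lp r hι _) (integrable_prod_Lp r hι _)]
    refine integral_congr_ae ?_
    filter_upwards [Lp.coeFn_add a b] with x hx
    rw [prod_update_coeFn, prod_update_coeFn, prod_update_coeFn, hx, Pi.add_apply, add_mul]
  map_update_smul' φ i c a := by
    rw [smul_eq_mul, ← integral_const_mul]
    refine integral_congr_ae ?_
    filter_upwards [Lp.coeFn_smul c a] with x hx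
    rw [prod_update_coeFn, prod_update_coeFn, hx, Pi.smul_apply, smul_eq_mul, mul_assoc]

/-- By homogeneity the arguments may be normalised to norm at most one, and then the pointwise bound
integrates to a constant. -/
theorem continuous_prodIntegral (r : Exponent) (hι : (Fintype.card ι : ℝ) ≤ 1 / (r : ℝ))
    (μ : FinMeas Ω) : Continuous (prodIntegral r hι μ) := by
  have hr := r.2.1
  refine MultilinearMap.continuous_of_bound _ (μ.1.real univ + Fintype.card ι) fun φ => ?_
  have h1 : φ = fun i => ‖φ i‖ • (‖φ i‖⁻¹ • φ i) := funext fun i => by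
    by_cases h : φ i = 0
    · simp [h]
    · rw [smul_smul, mul_inv_cancel₀ (norm_ne_zero_iff.2 h), one_smul]
  have h2 : ∀ i, ‖‖φ i‖⁻¹ • φ i‖ ≤ 1 := fun i => by
    rw [norm_smul, norm_inv, norm_norm]
    exact inv_mul_le_one
  conv_lhs => rw [h1]
  rw [MultilinearMap.map_smul_univ, norm_smul, norm_prod, mul_comm]
  simp only [norm_norm]
  refine mul_le_mul_of_nonneg_right ?_ (Finset.prod_nonneg fun i _ => norm_nonneg _)
  generalize hψ : (fun i => ‖φ i‖⁻¹ • φ i) = ψ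
  replace h2 : ∀ i, ‖ψ i‖ ≤ 1 := fun i => by rw [← hψ]; exact h2 i
  calc ‖∫ x, ∏ i, ψ i x ∂μ.1‖
      ≤ ∫ x, (1 + ∑ i, |ψ i x| ^ (1 / (r : ℝ))) ∂μ.1 := by
        refine norm_integral_le_of_norm_le ((integrable_const (1 : ℝ)).add
          (integrable_finsetSum Finset.univ fun i _ => integrable_abs_rpow r (ψ i)))
          (ae_of_all _ fun x => ?_)
        rw [Real.norm_eq_abs, Finset.abs_prod]
        exact prod_abs_le_one_add_sum hι fun i => ψ i x
    _ = μ.1.real univ + ∑ i, ‖ψ i‖ ^ (1 / (r : ℝ)) := by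
        rw [integral_add (integrable_const _)
          (integrable_finsetSum Finset.univ fun i _ => integrable_abs_rpow r (ψ i)),
          integral_finsetSum _ fun i _ => integrable_abs_rpow r (ψ i)]
        simp only [integral_abs_rpow]
        simp
    _ ≤ μ.1.real univ + Fintype.card ι := by
        gcongr
        refine (Finset.sum_le_card_nsmul _ _ 1 fun i _ =>
          Real.rpow_le_one (norm_nonneg _) (h2 i) (by positivity)).trans ?_
        simp

theorem tendsto_integral_prod {r : Exponent} {μ : FinMeas Ω} {n : ℕ} {B : Finset (Fin n)}
    (hB : (B.card : ℝ) ≤ 1 / (r : ℝ)) {κ : Type*} {l : Filter κ}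
    {χ : κ → Fin n → Lp ℝ r.inv μ.1} {φ : Fin n → Lp ℝ r.inv μ.1}
    (h : ∀ i, Filter.Tendsto (fun k => χ k i) l (𝓝 (φ i))) :
    Filter.Tendsto (fun k => ∫ x, ∏ i ∈ B, χ k i x ∂μ.1) l (𝓝 (∫ x, ∏ i ∈ B, φ i x ∂μ.1)) := by
  have hB' : (Fintype.card B : ℝ) ≤ 1 / (r : ℝ) := by rwa [Fintype.card_coe]
  have h1 := ((continuous_prodIntegral r hB' μ).tendsto (fun i => φ i)).comp
    (tendsto_pi_nhds.2 fun i : B => h i)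
  have h2 : ∀ φ : Fin n → Lp ℝ r.inv μ.1,
      prodIntegral r hB' μ (fun i => φ i) = ∫ x, ∏ i ∈ B, φ i x ∂μ.1 := fun φ => by
    simp only [← Finset.prod_coe_sort B]
    rfl
  rw [← h2]
  exact h1.congr fun k => h2 (χ k)

end Products

/-! ### Vector fields with simple values off a point -/

section Fields

variable {Ω : Type u} [MeasurableSpace Ω] {s : Setting} {r : Exponent}

/-- The masses `ν(A)` are recovered from `ν^r`; this is `tendsto_measure_real` for a constant net.
-/
theorem rootPow_injective : Function.Injective fun ν : Point s Ω => rootPow r ν.base := by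
  intro ν ν' h
  have h1 : ∀ A, MeasurableSet A → ν.base.1 A = ν'.base.1 A := fun A hA => by
    have h2 := tendsto_measure_real r (l := 𝓝 ()) (ν := fun _ : Unit => ν.base) (ν₀ := ν'.base)
      (by rw [show rootPow r ν.base = rootPow r ν'.base from h]; exact tendsto_const_nhds) hA
    exact (ENNReal.toReal_eq_toReal_iff' (measure_ne_top _ _) (measure_ne_top _ _)).1
      (tendsto_nhds_unique tendsto_const_nhds h2)
  obtain ⟨⟨ν, _⟩, _⟩ := ν
  obtain ⟨⟨ν', _⟩, _⟩ := ν'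
  have : ν = ν' := Measure.ext h1
  subst this
  rfl

theorem abs_integral_le_norm (r : Exponent) {μ : FinMeas Ω} (hμ : μ.1 univ = 1)
    (φ : Lp ℝ r.inv μ.1) : |∫ x, φ x ∂μ.1| ≤ ‖φ‖ := by
  have : IsProbabilityMeasure μ.1 := ⟨hμ⟩
  calc |∫ x, φ x ∂μ.1| ≤ ∫ x, ‖φ x‖ ∂μ.1 := by
        rw [← Real.norm_eq_abs]
        exact norm_integral_le_integral_norm _
    _ = (eLpNorm φ 1 μ.1).toReal := by
      rw [eLpNorm_one_eq_lintegral_enorm, integral_norm_eq_lintegral_enorm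
        (Lp.aestronglyMeasurable φ)]
    _ ≤ (eLpNorm φ r.inv μ.1).toReal := ENNReal.toReal_mono (Lp.eLpNorm_ne_top φ)
      (eLpNorm_le_eLpNorm_of_exponent_le r.one_le_inv (Lp.aestronglyMeasurable φ))
    _ = ‖φ‖ := (Lp.norm_def φ).symm

theorem continuous_tangentForm (μ : Point s Ω) : Continuous (tangentForm s r μ.base) := by
  cases s with
  | measures => exact continuous_const
  | probabilities =>
    exact AddMonoidHomClass.continuous_of_bound (tangentForm .probabilities r μ.base) 1
      fun φ => by
        rw [one_mul]
        exact abs_integral_le_norm r μ.admits φ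

theorem continuous_tangentProj (μ : Point s Ω) : Continuous (tangentProj s r μ) :=
  Continuous.subtype_mk
    (continuous_id.sub ((continuous_tangentForm μ).smul continuous_const)) _

theorem denseRange_simpleLp (r : Exponent) (μ : FinMeas Ω) : DenseRange (simpleLp r μ) := by
  intro φ
  refine Metric.mem_closure_range_iff.2 fun ε hε => ?_
  obtain ⟨g, hg, -⟩ := (Lp.memLp φ).exists_simpleFunc_eLpNorm_sub_lt r.inv_ne_top
    (ENNReal.ofReal_pos.2 hε).ne'
  refine ⟨g, ?_⟩
  rw [dist_eq_norm, Lp.norm_def]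
  have h1 : eLpNorm (φ - simpleLp r μ g : Lp ℝ r.inv μ.1) r.inv μ.1
      = eLpNorm ((φ : Ω → ℝ) - ⇑g) r.inv μ.1 := by
    refine eLpNorm_congr_ae ((Lp.coeFn_sub _ _).trans ?_)
    exact Filter.EventuallyEq.rfl.sub (coeFn_simpleLp r μ g)
  rw [h1]
  exact (ENNReal.lt_ofReal_iff_toReal_lt hg.ne_top).1 hg

theorem mem_closure_range_tangentProj (μ : Point s Ω) (φ : tangent s r μ.base) :
    φ ∈ closure (Set.range fun f : SimpleFunc Ω ℝ => tangentProj s r μ (simpleLp r μ.base f)) := by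
  have h1 := map_mem_closure (continuous_tangentProj μ) (denseRange_simpleLp r μ.base φ)
    (t := Set.range fun f : SimpleFunc Ω ℝ => tangentProj s r μ (simpleLp r μ.base f)) (by
      rintro _ ⟨f, rfl⟩
      exact ⟨f, rfl⟩)
  rwa [tangentProj_of_mem] at h1

theorem continuous_rootPow_base :
    Continuous[powTopology s r Ω, inferInstance] fun μ : Point s Ω => rootPow r μ.base :=
  continuous_induced_dom

/-- A vector field with a prescribed value at `μ`, whose values at the other points are linear
combinations of values of the fields `Y k`, which sum up to the prescribed value at `μ`. -/
theorem exists_field_of_series (μ : Point s Ω) (φ : tangent s r μ.base)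
    (Y : ℕ → VectorField s r Ω) {D : ℝ} (hD : ∀ k, ‖(Y k).val μ‖ ≤ D * (1 / 2) ^ k)
    (hφ : Filter.Tendsto (fun N => ∑ k ∈ Finset.range N, (Y k).val μ) Filter.atTop (𝓝 φ)) :
    ∃ X : VectorField s r Ω, X.val μ = φ ∧ ∀ ν, ν ≠ μ → ∃ (N : ℕ) (ρ : ℕ → ℝ),
      X.val ν = ∑ k ∈ Finset.range N, ρ k • (Y k).val ν := by
  let t : Point s Ω → ℝ := fun ν => ‖rootPow r ν.base - rootPow r μ.base‖
  have ht : Continuous[powTopology s r Ω, inferInstance] t := by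
    let := powTopology s r Ω
    exact (continuous_rootPow_base.sub continuous_const).norm
  have htμ : t μ = 0 := by simp [t]
  have htpos : ∀ ν, ν ≠ μ → 0 < t ν := fun ν hν =>
    norm_pos_iff.2 (sub_ne_zero.2 fun h => hν (rootPow_injective h))
  -- Continuity of `‖Y k‖` spreads the geometric bound at `μ` to a ball of radius `δ k`. The radii
  -- shrink to zero, so each other point lies in only finitely many of the balls.
  have hδ : ∀ k, ∃ δ : ℝ, 0 < δ ∧ δ ≤ (1 / 2) ^ k ∧
      ∀ ν, t ν < δ → ‖(Y k).val ν‖ ≤ (D + 1) * (1 / 2) ^ k := by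
    intro k
    have h1 := (continuous_powTopology_iff.1 (Y k).continuous_val μ).norm
    have h2 : ‖densityPow r μ.base ((Y k).val μ : Lp ℝ r.inv μ.base.1)‖ < (D + 1) * (1 / 2) ^ k := by
      rw [norm_densityPow]
      refine (hD k).trans_lt ?_
      have : (0 : ℝ) < (1 / 2) ^ k := by positivity
      linarith
    have h3 := h1.eventually (gt_mem_nhds h2)
    rw [Filter.eventually_comap] at h3
    obtain ⟨δ, hδ, h4⟩ := Metric.eventually_nhds_iff.1 h3
    refine ⟨min δ ((1 / 2) ^ k), lt_min hδ (by positivity), min_le_right _ _, fun ν hν => ?_⟩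
    have h5 := h4 (y := rootPow r ν.base)
      (by rw [dist_eq_norm]; exact hν.trans_le (min_le_left _ _)) ν rfl
    rw [norm_densityPow] at h5
    exact h5.le
  choose δ hδ0 hδk hδ using hδ
  -- Continuous cut-offs equal to one at `μ` and zero outside the ball of radius `δ k`. The field is
  -- `∑ ρ_k Y_k`, a finite sum away from `μ`.
  let ρ : ℕ → Point s Ω → ℝ := fun k ν => max 0 (1 - t ν / δ k)
  have hρ0 : ∀ k ν, 0 ≤ ρ k ν := fun k ν => le_max_left _ _
  have hρ1 : ∀ k ν, ρ k ν ≤ 1 := fun k ν =>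
    max_le zero_le_one (sub_le_self _ (div_nonneg (norm_nonneg _) (hδ0 k).le))
  have hρμ : ∀ k, ρ k μ = 1 := fun k => by simp [ρ, htμ]
  have hρz : ∀ k ν, δ k ≤ t ν → ρ k ν = 0 := fun k ν h =>
    max_eq_left (sub_nonpos.2 ((one_le_div (hδ0 k)).2 h))
  have hρc : ∀ k, Continuous[powTopology s r Ω, inferInstance] (ρ k) := fun k => by
    let := powTopology s r Ω
    exact continuous_const.max (continuous_const.sub (ht.div_const _))
  have hDnn : 0 ≤ D := by simpa using (norm_nonneg _).trans (hD 0)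
  have hbound : ∀ k ν, ‖ρ k ν • (Y k).val ν‖ ≤ (D + 1) * (1 / 2) ^ k := by
    intro k ν
    by_cases h : t ν < δ k
    · rw [norm_smul, Real.norm_of_nonneg (hρ0 k ν)]
      exact (mul_le_of_le_one_left (norm_nonneg _) (hρ1 k ν)).trans (hδ k ν h)
    · rw [hρz k ν (not_lt.1 h), zero_smul, norm_zero]
      positivity
  have hfin : ∀ ν, ν ≠ μ → ∃ N, ∀ k, N ≤ k → ρ k ν = 0 := by
    intro ν hν
    obtain ⟨N, hN⟩ := exists_pow_lt_of_lt_one (htpos ν hν) (by norm_num : (1 / 2 : ℝ) < 1)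
    exact ⟨N, fun k hk => hρz k ν ((hδk k).trans
      ((pow_le_pow_of_le_one (by norm_num) (by norm_num) hk).trans hN.le))⟩
  have hval : ∀ ν, ∃ x : tangent s r ν.base,
      Filter.Tendsto (fun N => ∑ k ∈ Finset.range N, ρ k ν • (Y k).val ν) Filter.atTop (𝓝 x) ∧
      (ν ≠ μ → ∃ (N : ℕ) (ρ : ℕ → ℝ), x = ∑ k ∈ Finset.range N, ρ k • (Y k).val ν) := by
    intro ν
    by_cases hν : ν = μ
    · subst hν
      exact ⟨φ, by simpa only [hρμ, one_smul] using hφ, fun h => absurd rfl h⟩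
    · obtain ⟨N, hN⟩ := hfin ν hν
      refine ⟨∑ k ∈ Finset.range N, ρ k ν • (Y k).val ν, tendsto_const_nhds.congr' ?_,
        fun _ => ⟨N, fun k => ρ k ν, rfl⟩⟩
      filter_upwards [Filter.eventually_ge_atTop N] with M hM
      refine Finset.sum_subset (Finset.range_subset_range.2 hM) fun k _ hk => ?_
      rw [hN k (by simpa using hk), zero_smul]
  choose val hval1 hval2 using hval
  have hcont : Continuous[powTopology s r Ω, inferInstance]
      fun μ => densityPow r μ.base (val μ : Lp ℝ r.inv μ.base.1) := by
    let := powTopology s r Ω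
    -- The terms are bounded by a geometric series uniformly in `ν`, so the sum of the continuous
    -- fields is continuous.
    have hu : TendstoUniformly (fun N (ν : Point s Ω) => densityPow r ν.base
        ((∑ k ∈ Finset.range N, ρ k ν • (Y k).val ν : tangent s r ν.base) :
          Lp ℝ r.inv ν.base.1))
        (fun ν => densityPow r ν.base (val ν : Lp ℝ r.inv ν.base.1)) Filter.atTop := by
      have h0 : Filter.Tendsto (fun N : ℕ => (D + 1) * (1 / 2 : ℝ) ^ N / (1 - 1 / 2))
          Filter.atTop (𝓝 0) := by
        have := ((tendsto_pow_atTop_nhds_zero_of_lt_one (r := (1 / 2 : ℝ)) (by norm_num)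
          (by norm_num)).const_mul (D + 1)).div_const (1 - 1 / 2)
        simpa using this
      refine Metric.tendstoUniformly_iff.2 fun ε hε => ?_
      filter_upwards [h0.eventually (gt_mem_nhds hε)] with N hN ν
      refine lt_of_le_of_lt ?_ hN
      rw [dist_comm, dist_eq_norm, ← map_sub, norm_densityPow, ← Submodule.coe_sub,
        Submodule.norm_coe, ← dist_eq_norm]
      refine dist_le_of_le_geometric_of_tendsto (1 / 2) (D + 1) (by norm_num) (fun M => ?_)
        (hval1 ν) N
      rw [Finset.sum_range_succ, dist_self_add_right]
      exact hbound M ν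
    refine hu.continuous (Filter.Frequently.of_forall fun N => ?_)
    simp only [Submodule.coe_sum, Submodule.coe_smul, map_sum, map_smul]
    exact continuous_finsetSum _ fun k _ => (hρc k).smul (Y k).continuous_val
  refine ⟨⟨val, hcont⟩, ?_, fun ν hν => hval2 ν hν⟩
  have h1 := hval1 μ
  simp only [hρμ, one_smul] at h1
  exact tendsto_nhds_unique h1 hφ

theorem simpleLp_sub_tangentForm (ν : Point s Ω) (f : SimpleFunc Ω ℝ) :
    (tangentProj s r ν (simpleLp r ν.base f) : Lp ℝ r.inv ν.base.1) =
      simpleLp r ν.base (f - tangentForm s r ν.base (simpleLp r ν.base f) • 1) := by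
  rw [tangentProj_coe, map_sub, map_smul, simpleLp_one]

/-- A tangent vector is the sum of a rapidly converging series of projected simple functions, each
of which extends to a continuous field. Cutting these off ever closer to `μ` leaves a simple
function at every other point. -/
theorem exists_field (μ : Point s Ω) (φ : tangent s r μ.base) :
    ∃ X : VectorField s r Ω, X.val μ = φ ∧ ∀ ν, ν ≠ μ → ∃ f : SimpleFunc Ω ℝ,
      (X.val ν : Lp ℝ r.inv ν.base.1) = simpleLp r ν.base f := by
  let S : AddSubgroup (tangent s r μ.base) :=
    (tangentProj s r μ ∘ₗ simpleLp r μ.base).range.toAddSubgroup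
  have hS : φ ∈ closure (S : Set (tangent s r μ.base)) := by
    refine closure_mono ?_ (mem_closure_range_tangentProj μ φ)
    rintro _ ⟨f, rfl⟩
    exact ⟨f, rfl⟩
  obtain ⟨v, hv, hvS, -, hvb⟩ := controlled_sum_of_mem_closure hS
    (b := fun n => (1 / 2 : ℝ) ^ n) fun n => by positivity
  choose f hf using hvS
  have hf' : ∀ k, (simpleField s r (f k)).val μ = v k := hf
  -- The controlled series bounds the norms only from the second term on; the constant `‖v 0‖ + 1`
  -- absorbs the first.
  obtain ⟨X, hX, hX'⟩ := exists_field_of_series μ φ (fun k => simpleField s r (f k))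
    (D := ‖v 0‖ + 1) (fun k => by
      rw [hf']
      rcases Nat.eq_zero_or_pos k with rfl | hk
      · simp
      · refine (hvb k hk).le.trans (le_mul_of_one_le_left (by positivity) ?_)
        linarith [norm_nonneg (v 0)]) (by
      simp only [hf']
      exact (Filter.tendsto_add_atTop_iff_nat 1).1 hv)
  refine ⟨X, hX, fun ν hν => ?_⟩
  obtain ⟨N, ρ, h⟩ := hX' ν hν
  have h1 : X.val ν = tangentProj s r ν
      (simpleLp r ν.base (∑ k ∈ Finset.range N, ρ k • f k)) := by
    rw [h, map_sum, map_sum]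
    refine Finset.sum_congr rfl fun k _ => ?_
    rw [map_smul, map_smul]
    rfl
  rw [h1]
  exact ⟨_, simpleLp_sub_tangentForm ν _⟩

end Fields

/-! ### Perturbation of a measure by a simple density -/

section Perturbation

variable {Ω : Type u} [MeasurableSpace Ω] {s : Setting} {r : Exponent}

theorem simpleAct_add (r : Exponent) (f g : SimpleFunc Ω ℝ) (x : RootMeas r Ω) :
    simpleAct r (f + g) x = simpleAct r f x + simpleAct r g x := by
  obtain ⟨μ, φ, rfl⟩ := exists_densityPow r x
  simp only [simpleAct_densityPow]
  rw [← map_add]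
  congr 1
  refine Lp.ext ((coeFn_simpleMul r _ μ φ).trans ?_)
  filter_upwards [Lp.coeFn_add (simpleMul r f μ φ) (simpleMul r g μ φ), coeFn_simpleMul r f μ φ,
    coeFn_simpleMul r g μ φ] with x h1 h2 h3
  rw [h1, Pi.add_apply, h2, h3, SimpleFunc.coe_add, Pi.add_apply, add_mul]

theorem simpleAct_smul (r : Exponent) (c : ℝ) (f : SimpleFunc Ω ℝ) (x : RootMeas r Ω) :
    simpleAct r (c • f) x = c • simpleAct r f x := by
  obtain ⟨μ, φ, rfl⟩ := exists_densityPow r x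
  simp only [simpleAct_densityPow]
  rw [← map_smul]
  congr 1
  refine Lp.ext ((coeFn_simpleMul r _ μ φ).trans ?_)
  filter_upwards [Lp.coeFn_smul c (simpleMul r f μ φ), coeFn_simpleMul r f μ φ] with x h1 h2
  rw [h1, Pi.smul_apply, h2, SimpleFunc.coe_smul, Pi.smul_apply, smul_eq_mul, smul_eq_mul,
    mul_assoc]

theorem simpleAct_one (r : Exponent) (x : RootMeas r Ω) : simpleAct r 1 x = x := by
  obtain ⟨μ, φ, rfl⟩ := exists_densityPow r x
  rw [simpleAct_densityPow]
  congr 1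
  refine Lp.ext ((coeFn_simpleMul r _ μ φ).trans (ae_of_all _ fun x => ?_))
  simp

theorem simpleAct_map (r : Exponent) (h : SimpleFunc Ω ℝ) (q : ℝ → ℝ) (x : RootMeas r Ω) :
    simpleAct r (h.map q) x =
      ∑ y ∈ h.range, q y • simpleAct r (indicatorSimple _ (h.measurableSet_fiber y)) x := by
  let L : SimpleFunc Ω ℝ →ₗ[ℝ] RootMeas r Ω :=
    { toFun := fun f => simpleAct r f x
      map_add' := fun f g => simpleAct_add r f g x
      map_smul' := fun c f => simpleAct_smul r c f x }
  have h1 : h.map q = ∑ y ∈ h.range, q y • indicatorSimple _ (h.measurableSet_fiber y) := by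
    ext z
    have hsum : ∀ (S : Finset ℝ) (g : ℝ → SimpleFunc Ω ℝ), (∑ y ∈ S, g y) z = ∑ y ∈ S, g y z :=
      fun S g => map_sum (⟨⟨fun f : SimpleFunc Ω ℝ => f z, rfl⟩, fun _ _ => rfl⟩ :
        SimpleFunc Ω ℝ →+ ℝ) g S
    rw [hsum, Finset.sum_eq_single (h z)]
    · rw [SimpleFunc.coe_smul, Pi.smul_apply, coe_indicatorSimple]
      simp
    · intro y _ hy
      rw [SimpleFunc.coe_smul, Pi.smul_apply, coe_indicatorSimple, Set.indicator_of_notMem,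
        smul_zero]
      exact fun hz => hy hz.symm
    · exact fun hz => absurd (h.mem_range_self z) hz
  change L (h.map q) = _
  rw [h1, map_sum]
  refine Finset.sum_congr rfl fun y _ => ?_
  rw [map_smul]
  rfl

/-- As `h` has finitely many values, pointwise convergence of `q` suffices: the action is a finite
sum over level sets. -/
theorem tendsto_simpleAct_map (h : SimpleFunc Ω ℝ) {ι : Type*} {l : Filter ι} {q : ι → ℝ → ℝ}
    (hq : ∀ y, Filter.Tendsto (fun k => q k y) l (𝓝 1)) {x : ι → RootMeas r Ω} {x₀ : RootMeas r Ω}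
    (hx : Filter.Tendsto x l (𝓝 x₀)) :
    Filter.Tendsto (fun k => simpleAct r (h.map (q k)) (x k)) l (𝓝 x₀) := by
  have h1 : x₀ = simpleAct r (h.map fun _ => 1) x₀ := by
    rw [show h.map (fun _ => (1 : ℝ)) = 1 by ext; rfl, simpleAct_one]
  rw [h1]
  simp only [simpleAct_map]
  exact tendsto_finsetSum _ fun y _ =>
    (hq y).smul (((simpleAct r _).continuous.tendsto x₀).comp hx)

variable {μ ν : FinMeas Ω} {h : SimpleFunc Ω ℝ} {δ : ℝ}

theorem rnDeriv_perturb
    (hν : ν.1 = μ.1.withDensity fun x => ENNReal.ofReal (1 + δ * h x))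
    (hpos : ∀ x, 0 < 1 + δ * h x) :
    (fun x => (ν.1.rnDeriv μ.1 x).toReal) =ᵐ[μ.1] fun x => 1 + δ * h x := by
  have h1 := Measure.rnDeriv_withDensity μ.1
    (f := fun x => ENNReal.ofReal (1 + δ * h x))
    (measurable_const.add (h.measurable.const_mul δ)).ennreal_ofReal
  rw [← hν] at h1
  filter_upwards [h1] with x hx
  rw [hx, ENNReal.toReal_ofReal (hpos x).le]

theorem le_of_perturb (hν : ν.1 = μ.1.withDensity fun x => ENNReal.ofReal (1 + δ * h x)) :
    ν ≤ μ := by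
  rw [FinMeas.le_def, hν]
  exact withDensity_absolutelyContinuous _ _

theorem rootPow_perturb (r : Exponent)
    (hν : ν.1 = μ.1.withDensity fun x => ENNReal.ofReal (1 + δ * h x))
    (hpos : ∀ x, 0 < 1 + δ * h x) :
    rootPow r ν = simpleAct r (h.map fun y => (1 + δ * y) ^ (r : ℝ)) (rootPow r μ) := by
  rw [simpleAct_rootPow]
  refine rootPow_eq r (le_of_perturb hν) ((coeFn_simpleLp r μ _).trans ?_)
  filter_upwards [rnDeriv_perturb hν hpos] with x hx
  rw [hx]
  rfl

/-- With `b = 1/|B|`, multiplying the `χ` over a block `B` produces the density `1 + δh` exactly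
once, so a moment for `ν` becomes a moment for the fixed measure `μ`. The exponent `b - r` corrects
the power `r` that comes from rescaling, and its factor tends to one with `δ → 0`. -/
theorem exists_densityPow_perturb
    (hν : ν.1 = μ.1.withDensity fun x => ENNReal.ofReal (1 + δ * h x))
    (hpos : ∀ x, 0 < 1 + δ * h x) (b : ℝ) (ψ : Lp ℝ r.inv ν.1) :
    ∃ χ : Lp ℝ r.inv μ.1, densityPow r μ χ =
        simpleAct r (h.map fun y => (1 + δ * y) ^ (b - r)) (densityPow r ν ψ) ∧
      χ =ᵐ[μ.1] fun x => ψ x * (1 + δ * h x) ^ b := by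
  refine ⟨simpleMul r (h.map fun y => (1 + δ * y) ^ (b - r)) μ (rescale r (le_of_perturb hν) ψ),
    ?_, ?_⟩
  · rw [← simpleAct_densityPow, densityPow_rescale]
  · refine (coeFn_simpleMul r _ μ _).trans ?_
    filter_upwards [coeFn_rescale r (le_of_perturb hν) ψ, rnDeriv_perturb hν hpos] with x h1 h2
    rw [h1, h2, SimpleFunc.map_apply, mul_left_comm, ← Real.rpow_add (hpos x), sub_add_cancel]

theorem integral_perturb
    (hν : ν.1 = μ.1.withDensity fun x => ENNReal.ofReal (1 + δ * h x))
    (hpos : ∀ x, 0 < 1 + δ * h x) (f : Ω → ℝ) :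
    ∫ x, f x ∂ν.1 = ∫ x, f x * (1 + δ * h x) ∂μ.1 := by
  rw [hν, integral_withDensity_eq_integral_toReal_smul
    (f := fun x => ENNReal.ofReal (1 + δ * h x))
    (measurable_const.add (h.measurable.const_mul δ)).ennreal_ofReal
    (ae_of_all _ fun x => ENNReal.ofReal_lt_top)]
  refine integral_congr_ae (ae_of_all _ fun x => ?_)
  simp only
  rw [ENNReal.toReal_ofReal (hpos x).le, smul_eq_mul, mul_comm]

/-- For probability measures, tangency of `h` means `∫ h dμ = 0`, which keeps the total mass equal
to one. -/
theorem exists_perturb (μ : Point s Ω) {h : SimpleFunc Ω ℝ}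
    (hh : simpleLp r μ.base h ∈ tangent s r μ.base) {δ : ℝ} (hpos : ∀ x, 0 < 1 + δ * h x) :
    ∃ ν : Point s Ω,
      ν.base.1 = μ.base.1.withDensity fun x => ENNReal.ofReal (1 + δ * h x) := by
  have hi : Integrable h μ.base.1 := h.integrable_of_isFiniteMeasure
  have hi' : Integrable (fun x => 1 + δ * h x) μ.base.1 :=
    (integrable_const 1).add (hi.const_mul δ)
  refine ⟨⟨⟨_, isFiniteMeasure_withDensity_ofReal hi'.hasFiniteIntegral⟩, ?_⟩, rfl⟩
  cases s with
  | measures => trivial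
  | probabilities =>
    have h1 : ∫ x, h x ∂μ.base.1 = 0 := by
      rw [← integral_congr_ae (coeFn_simpleLp r μ.base h)]
      exact hh
    have h2 : μ.base.1 univ = 1 := μ.admits
    change (μ.base.1.withDensity _) univ = 1
    rw [withDensity_apply _ MeasurableSet.univ, Measure.restrict_univ,
      ← ofReal_integral_eq_lintegral_ofReal hi' (ae_of_all _ fun x => (hpos x).le),
      integral_add (integrable_const 1) (hi.const_mul δ), integral_const_mul, h1]
    simp [Measure.real, h2]

theorem perturb_ne (μ ν : Point s Ω) {h : SimpleFunc Ω ℝ} (hh : simpleLp r μ.base h ≠ 0) {δ : ℝ}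
    (hδ : δ ≠ 0) (hpos : ∀ x, 0 < 1 + δ * h x)
    (hν : ν.base.1 = μ.base.1.withDensity fun x => ENNReal.ofReal (1 + δ * h x)) : ν ≠ μ := by
  rintro rfl
  refine hh (Lp.ext ((coeFn_simpleLp r _ h).trans ?_))
  filter_upwards [rnDeriv_perturb hν hpos, Measure.rnDeriv_self ν.base.1,
    Lp.coeFn_zero ℝ r.inv ν.base.1] with x h1 h2 h3
  rw [h2, ENNReal.toReal_one] at h1
  rw [h3]
  have h4 : δ * h x = 0 := by linarith
  exact (mul_eq_zero.1 h4).resolve_left hδ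

end Perturbation

/-! ### The form of a congruent family -/

section Extension

variable {s : Setting} {r : Exponent} {n : ℕ} {Θ : TensorFamily.{u} s r n}

theorem HasCoeff.form_eq_of_simple {Ω : Type u} [MeasurableSpace Ω] {ν : Point s Ω}
    {c : ArgPartition n → ℝ} (hc : HasCoeff Θ ν.base.mass c) {φ : Fin n → tangent s r ν.base}
    (hφ : ∀ i, ∃ f : SimpleFunc Ω ℝ, (φ i : Lp ℝ r.inv ν.base.1) = simpleLp r ν.base f) :
    (Θ Ω).form ν φ = ∑ R, c R * momentProd ν.base R fun i => (φ i : Lp ℝ r.inv ν.base.1) := by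
  choose f hf using hφ
  have h1 := hc Ω ν rfl f
  rw [evalSimple_apply] at h1
  simp only [← hf, tangentProj_of_mem] at h1
  rw [h1]
  refine Finset.sum_congr rfl fun R _ => ?_
  congr 1
  refine Finset.prod_congr rfl fun B _ => integral_congr_ae ?_
  filter_upwards [ae_all_iff.2 fun i => coeFn_simpleLp r ν.base (f i)] with x hx
  simp only [hf, hx]

theorem momentProd_zero (hn : 1 ≤ n) {Ω : Type u} [MeasurableSpace Ω] (μ : FinMeas Ω)
    (R : ArgPartition n) : momentProd μ R (fun _ => ((0 : Lp ℝ r.inv μ.1) : Ω → ℝ)) = 0 := by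
  refine Finset.prod_eq_zero (R.part_mem.2 (Finset.mem_univ (⟨0, hn⟩ : Fin n))) ?_
  rw [← integral_zero Ω ℝ (μ := μ.1)]
  refine integral_congr_ae ?_
  filter_upwards [Lp.coeFn_zero ℝ r.inv μ.1] with x hx
  rw [hx]
  exact Finset.prod_eq_zero (R.mem_part_self.2 (Finset.mem_univ _)) rfl

/-- Each `φ_i` is extended to a field with simple values off `μ`, and `μ` is approached along `(1 +
δ_k h) μ ≠ μ`. The left side converges by continuity on vector fields. On the right, the moments are
transported to the fixed space `L^{1/r}(μ)`, where they converge for blocks of size at most `1/r`;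
the remaining coefficients are zero. -/
theorem form_eq_of_hasCoeff (hn : 1 ≤ n) {c : ℝ → ArgPartition n → ℝ}
    (hc : ∀ m ∈ s.masses, HasCoeff Θ m (c m)) {Ω : Type u} [MeasurableSpace Ω] (μ : Point s Ω)
    (hμ : 0 < μ.base.mass) (φ : Fin n → tangent s r μ.base) :
    (Θ Ω).form μ φ =
      ∑ R, c μ.base.mass R * momentProd μ.base R fun i => (φ i : Lp ℝ r.inv μ.base.1) := by
  by_cases hex : ∃ h : SimpleFunc Ω ℝ, simpleLp r μ.base h ∈ tangent s r μ.base ∧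
      simpleLp r μ.base h ≠ 0
  swap
  -- Without a nonzero simple tangent vector, density makes the tangent space trivial, as for a
  -- point mass among probability measures. Both sides then vanish because there is at least one
  -- argument.
  · have h0 : ∀ x : tangent s r μ.base, x = 0 := fun x => by
      have h1 : (Set.range fun f : SimpleFunc Ω ℝ => tangentProj s r μ (simpleLp r μ.base f))
          ⊆ {0} := by
        rintro _ ⟨f, rfl⟩
        by_contra hf
        refine hex ⟨f - tangentForm s r μ.base (simpleLp r μ.base f) • 1, ?_, ?_⟩
        · rw [← simpleLp_sub_tangentForm]
          exact Subtype.property _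
        · rw [← simpleLp_sub_tangentForm]
          exact fun h => hf (Subtype.ext h)
      have h2 := closure_mono h1 (mem_closure_range_tangentProj μ x)
      rwa [closure_singleton] at h2
    have h1 : φ = fun _ => 0 := funext fun i => h0 (φ i)
    subst h1
    rw [(Θ Ω).form μ |>.map_coord_zero ⟨0, hn⟩ rfl]
    simp only [Submodule.coe_zero, momentProd_zero hn, mul_zero, Finset.sum_const_zero]
  obtain ⟨h, hh, hh0⟩ := hex
  obtain ⟨C, hC⟩ := h.exists_forall_norm_le
  -- Scaled by the bound on `h` so that `|δ_k h| < 1` and the density stays positive; the second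
  -- added one makes this strict already at `k = 0`.
  let δ : ℕ → ℝ := fun k => 1 / (|C| + 1) * (1 / ((k : ℝ) + 1 + 1))
  have hδ0 : ∀ k, 0 < δ k := fun k => by positivity
  have hδ : Filter.Tendsto δ Filter.atTop (𝓝 0) := by
    have h1 := ((tendsto_one_div_add_atTop_nhds_zero_nat (𝕜 := ℝ)).comp
      (Filter.tendsto_add_atTop_nat 1)).const_mul (1 / (|C| + 1))
    rw [mul_zero] at h1
    refine h1.congr fun k => ?_
    simp [δ]
  have hpos : ∀ k x, 0 < 1 + δ k * h x := fun k x => by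
    have h1 : |h x| ≤ |C| := (hC x).trans (le_abs_self C)
    have h2 : δ k * (|C| + 1) < 1 := by
      have : (1 : ℝ) / ((k : ℝ) + 1 + 1) < 1 := by
        rw [div_lt_one (by positivity)]
        linarith [(Nat.cast_nonneg k : (0 : ℝ) ≤ k)]
      have h3 : |C| + 1 ≠ 0 := by positivity
      simp only [δ]
      rw [mul_right_comm, one_div_mul_cancel h3, one_mul]
      exact this
    have h4 : δ k * |h x| ≤ δ k * (|C| + 1) :=
      mul_le_mul_of_nonneg_left (by linarith) (hδ0 k).le
    have h5 : -(δ k * |h x|) ≤ δ k * h x := by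
      rw [← mul_neg]
      exact mul_le_mul_of_nonneg_left (neg_abs_le _) (hδ0 k).le
    linarith
  choose ν hν using fun k => exists_perturb μ hh (hpos k)
  have hνμ : ∀ k, ν k ≠ μ := fun k => perturb_ne μ (ν k) hh0 (hδ0 k).ne' (hpos k) (hν k)
  have hq : ∀ (b y : ℝ), Filter.Tendsto (fun k => (1 + δ k * y) ^ b) Filter.atTop (𝓝 1) := by
    intro b y
    have h1 := (hδ.mul_const y).const_add 1
    rw [zero_mul, add_zero] at h1
    simpa using h1.rpow_const (p := b) (Or.inl one_ne_zero)
  have hroot : Filter.Tendsto (fun k => rootPow r (ν k).base) Filter.atTop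
      (𝓝 (rootPow r μ.base)) :=
    (tendsto_simpleAct_map h (hq r) tendsto_const_nhds).congr fun k =>
      (rootPow_perturb r (hν k) (hpos k)).symm
  have hmass : Filter.Tendsto (fun k => (ν k).base.mass) Filter.atTop (𝓝 μ.base.mass) :=
    tendsto_measure_real r hroot MeasurableSet.univ
  have hev : ∀ᶠ k in Filter.atTop, 0 < (ν k).base.mass := hmass.eventually (lt_mem_nhds hμ)
  have hcoef : ∀ R, Filter.Tendsto (fun k => c (ν k).base.mass R) Filter.atTop
      (𝓝 (c μ.base.mass R)) := fun R => by
    refine ((continuousOn_coeff hn hc R) _ (μ.mass_mem hμ)).tendsto.comp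
      (tendsto_nhdsWithin_iff.2 ⟨hmass, ?_⟩)
    filter_upwards [hev] with k hk
    exact (ν k).mass_mem hk
  choose X hX hX' using fun i => exists_field μ (φ i)
  have hlim := tendsto_of_continuous_powTopology ((Θ Ω).continuous_form X) hroot
  simp only [hX] at hlim
  refine tendsto_nhds_unique hlim (Filter.Tendsto.congr'
    (f₁ := fun k => ∑ R, c (ν k).base.mass R *
      momentProd (ν k).base R fun i => ((X i).val (ν k) : Lp ℝ r.inv (ν k).base.1)) ?_ ?_)
  · filter_upwards [hev] with k hk
    exact ((hc _ ((ν k).mass_mem hk)).form_eq_of_simple fun i => hX' i (ν k) (hνμ k)).symm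
  refine tendsto_finsetSum _ fun R _ => ?_
  by_cases hR : ∀ B ∈ R.parts, (B.card : ℝ) ≤ 1 / (r : ℝ)
  · refine (hcoef R).mul (tendsto_finsetProd _ fun B hB => ?_)
    have hB0 : (B.card : ℝ) ≠ 0 := by
      exact_mod_cast (Finset.card_pos.2 (R.nonempty_of_mem_parts hB)).ne'
    choose χ hχ hχ' using fun k i => exists_densityPow_perturb (r := r) (hν k) (hpos k)
      (1 / (B.card : ℝ)) ((X i).val (ν k) : Lp ℝ r.inv (ν k).base.1)
    have h1 : ∀ i, Filter.Tendsto (fun k => χ k i) Filter.atTop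
        (𝓝 (φ i : Lp ℝ r.inv μ.base.1)) := fun i => by
      have h2 := tendsto_of_continuous_powTopology (X i).continuous_val hroot
      rw [hX] at h2
      have h3 := (tendsto_simpleAct_map h (hq (1 / (B.card : ℝ) - r)) h2).congr
        fun k => (hχ k i).symm
      rw [tendsto_iff_norm_sub_tendsto_zero] at h3 ⊢
      refine h3.congr fun k => ?_
      rw [← map_sub, norm_densityPow]
    refine (tendsto_integral_prod (hR B hB) h1).congr fun k => ?_
    rw [integral_perturb (hν k) (hpos k)]
    refine integral_congr_ae ?_
    filter_upwards [ae_all_iff.2 (hχ' k)] with x hx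
    simp only [hx]
    rw [Finset.prod_mul_distrib, Finset.prod_const, ← Real.rpow_mul_natCast (hpos k x).le,
      one_div_mul_cancel hB0, Real.rpow_one]
  · push Not at hR
    obtain ⟨B, hB, hBr⟩ := hR
    have hz : ∀ m ∈ s.masses, c m R = 0 := fun m hm =>
      (hc m hm).eq_zero_of_large_block hn hm hBr hB
    rw [hz _ (μ.mass_mem hμ), zero_mul]
    refine tendsto_const_nhds.congr' ?_
    filter_upwards [hev] with k hk
    rw [hz _ ((ν k).mass_mem hk), zero_mul]

end Extension

/-! ### The differential of a model -/

section ModelDifferential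

variable {Ω : Type u} [MeasurableSpace Ω] {r : Exponent}

theorem exists_nonneg_densityPow (r : Exponent) {μ ν : FinMeas Ω} (h : μ ≤ ν) :
    ∃ f : Lp ℝ r.inv ν.1, rootPow r μ = densityPow r ν f ∧
      f =ᵐ[ν.1] fun x => ((μ.1.rnDeriv ν.1 x).toReal) ^ (r : ℝ) := by
  have h1 : rescale r h (Lp.const r.inv μ.1 (1 : ℝ)) =ᵐ[ν.1]
      fun x => ((μ.1.rnDeriv ν.1 x).toReal) ^ (r : ℝ) := by
    refine (coeFn_rescale r h _).trans ((ae_imp_rescale r ν (Lp.coeFn_const ..)).trans ?_)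
    exact ae_of_all _ fun x => by simp
  exact ⟨_, rootPow_eq r h h1, h1⟩

/-- Densities of powers of measures are nonnegative, so adding a second one cannot decrease the
norm. -/
theorem norm_indicator_rootPow_le (r : Exponent) {A : Set Ω} (hA : MeasurableSet A)
    (μ ν : FinMeas Ω) :
    ‖simpleAct r (indicatorSimple A hA) (rootPow r μ)‖ ≤
      ‖simpleAct r (indicatorSimple A hA) (rootPow r μ) +
        simpleAct r (indicatorSimple A hA) (rootPow r ν)‖ := by
  obtain ⟨κ, h₁, h₂⟩ := exists_ge_ge μ ν
  obtain ⟨f, hf, hf'⟩ := exists_nonneg_densityPow r h₁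
  obtain ⟨g, hg, hg'⟩ := exists_nonneg_densityPow r h₂
  rw [hf, hg, ← map_add, ← map_add, simpleAct_densityPow, simpleAct_densityPow, norm_densityPow,
    norm_densityPow]
  refine Lp.norm_le_norm_of_ae_le ?_
  filter_upwards [coeFn_simpleMul r (indicatorSimple A hA) κ f,
    coeFn_simpleMul r (indicatorSimple A hA) κ (f + g), Lp.coeFn_add f g, hf', hg']
    with x h1 h2 h3 h4 h5
  rw [h1, h2, h3, Pi.add_apply, norm_mul, norm_mul]
  have hf0 : 0 ≤ f x := by rw [h4]; positivity
  have hg0 : 0 ≤ g x := by rw [h5]; positivity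
  refine mul_le_mul_of_nonneg_left ?_ (norm_nonneg _)
  rw [Real.norm_of_nonneg hf0, Real.norm_of_nonneg (add_nonneg hf0 hg0)]
  linarith

/-- The even combination `F(t) + F(-t)` has zero derivative at the origin, hence is `o(t)`; it
dominates `F`, so `F` is `o(t)` as well. -/
theorem eq_zero_of_hasDerivAt_of_norm_le {V : Type*} [NormedAddCommGroup V] [NormedSpace ℝ V]
    {F : ℝ → V} {F' : V} (hF : HasDerivAt F F' 0) (h0 : F 0 = 0)
    (hle : ∀ t, ‖F t‖ ≤ ‖F t + F (-t)‖) : F' = 0 := by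
  have h1 : HasDerivAt (fun t => F t + F (-t)) 0 0 := by
    have h2 : HasDerivAt (fun t : ℝ => F (-t)) (-F') 0 := by
      have h3 : HasDerivAt F F' (-(0 : ℝ)) := by rwa [neg_zero]
      have h4 := h3.scomp (0 : ℝ) (hasDerivAt_neg 0)
      rw [neg_one_smul] at h4
      exact h4
    have h5 := hF.add h2
    rw [add_neg_cancel] at h5
    exact h5
  refine hF.unique ?_
  rw [hasDerivAt_iff_isLittleO] at h1 ⊢
  simp only [neg_zero, h0, add_zero, sub_zero, smul_zero] at h1 ⊢
  refine (Asymptotics.IsBigO.of_bound 1 (Filter.Eventually.of_forall fun t => ?_)).trans_isLittleO h1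
  rw [one_mul]
  exact hle t

/-- Division by `(dμ/dκ)^r` where this is nonzero inverts the rescaling, and nothing is lost
elsewhere because `ψ` vanishes there. -/
theorem exists_densityPow_of_vanish (r : Exponent) {μ κ : FinMeas Ω} (h : μ ≤ κ)
    (ψ : Lp ℝ r.inv κ.1) (hψ : ∀ᵐ x ∂κ.1, μ.1.rnDeriv κ.1 x = 0 → ψ x = 0) :
    ∃ φ : Lp ℝ r.inv μ.1, densityPow r μ φ = densityPow r κ ψ := by
  let g : Ω → ℝ := fun x => ((μ.1.rnDeriv κ.1 x).toReal) ^ (r : ℝ)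
  have hg : Measurable g := (Measure.measurable_rnDeriv _ _).ennreal_toReal.pow_const _
  have hm : Measurable fun x => ψ x * (g x)⁻¹ :=
    (Lp.stronglyMeasurable ψ).measurable.mul hg.inv
  have h1 : (fun x => ψ x * (g x)⁻¹ * g x) =ᵐ[κ.1] ψ := by
    filter_upwards [hψ, Measure.rnDeriv_lt_top μ.1 κ.1] with x hx hx'
    by_cases h0 : μ.1.rnDeriv κ.1 x = 0
    · rw [hx h0, zero_mul, zero_mul]
    · have : g x ≠ 0 := (Real.rpow_pos_of_pos (ENNReal.toReal_pos h0 hx'.ne) _).ne'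
      rw [inv_mul_cancel_right₀ this]
  have h2 : MemLp (fun x => ψ x * (g x)⁻¹) r.inv μ.1 := by
    refine ⟨hm.aestronglyMeasurable, ?_⟩
    rw [← eLpNorm_rescale r h hm.stronglyMeasurable]
    refine (eLpNorm_congr_ae h1).trans_lt ?_
    exact Lp.eLpNorm_lt_top ψ
  refine ⟨h2.toLp _, densityPow_eq r h ?_⟩
  exact (h1.symm.trans (ae_imp_rescale r κ h2.coeFn_toLp).symm)

variable {E : Type w} [NormedAddCommGroup E] [NormedSpace ℝ E]

/-- The derivative of `x ↦ μ_x^r` is dominated by `μ_x`. -/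
theorem exists_densityPow_eq_fderiv {f : E → FinMeas Ω} {D : E →L[ℝ] RootMeas r Ω} {x₀ : E}
    (hD : HasFDerivAt (fun x => rootPow r (f x)) D x₀) (v : E) :
    ∃ φ : Lp ℝ r.inv (f x₀).1, densityPow r (f x₀) φ = D v := by
  obtain ⟨κ₀, ψ₀, hψ₀⟩ := exists_densityPow r (D v)
  obtain ⟨κ, h₁, h₂⟩ := exists_ge_ge (f x₀) κ₀
  rw [← densityPow_rescale r h₂] at hψ₀
  set ψ := rescale r h₂ ψ₀
  -- The part of `κ` not seen by `μ_{x₀}`. Along a line through `x₀`, the restriction of `μ_x^r` to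
  -- `A` is nonnegative and vanishes at `x₀`, which forces its derivative to vanish.
  let A : Set Ω := {x | (f x₀).1.rnDeriv κ.1 x = 0}
  have hA : MeasurableSet A := Measure.measurable_rnDeriv _ _ (measurableSet_singleton 0)
  let L := simpleAct r (indicatorSimple A hA)
  have hL0 : L (rootPow r (f x₀)) = 0 := by
    obtain ⟨g, hg, hg'⟩ := exists_nonneg_densityPow r h₁
    change simpleAct r (indicatorSimple A hA) _ = 0
    rw [hg, simpleAct_densityPow, ← map_zero (densityPow r κ)]
    congr 1
    refine Lp.ext ((coeFn_simpleMul r _ κ g).trans ?_)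
    filter_upwards [hg', Lp.coeFn_zero ℝ r.inv κ.1] with x hx hx'
    rw [hx, hx', coe_indicatorSimple, Pi.zero_apply]
    by_cases h0 : x ∈ A
    · rw [show (f x₀).1.rnDeriv κ.1 x = 0 from h0, ENNReal.toReal_zero,
        Real.zero_rpow r.2.1.ne', mul_zero]
    · rw [Set.indicator_of_notMem h0, zero_mul]
  have hline : HasDerivAt (fun t : ℝ => x₀ + t • v) v 0 := by
    simpa using ((hasDerivAt_id (0 : ℝ)).smul_const v).const_add x₀
  have hF : HasDerivAt (fun t : ℝ => L (rootPow r (f (x₀ + t • v)))) (L (D v)) 0 := by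
    have h1 : HasFDerivAt (fun x => rootPow r (f x)) D (x₀ + (0 : ℝ) • v) := by
      simpa using hD
    have h2 := h1.comp_hasDerivAt (0 : ℝ) hline
    exact L.hasFDerivAt.comp_hasDerivAt (0 : ℝ) h2
  have hzero : L (D v) = 0 := eq_zero_of_hasDerivAt_of_norm_le hF (by simpa using hL0)
    fun t => norm_indicator_rootPow_le r hA _ _
  rw [← hψ₀]
  refine exists_densityPow_of_vanish r h₁ ψ ?_
  have h3 : simpleMul r (indicatorSimple A hA) κ ψ = 0 := by
    apply densityPow_injective r κ
    rw [map_zero, ← simpleAct_densityPow, hψ₀]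
    exact hzero
  have h4 := coeFn_simpleMul r (indicatorSimple A hA) κ ψ
  rw [h3] at h4
  filter_upwards [h4, Lp.coeFn_zero ℝ r.inv κ.1] with x h5 h6 h7
  rw [h6, coe_indicatorSimple, Set.indicator_of_mem (show x ∈ A from h7), Pi.one_apply,
    one_mul] at h5
  exact h5.symm

theorem norm_rootPow (r : Exponent) {μ : FinMeas Ω} (hμ : μ.1 univ = 1) : ‖rootPow r μ‖ = 1 := by
  rw [rootPow, norm_densityPow, Lp.norm_const' _ _ _ r.inv_ne_zero r.inv_ne_top]
  simp [Measure.real, hμ]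

/-- For a probability measure `μ`, the form `φ μ^r ↦ ∫ φ dμ` extends to `S^r(Ω)` with norm at most
one. -/
theorem exists_dual_integral (r : Exponent) {μ : FinMeas Ω} (hμ : μ.1 univ = 1) :
    ∃ ℓ : StrongDual ℝ (RootMeas r Ω), ‖ℓ‖ ≤ 1 ∧
      ∀ φ : Lp ℝ r.inv μ.1, ℓ (densityPow r μ φ) = ∫ x, φ x ∂μ.1 := by
  let e := LinearEquiv.ofInjective (densityPow r μ) (densityPow_injective r μ)
  have hbound : ∀ x : (densityPow r μ).range,
      ‖(tangentForm .probabilities r μ ∘ₗ e.symm.toLinearMap) x‖ ≤ 1 * ‖x‖ := fun x => by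
    obtain ⟨φ, rfl⟩ := e.surjective x
    rw [LinearMap.comp_apply, LinearEquiv.coe_coe, e.symm_apply_apply, one_mul]
    refine (abs_integral_le_norm r hμ φ).trans (le_of_eq ?_)
    exact (norm_densityPow r μ φ).symm
  obtain ⟨ℓ, h1, h2⟩ := exists_extension_norm_eq (densityPow r μ).range
    (LinearMap.mkContinuous _ 1 hbound)
  refine ⟨ℓ, ?_, fun φ => ?_⟩
  · rw [h2]
    exact LinearMap.mkContinuous_norm_le _ zero_le_one _
  · have h3 := h1 (e φ)
    rw [LinearMap.mkContinuous_apply, LinearMap.comp_apply, LinearEquiv.coe_coe,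
      e.symm_apply_apply] at h3
    exact h3

/-- Powers of probability measures lie on the unit sphere of `S^r(Ω)`. The functional extending `φ ↦
∫ φ dμ` has norm at most one and equals one at `μ^r`, so it is maximal there and its derivative `∫ φ
dμ` is zero. -/
theorem mem_tangent_of_fderiv {s : Setting} {f : E → Point s Ω} {D : E →L[ℝ] RootMeas r Ω}
    {x₀ : E} (hD : HasFDerivAt (fun x => rootPow r (f x).base) D x₀) {v : E}
    {φ : Lp ℝ r.inv (f x₀).base.1} (hφ : densityPow r (f x₀).base φ = D v) :
    φ ∈ tangent s r (f x₀).base := by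
  cases s with
  | measures => exact Submodule.mem_top
  | probabilities =>
    obtain ⟨ℓ, hℓ, hℓ'⟩ := exists_dual_integral r (f x₀).admits
    have h1 : ℓ (rootPow r (f x₀).base) = 1 := by
      have h : (f x₀).base.1 univ = 1 := (f x₀).admits
      rw [rootPow, hℓ', integral_congr_ae (Lp.coeFn_const ..)]
      simp [Measure.real, h]
    have hmax : IsLocalMax (fun x => ℓ (rootPow r (f x).base)) x₀ :=
      Filter.Eventually.of_forall fun x => by
        simp only [h1]
        refine (le_abs_self _).trans ((ℓ.le_opNorm _).trans ?_)
        rw [norm_rootPow r (f x).admits, mul_one]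
        exact hℓ
    have h2 := hmax.hasFDerivAt_eq_zero (ℓ.hasFDerivAt.comp x₀ hD)
    have h3 := DFunLike.congr_fun h2 v
    change ∫ x, φ x ∂(f x₀).base.1 = 0
    rw [← hℓ', hφ]
    exact h3

variable {M : Type v} [TopologicalSpace M] [ChartedSpace E M]

theorem exists_isRootDifferential {s : Setting} {p : M → Point s Ω}
    (hp : IsIntegrableModel (E := E) r p) (ξ : M) :
    ∃ D : TangentSpace 𝓘(ℝ, E) ξ →ₗ[ℝ] tangent s r (p ξ).base, IsRootDifferential r p ξ D := by
  have hmd : MDifferentiableAt 𝓘(ℝ, E) 𝓘(ℝ, RootMeas r Ω) (fun ζ => rootPow r (p ζ).base) ξ :=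
    (hp.2 ξ).mdifferentiableAt (by simp)
  let T : E →L[ℝ] RootMeas r Ω :=
    mfderiv 𝓘(ℝ, E) 𝓘(ℝ, RootMeas r Ω) (fun ζ => rootPow r (p ζ).base) ξ
  let f : E → Point s Ω := fun x => p ((extChartAt 𝓘(ℝ, E) ξ).symm x)
  let x₀ : E := extChartAt 𝓘(ℝ, E) ξ ξ
  have hfx : f x₀ = p ξ := congrArg p (extChartAt_to_inv (I := 𝓘(ℝ, E)) ξ)
  have hT : HasFDerivAt (fun x => rootPow r (f x).base) T x₀ := by
    have h1 := hmd.hasMFDerivAt.2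
    -- The manifold has no boundary, so the derivative in the chart is taken within the whole model
    -- space.
    simp only [modelWithCornersSelf_coe, range_id] at h1
    exact hasFDerivWithinAt_univ.1 h1
  -- The chart returns `p ξ` only up to a propositional equality, while the tangent space depends on
  -- the point; a variable point `q` permits substitution.
  have key : ∀ q : Point s Ω, f x₀ = q → ∀ v : E, ∃ φ : tangent s r q.base,
      densityPow r q.base (φ : Lp ℝ r.inv q.base.1) = T v := by
    rintro q rfl v
    obtain ⟨φ, hφ⟩ := exists_densityPow_eq_fderiv hT v
    exact ⟨⟨φ, mem_tangent_of_fderiv hT hφ⟩, hφ⟩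
  choose D hD using key (p ξ) hfx
  let D' : E →ₗ[ℝ] tangent s r (p ξ).base :=
    { toFun := D, map_add' := fun v w => ?_, map_smul' := fun c v => ?_ }
  · exact ⟨D', hD⟩
  · apply Subtype.ext
    apply densityPow_injective r
    rw [hD, Submodule.coe_add, map_add T, map_add (densityPow r _), hD, hD]
  · apply Subtype.ext
    apply densityPow_injective r
    rw [hD, RingHom.id_apply, Submodule.coe_smul, map_smul T, map_smul (densityPow r _), hD]

end ModelDifferential

/-! ### Generated families -/

section Generated

variable {r : Exponent} {n : ℕ}

theorem partitionTensor_formalDeriv {Ω Ω' : Type u} [MeasurableSpace Ω] [MeasurableSpace Ω']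
    {K : Kernel Ω Ω'} [IsMarkovKernel K] (hK : IsCongruentKernel K) (μ : FinMeas Ω)
    (R : ArgPartition n) (φ : Fin n → Lp ℝ r.inv μ.1) :
    partitionTensor r (μ.push K) R (fun i => formalDeriv r K μ (φ i))
      = partitionTensor r μ R φ := by
  obtain ⟨κ, hκ, h⟩ := hK
  rw [partitionTensor_eq_momentProd r _ R fun i => formalDeriv_congruent r hκ h μ (φ i),
    partitionTensor_eq_momentProd r μ R fun i => Filter.EventuallyEq.rfl]
  congr 1
  exact Finset.prod_congr rfl fun B _ => integral_comp_congruent hκ h μ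
    (f := fun x => ∏ i ∈ B, φ i x)
    (Finset.measurable_prod B fun i _ => (Lp.stronglyMeasurable (φ i)).measurable)

theorem HasMeasureForm.isCongruentFamily {Θ : TensorFamily.{u} .measures r n}
    {a : BlockPartition r n 1 → C(Set.Ioi (0 : ℝ), ℝ)} (h : HasMeasureForm Θ a) :
    IsCongruentFamily Θ := by
  intro Ω Ω' _ _ K _ hK μ
  ext φ
  rw [pullback, MultilinearMap.compLinearMap_apply, h, h]
  refine Finset.sum_congr rfl fun P _ => ?_
  rw [mass_push]
  congr 1
  exact partitionTensor_formalDeriv hK μ.base P.1 _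

theorem HasProbabilityForm.isCongruentFamily {Θ : TensorFamily.{u} .probabilities r n}
    {c : BlockPartition r n 2 → ℝ} (h : HasProbabilityForm Θ c) : IsCongruentFamily Θ := by
  intro Ω Ω' _ _ K _ hK μ
  ext φ
  rw [pullback, MultilinearMap.compLinearMap_apply, h, h]
  refine Finset.sum_congr rfl fun P _ => ?_
  congr 1
  exact partitionTensor_formalDeriv hK μ.base P.1 _

theorem IsCongruentFamily.isFinitelyCongruentFamily {s : Setting} {Θ : TensorFamily.{u} s r n}
    (h : IsCongruentFamily Θ) : IsFinitelyCongruentFamily Θ :=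
  fun I Ω _ _ _ _ K _ hK μ => h I Ω K hK μ

theorem sum_blockPartition {b : ℕ} (F : ArgPartition n → ℝ)
    (hF : ∀ R : ArgPartition n,
      ¬ (∀ B ∈ R.parts, b ≤ B.card ∧ (B.card : ℝ) ≤ 1 / (r : ℝ)) → F R = 0) :
    ∑ P : BlockPartition r n b, F P.1 = ∑ R, F R :=
  Finset.sum_of_injOn Subtype.val Subtype.val_injective.injOn (fun _ _ => Finset.mem_univ _)
    (fun R _ hR => hF R fun h => hR ⟨⟨R, h⟩, Finset.mem_univ _, rfl⟩) fun _ _ => rfl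

/-- Large blocks have zero coefficient and small ones zero moment by `hb`; the factor `r^n` undoes
the normalisation of the canonical tensors. The bound `b` is `1` for measures, where `hb` is
vacuous, and `2` for probability measures. -/
theorem form_eq_sum_blockPartition {s : Setting} {Θ : TensorFamily.{u} s r n} (hn : 1 ≤ n)
    {c : ℝ → ArgPartition n → ℝ}
    (hc : ∀ m ∈ s.masses, HasCoeff Θ m (c m)) {Ω : Type u} [MeasurableSpace Ω] (μ : Point s Ω)
    (hμ : 0 < μ.base.mass) (φ : Fin n → tangent s r μ.base) {b : ℕ}
    (hb : ∀ R : ArgPartition n, (∃ B ∈ R.parts, B.card < b) →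
      momentProd μ.base R (fun i => (φ i : Lp ℝ r.inv μ.base.1)) = 0) :
    (Θ Ω).form μ φ = ∑ P : BlockPartition r n b, (r : ℝ) ^ n * c μ.base.mass P.1 *
      partitionTensor r μ.base P.1 fun i => (φ i : Lp ℝ r.inv μ.base.1) := by
  have hr : (r : ℝ) ^ n ≠ 0 := (pow_pos r.2.1 n).ne'
  rw [form_eq_of_hasCoeff hn hc μ hμ φ, ← sum_blockPartition (r := r) (b := b)]
  · refine Finset.sum_congr rfl fun P _ => ?_
    rw [partitionTensor_eq_momentProd r μ.base P.1 fun i => Filter.EventuallyEq.rfl]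
    field_simp
  · intro R hR
    push Not at hR
    obtain ⟨B, hB, h⟩ := hR
    by_cases hbB : b ≤ B.card
    · rw [(hc _ (μ.mass_mem hμ)).eq_zero_of_large_block hn (μ.mass_mem hμ) (h hbB) hB, zero_mul]
    · rw [hb R ⟨B, hB, not_le.1 hbB⟩, mul_zero]

theorem eq_zero_of_mass_eq_zero {Ω : Type u} [MeasurableSpace Ω] {μ : FinMeas Ω}
    (h : μ.mass = 0) (φ : Lp ℝ r.inv μ.1) : φ = 0 := by
  have h0 : μ.1 = 0 := by
    rw [FinMeas.mass, measureReal_eq_zero_iff] at h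
    exact Measure.measure_univ_eq_zero.1 h
  refine Lp.ext ?_
  refine ae_iff.2 (measure_mono_null (Set.subset_univ _) ?_)
  rw [h0]
  rfl

theorem exists_hasMeasureForm (hn : 1 ≤ n) {Θ : TensorFamily.{u} .measures r n}
    (hΘ : IsFinitelyCongruentFamily Θ) : ∃ a, HasMeasureForm Θ a := by
  choose! c hc using fun m (hm : m ∈ Setting.measures.masses) => exists_hasCoeff hn hΘ hm
  refine ⟨fun P => ⟨fun m => (r : ℝ) ^ n * c m P.1, continuous_const.mul
    (continuousOn_iff_continuous_domRestrict.1 (continuousOn_coeff hn hc P.1))⟩,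
    fun Ω _ μ φ => ?_⟩
  have hμ : 0 ≤ μ.base.mass := measureReal_nonneg (μ := μ.base.1)
  rcases eq_or_lt_of_le hμ with h | h
  · rw [(Θ Ω).form μ |>.map_coord_zero ⟨0, hn⟩
      (Subtype.ext (eq_zero_of_mass_eq_zero h.symm _)), generatedOnMeasures]
    refine (Finset.sum_eq_zero fun P _ => ?_).symm
    rw [coeffAt, dif_neg (by rw [← h]; exact lt_irrefl 0), zero_mul]
  · rw [form_eq_sum_blockPartition hn hc μ h φ (b := 1)]
    · refine Finset.sum_congr rfl fun P _ => ?_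
      rw [coeffAt, dif_pos h]
      rfl
    · rintro R ⟨B, hB, hB1⟩
      exact absurd (Finset.card_pos.2 (R.nonempty_of_mem_parts hB)) (by omega)

theorem exists_hasProbabilityForm (hn : 1 ≤ n) {Θ : TensorFamily.{u} .probabilities r n}
    (hΘ : IsFinitelyCongruentFamily Θ) : ∃ c, HasProbabilityForm Θ c := by
  choose! c hc using fun m (hm : m ∈ Setting.probabilities.masses) => exists_hasCoeff hn hΘ hm
  refine ⟨fun P => (r : ℝ) ^ n * c 1 P.1, fun Ω _ μ φ => ?_⟩
  have hmass : μ.base.mass = 1 := by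
    have h : μ.base.1 univ = 1 := μ.admits
    simp [FinMeas.mass, Measure.real, h]
  rw [form_eq_sum_blockPartition hn hc μ (hmass ▸ one_pos) φ (b := 2), hmass]
  · rfl
  -- A block with fewer than two elements is a singleton, whose moment `∫ φ_i dμ` is zero by
  -- tangency.
  · rintro R ⟨B, hB, hB1⟩
    have hB0 := Finset.card_pos.2 (R.nonempty_of_mem_parts hB)
    obtain ⟨i, rfl⟩ := Finset.card_eq_one.1 (show B.card = 1 by omega)
    refine Finset.prod_eq_zero hB ?_
    simp only [Finset.prod_singleton]
    exact (φ i).2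

/-- At each mass `m`, equal weights on `n` points already separate all partition tensors. -/
theorem HasMeasureForm.unique (hn : 1 ≤ n) {Θ : TensorFamily.{u} .measures r n}
    {a a' : BlockPartition r n 1 → C(Set.Ioi (0 : ℝ), ℝ)} (h : HasMeasureForm Θ a)
    (h' : HasMeasureForm Θ a') : a = a' := by
  classical
  have hr : (r : ℝ) ^ n ≠ 0 := (pow_pos r.2.1 n).ne'
  have hn0 : (0 : ℝ) < n := by exact_mod_cast hn
  ext P ⟨m, hm⟩
  have hm0 : 0 < m := hm
  let I := ULift.{u} (Fin n)
  let _ : MeasurableSpace I := ⊤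
  have : DiscreteMeasurableSpace I := ⟨fun _ => trivial⟩
  have hI : Fintype.card I = n := by simp [I]
  have hsum : ∑ _ : I, m / n = m := by
    rw [Finset.sum_const, Finset.card_univ, hI, nsmul_eq_mul, mul_div_cancel₀ _ hn0.ne']
  obtain ⟨ν, hν⟩ := Point.exists_of_weights (s := .measures) (I := I) (fun _ => m / n)
    (fun _ => by positivity) (hsum.symm ▸ hm)
  have hmass : ν.base.mass = m := by
    rw [mass_eq_sum_singleton]
    simp only [hν, hsum]
  -- The difference of the coefficients, extended by zero to the excluded partitions so that
  -- inversion over all partitions applies.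
  let d : ArgPartition n → ℝ := fun R =>
    if hR : ∀ B ∈ R.parts, 1 ≤ B.card ∧ (B.card : ℝ) ≤ 1 / (r : ℝ) then
      a ⟨R, hR⟩ ⟨m, hm⟩ - a' ⟨R, hR⟩ ⟨m, hm⟩ else 0
  have hd : d = 0 := by
    refine eq_zero_of_sum_momentProd (w := m / n) (by positivity) hν hI.ge d fun f => ?_
    rw [← sum_blockPartition (r := r) (b := 1) _ fun R hR => by
      simp only [d, dif_neg hR, zero_mul]]
    have h1 := (h I ν fun i => ⟨simpleLp r _ (simpleOfFinite (f i)), Submodule.mem_top⟩).symm.trans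
      (h' I ν _)
    rw [generatedOnMeasures, generatedOnMeasures, ← sub_eq_zero, ← Finset.sum_sub_distrib] at h1
    simp only [partitionTensor_eq_momentProd r ν.base _ fun i =>
      coeFn_simpleLp r ν.base (simpleOfFinite (f i)), hmass, coeffAt, hm0, dif_pos,
      coe_simpleOfFinite, ← sub_mul] at h1
    rw [← mul_right_inj' (one_div_ne_zero hr), mul_zero, Finset.mul_sum]
    refine (Finset.sum_congr rfl fun P _ => ?_).trans h1
    simp only [d, dif_pos P.2]
    ring
  have h1 := congrFun hd P.1
  simp only [d, dif_pos P.2, Pi.zero_apply] at h1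
  exact sub_eq_zero.1 h1

/-- A function on three points with mean zero, all of whose higher moments are nonzero. -/
def skewVector : Fin 3 → ℝ := ![2, -1, -1]

theorem sum_skewVector_pow (k : ℕ) : ∑ y, skewVector y ^ k = 2 ^ k + 2 * (-1) ^ k := by
  simp [skewVector, Fin.sum_univ_three]
  ring

/-- For `k ≥ 2` the sum is at least `4 - 2`. Two points with values `1, -1` would not do, since
their odd moments vanish. -/
theorem sum_skewVector_pow_ne_zero {k : ℕ} (hk : 2 ≤ k) : ∑ y, skewVector y ^ k ≠ 0 := by
  rw [sum_skewVector_pow]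
  have h1 : (2 : ℝ) ^ 2 ≤ 2 ^ k := pow_le_pow_right₀ (by norm_num) hk
  rcases neg_one_pow_eq_or ℝ k with h | h <;> rw [h] <;> linarith

/-- Indicators of points are not tangent to probability measures. Each point is therefore replaced
by three, and the indicator is multiplied by `skewVector`. The mean becomes zero, while a block
integral only gains the factor `w ∑ skewVector^|B|`, nonzero for `|B| ≥ 2`, so the triangular system
survives. -/
theorem HasProbabilityForm.unique (hn : 1 ≤ n) {Θ : TensorFamily.{u} .probabilities r n}
    {c c' : BlockPartition r n 2 → ℝ} (h : HasProbabilityForm Θ c)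
    (h' : HasProbabilityForm Θ c') : c = c' := by
  classical
  have hr : (r : ℝ) ^ n ≠ 0 := (pow_pos r.2.1 n).ne'
  have hn0 : (0 : ℝ) < n := by exact_mod_cast hn
  let J := ULift.{u} (Fin n)
  let I := J × Fin 3
  let _ : MeasurableSpace I := ⊤
  have : DiscreteMeasurableSpace I := ⟨fun _ => trivial⟩
  let w : ℝ := 1 / (n * 3)
  have hw : 0 < w := by positivity
  obtain ⟨ν, hν⟩ := Point.exists_of_weights (s := .probabilities) (I := I) (fun _ => w)
    (fun _ => hw.le) (by
      rw [Finset.sum_const, Finset.card_univ, nsmul_eq_mul]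
      simp only [I, J, Fintype.card_prod, Fintype.card_ulift, Fintype.card_fin, w, Setting.masses,
        mem_singleton_iff]
      push_cast
      field_simp)
  let f : (Fin n → J) → Fin n → I → ℝ := fun j i x =>
    (Pi.single (j i) (1 : ℝ) : J → ℝ) x.1 * skewVector x.2
  have hint : ∀ j (B : Finset (Fin n)), ∫ x, ∏ i ∈ B, f j i x ∂ν.base.1 =
      ∑ x, w * (∑ y, skewVector y ^ B.card) * ∏ i ∈ B, (Pi.single (j i) (1 : ℝ) : _ → ℝ) x := by
    intro j B
    rw [integral_eq_sum_singleton, Fintype.sum_prod_type]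
    refine Finset.sum_congr rfl fun x _ => ?_
    simp only [f, hν, Finset.prod_mul_distrib, Finset.prod_const]
    rw [← Finset.mul_sum, ← Finset.mul_sum]
    ring
  have htan : ∀ j i, simpleLp r ν.base (simpleOfFinite (f j i)) ∈
      tangent .probabilities r ν.base := fun j i => by
    change ∫ x, _ ∂ν.base.1 = 0
    rw [integral_congr_ae (coeFn_simpleLp r ν.base _), coe_simpleOfFinite]
    have h1 := hint j {i}
    simp only [Finset.prod_singleton, Finset.card_singleton, sum_skewVector_pow] at h1
    rw [h1]
    norm_num
  have hmom : ∀ {Q : ArgPartition n} {j : Fin n → J}, IsKernelOf Q j → ∀ R,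
      momentProd ν.base R (f j) =
        if R ≤ Q then ∏ B ∈ R.parts, w * (∑ y, skewVector y ^ B.card) else 0 := by
    intro Q j hj R
    simp only [← hj.constOnBlocks_iff]
    have h1 : ∀ B ∈ R.parts, ∫ x, ∏ i ∈ B, f j i x ∂ν.base.1 =
        if ∀ k ∈ B, ∀ l ∈ B, j k = j l then w * (∑ y, skewVector y ^ B.card) else 0 :=
      fun B hB => by
        obtain ⟨i, hi⟩ := R.nonempty_of_mem_parts hB
        rw [hint, sum_mul_prod_single hi j fun _ => w * (∑ y, skewVector y ^ B.card)]
    rw [momentProd, Finset.prod_congr rfl h1, Finset.prod_ite_zero]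
    by_cases hR : ConstOnBlocks R j
    · rw [if_pos hR]
      exact if_pos hR
    · rw [if_neg hR]
      exact if_neg hR
  let d : ArgPartition n → ℝ := fun R =>
    if hR : ∀ B ∈ R.parts, 2 ≤ B.card ∧ (B.card : ℝ) ≤ 1 / (r : ℝ) then c ⟨R, hR⟩ - c' ⟨R, hR⟩
    else 0
  have hd := eq_zero_of_sum_Iic
    (fun R => d R * ∏ B ∈ R.parts, w * (∑ y, skewVector y ^ B.card)) fun Q => by
      right
      obtain ⟨j, hj⟩ := exists_isKernelOf_of_le_card (I := J) (by simp [J]) Q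
      have h1 := (h I ν fun i => ⟨_, htan j i⟩).symm.trans (h' I ν _)
      rw [generatedOnProbabilities, generatedOnProbabilities, ← sub_eq_zero,
        ← Finset.sum_sub_distrib] at h1
      simp only [partitionTensor_eq_momentProd r ν.base _ fun i =>
        coeFn_simpleLp r ν.base (simpleOfFinite (f j i)), coe_simpleOfFinite, ← sub_mul] at h1
      have h2 : ∑ R, d R * momentProd ν.base R (f j) = 0 := by
        rw [← sum_blockPartition (r := r) (b := 2) _ fun R hR => by
          simp only [d, dif_neg hR, zero_mul]]
        rw [← mul_right_inj' (one_div_ne_zero hr), mul_zero, Finset.mul_sum]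
        refine (Finset.sum_congr rfl fun P _ => ?_).trans h1
        simp only [d, dif_pos P.2]
        ring
      refine (Finset.sum_congr rfl fun R _ => ?_).trans h2
      rw [hmom hj, mul_ite, mul_zero]
  ext P
  have h1 := congrFun hd P.1
  have h2 : ∏ B ∈ P.1.parts, w * (∑ y, skewVector y ^ B.card) ≠ 0 :=
    Finset.prod_ne_zero_iff.2 fun B hB =>
      mul_ne_zero hw.ne' (sum_skewVector_pow_ne_zero (P.2 B hB).1)
  have h3 := (mul_eq_zero.1 h1).resolve_right h2
  simp only [d, dif_pos P.2] at h3
  exact sub_eq_zero.1 h3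

end Generated

end CongruentTensors

end

theorem mainTheorem1 (r : Exponent) (n : ℕ) (hn : 1 ≤ n) :
    (∀ Θ : TensorFamily.{u} Setting.measures r n,
      List.TFAE
        [IsCongruentFamily Θ,
         IsFinitelyCongruentFamily Θ,
         ∃! a : BlockPartition r n 1 → C(Set.Ioi (0 : ℝ), ℝ), HasMeasureForm Θ a] ∧
      (IsCongruentFamily Θ →
        ∃ a : BlockPartition r n 1 → C(Set.Ioi (0 : ℝ), ℝ),
          HasMeasureForm Θ a ∧
          ∀ (Ω : Type u) [MeasurableSpace Ω]
            (E : Type w) [NormedAddCommGroup E] [NormedSpace ℝ E]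
            (M : Type v) [TopologicalSpace M] [ChartedSpace E M] [IsManifold 𝓘(ℝ, E) 1 M]
            (p : M → Point Setting.measures Ω), IsIntegrableModel (E := E) r p →
            ∀ ξ : M, ∃ D : TangentSpace 𝓘(ℝ, E) ξ →ₗ[ℝ] tangent Setting.measures r (p ξ).base,
              IsRootDifferential r p ξ D ∧
              ∀ V : Fin n → TangentSpace 𝓘(ℝ, E) ξ,
                modelPullback (Θ Ω) p ξ D V =
                  ∑ P, coeffAt (a P) (p ξ).base.mass * modelPartitionTensor p ξ D P.1 V)) ∧
    (∀ Θ : TensorFamily.{u} Setting.probabilities r n,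
      List.TFAE
        [IsCongruentFamily Θ,
         IsFinitelyCongruentFamily Θ,
         ∃! c : BlockPartition r n 2 → ℝ, HasProbabilityForm Θ c] ∧
      (IsCongruentFamily Θ →
        ∃ c : BlockPartition r n 2 → ℝ,
          HasProbabilityForm Θ c ∧
          ∀ (Ω : Type u) [MeasurableSpace Ω]
            (E : Type w) [NormedAddCommGroup E] [NormedSpace ℝ E]
            (M : Type v) [TopologicalSpace M] [ChartedSpace E M] [IsManifold 𝓘(ℝ, E) 1 M]
            (p : M → Point Setting.probabilities Ω), IsIntegrableModel (E := E) r p →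
            ∀ ξ : M,
              ∃ D : TangentSpace 𝓘(ℝ, E) ξ →ₗ[ℝ] tangent Setting.probabilities r (p ξ).base,
              IsRootDifferential r p ξ D ∧
              ∀ V : Fin n → TangentSpace 𝓘(ℝ, E) ξ,
                modelPullback (Θ Ω) p ξ D V =
                  ∑ P, c P * modelPartitionTensor p ξ D P.1 V)) := by
  refine ⟨fun Θ => ⟨?_, fun hΘ => ?_⟩, fun Θ => ⟨?_, fun hΘ => ?_⟩⟩
  · tfae_have 1 → 2 := IsCongruentFamily.isFinitelyCongruentFamily
    tfae_have 2 → 3 := fun h => by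
      obtain ⟨a, ha⟩ := exists_hasMeasureForm hn h
      exact ⟨a, ha, fun a' ha' => ha'.unique hn ha⟩
    tfae_have 3 → 1 := fun ⟨_, ha, _⟩ => ha.isCongruentFamily
    tfae_finish
  · obtain ⟨a, ha⟩ := exists_hasMeasureForm hn hΘ.isFinitelyCongruentFamily
    refine ⟨a, ha, fun Ω _ E _ _ M _ _ _ p hp ξ => ?_⟩
    obtain ⟨D, hD⟩ := exists_isRootDifferential hp ξ
    -- The tensors of the model are by definition those of `Ω` evaluated at `D (V i)`, so the
    -- formula on `M^r(Ω)` is the claim.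
    exact ⟨D, hD, fun V => ha Ω (p ξ) fun i => D (V i)⟩
  · tfae_have 1 → 2 := IsCongruentFamily.isFinitelyCongruentFamily
    tfae_have 2 → 3 := fun h => by
      obtain ⟨c, hc⟩ := exists_hasProbabilityForm hn h
      exact ⟨c, hc, fun c' hc' => hc'.unique hn hc⟩
    tfae_have 3 → 1 := fun ⟨_, hc, _⟩ => hc.isCongruentFamily
    tfae_finish
  · obtain ⟨c, hc⟩ := exists_hasProbabilityForm hn hΘ.isFinitelyCongruentFamily
    refine ⟨c, hc, fun Ω _ E _ _ M _ _ _ p hp ξ => ?_⟩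
    obtain ⟨D, hD⟩ := exists_isRootDifferential hp ξ
    exact ⟨D, hD, fun V => hc Ω (p ξ) fun i => D (V i)⟩
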